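/- Let $H$ be a Hopf algebra over $\mathbb C$ with counit $\varepsilon$ and bijective antipode $S$ (Sweedler notation $\Delta(h)=h_1\otimes h_2$), and let $M$ be a right-left stable anti-Yetter--Drinfeld module over $H$: a right $H$-module and left $H$-comodule with $\rho(mh)=S(h_3)m_{(-1)}h_1\otimes m_{(0)}h_2$ and $m_{(0)}m_{(-1)}=m$. Small $\mathbb C$-linear semicategories are categories possibly without identities. A left $H$-semicategory is one whose morphism spaces are left $H$-modules with $h(gf)=(h_1g)(h_2f)$; a left $H$-category is one which moreover has identities, with $h\,\mathrm{id}_X=\varepsilon(h)\,\mathrm{id}_X$. Let $\mathcal D_H$ be a left $H$-category and $n\ge 0$. **Cochains.** Let $CN_n(\mathcal D_H)=\bigoplus_{(X_0,\dots,X_n)}\mathrm{Hom}(X_1,X_0)\otimes \mathrm{Hom}(X_2,X_1)\otimes\cdots\otimes \mathrm{Hom}(X_0,X_n)$ with the diagonal $H$-action, and let $C^n_H(\mathcal D_H,M)$ be the space of linear maps $\phi:M\otimes CN_n(\mathcal D_H)\to\mathbb C$ with $\phi(mh_1\otimes S(h_2)x)=\varepsilon(h)\phi(m\otimes x)$. For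 a linear map $\phi:M\otimes CN_n(\mathcal D_H)\to\mathbb C$ put $$(\tau_n\phi)(m\otimes f^0\otimes\cdots\otimes f^n)=\phi\big(m_{(0)}\otimes S^{-1}(m_{(-1)})f^n\otimes f^0\otimes\cdots\otimes f^{n-1}\big),$$ $$(b\phi)(m\otimes f^0\otimes\cdots\otimes f^{n+1})=\sum_{i=0}^{n}(-1)^i\phi(m\otimes f^0\otimes\cdots\otimes f^if^{i+1}\otimes\cdots\otimes f^{n+1})+(-1)^{n+1}\phi\big(m_{(0)}\otimes (S^{-1}(m_{(-1)})f^{n+1})f^0\otimes f^1\otimes\cdots\otimes f^{n}\big).$$ A Hopf-cyclic coboundary in $C^n_H(\mathcal D_H,M)$ is an element $b\psi$ with $\psi\in C^{n-1}_H(\mathcal D_H,M)$ and $(-1)^{n-1}\tau_{n-1}\psi=\psi$ (for $n=0$, only $0$ is a coboundary). **Cycles.** A DGH-semicategory $(\mathcal S_H,\hat\partial_H)$ is a small semicategory whose morphism spaces are $\mathbb N$-graded $\bigoplus_{n\ge0}\mathrm{Hom}^n_{\mathcal S_H}(X,Y)$, each $\mathrm{Hom}^n$ being a left $H$-module, with a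 bilinear associative composition which is additive on degrees and satisfies $h(gf)=(h_1g)(h_2f)$, and with an $H$-linear differential $\hat\partial_H$ of degree $1$ such that $\hat\partial_H^2=0$ and $\hat\partial_H(gf)=\hat\partial_H(g)f+(-1)^{\deg g}g\,\hat\partial_H(f)$. Its degree-$0$ part $\mathcal S_H^0$ is a left $H$-semicategory. An $n$-dimensional closed graded $(H,M)$-trace on it is a family of linear maps $\hat{\mathscr T}_X:M\otimes \mathrm{Hom}^n_{\mathcal S_H}(X,X)\to\mathbb C$ such that $$\hat{\mathscr T}_X(mh_1\otimes S(h_2)f)=\varepsilon(h)\hat{\mathscr T}_X(m\otimes f),\qquad \hat{\mathscr T}_X(m\otimes\hat\partial_H f')=0\ \ (\deg f'=n-1),$$ $$\hat{\mathscr T}_X(m\otimes g'g)=(-1)^{ij}\hat{\mathscr T}_Y\big(m_{(0)}\otimes(S^{-1}(m_{(-1)})g)g'\big)$$ for $g\in \mathrm{Hom}^i(X,Y)$, $g'\in \mathrm{Hom}^j(Y,X)$, $i+j=n$. An $n$-dimensional cycle over $\mathcal D_H$ is a tuple $(\mathcal S_H,\hat\partial_H,\hat{\mathscr T},\rho)$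 of such data and an $H$-linear semifunctor $\rho:\mathcal D_H\to\mathcal S_H^0$. Its character is $$m\otimes f^0\otimes\cdots\otimes f^n\longmapsto \hat{\mathscr T}_{\rho(X_0)}\big(m\otimes\rho(f^0)\,\hat\partial_H\rho(f^1)\cdots\hat\partial_H\rho(f^n)\big).$$ The cycle is *vanishing* if $\mathcal E:=\mathcal S_H^0$ is a left $H$-category and there are an $H$-linear semifunctor $\upsilon:\mathcal E\to\mathcal E$ with $\upsilon(X)=X$ for all objects $X$, and automorphisms $\eta(X)$ of the objects $X$ of $\mathcal E\otimes M_2(\mathbb C)$ with $h\,\eta(X)=\varepsilon(h)\eta(X)$ for all $h\in H$, such that $$\eta(Y)\circ\big(f\otimes E_{11}+\upsilon(f)\otimes E_{22}\big)\circ\eta(X)^{-1}=\upsilon(f)\otimes E_{22}$$ for all morphisms $f:X\to Y$ of $\mathcal E$. Here $\mathcal E\otimes M_2(\mathbb C)$ has the objects of $\mathcal E$, morphism spaces $\mathrm{Hom}_{\mathcal E}(X,Y)\otimes M_2(\mathbb C)$, composition $(g\otimes B)(f\otimes B')=gf\otimes BB'$ and action $h(f\otimes B)=hf\otimes B$. **Theorem.**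 An element $\phi\in C^n_H(\mathcal D_H,M)$ is a Hopf-cyclic coboundary if and only if it is the character of an $n$-dimensional vanishing cycle over $\mathcal D_H$. -/

import Mathlib

open scoped TensorProduct DirectSum

universe u v w

namespace HopfCyclic

noncomputable section

/-! ### Hopf algebras and stable anti-Yetter-Drinfeld modules -/

/-- The antipode of the Hopf algebra `H` is bijective. -/
class BijectiveAntipode (H : Type v) [Ring H] [HopfAlgebra ℂ H] : Prop where
  bijective : Function.Bijective (HopfAlgebra.antipode ℂ : H →ₗ[ℂ] H)

/-- The inverse `S⁻¹` of the antipode. -/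
def antipodeInv (H : Type v) [Ring H] [HopfAlgebra ℂ H] [BijectiveAntipode H] : H →ₗ[ℂ] H :=
  (LinearEquiv.ofBijective (HopfAlgebra.antipode ℂ : H →ₗ[ℂ] H)
    BijectiveAntipode.bijective).symm.toLinearMap

/-- The Sweedler sum `∑ B(h₁, h₂)` of a bilinear map `B`. -/
def sweedler {H : Type v} [Ring H] [HopfAlgebra ℂ H] {P : Type w} [AddCommMonoid P] [Module ℂ P]
    (B : H →ₗ[ℂ] H →ₗ[ℂ] P) : H →ₗ[ℂ] P :=
  TensorProduct.lift B ∘ₗ Coalgebra.comul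

/-- A left `H`-module structure as a linear map `h ↦ (x ↦ h x)`. -/
def lact (H : Type v) [Ring H] [HopfAlgebra ℂ H] (V : Type w) [AddCommGroup V] [Module ℂ V]
    [Module H V] [IsScalarTower ℂ H V] : H →ₗ[ℂ] V →ₗ[ℂ] V :=
  (Algebra.lsmul ℂ ℂ V : H →ₐ[ℂ] Module.End ℂ V).toLinearMap

theorem sweedler_eq_sum {H : Type v} [Ring H] [HopfAlgebra ℂ H] {P : Type w} [AddCommMonoid P]
    [Module ℂ P] (B : H →ₗ[ℂ] H →ₗ[ℂ] P) {ι : Type*} {h : H} (R : Coalgebra.Repr ℂ h ι) :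
    sweedler B h = ∑ i ∈ R.index, B (R.left i) (R.right i) := by
  simp [sweedler, ← R.eq]

theorem lact_apply {H : Type v} [Ring H] [HopfAlgebra ℂ H] {V : Type w} [AddCommGroup V]
    [Module ℂ V] [Module H V] [IsScalarTower ℂ H V] (h : H) (x : V) : lact H V h x = h • x := rfl

/-- A right `H`-module structure (a module over the opposite ring), as a linear map
`h ↦ (m ↦ m h)`. -/
def ract (H : Type v) [Ring H] [HopfAlgebra ℂ H] (M : Type w) [AddCommGroup M] [Module ℂ M]
    [Module Hᵐᵒᵖ M] [IsScalarTower ℂ Hᵐᵒᵖ M] : H →ₗ[ℂ] M →ₗ[ℂ] M :=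
  (Algebra.lsmul ℂ ℂ M : Hᵐᵒᵖ →ₐ[ℂ] Module.End ℂ M).toLinearMap ∘ₗ
    (MulOpposite.opLinearEquiv ℂ : H ≃ₗ[ℂ] Hᵐᵒᵖ).toLinearMap

/-- The linear map sending `x ⊗ y ⊗ z` to the endomorphism `a ⊗ m ↦ S(z) a x ⊗ m y` of `H ⊗ M`. -/
def aydTwist (H : Type v) [Ring H] [HopfAlgebra ℂ H] (M : Type w) [AddCommGroup M] [Module ℂ M]
    [Module Hᵐᵒᵖ M] [IsScalarTower ℂ Hᵐᵒᵖ M] :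
    H ⊗[ℂ] (H ⊗[ℂ] H) →ₗ[ℂ] Module.End ℂ (H ⊗[ℂ] M) :=
  LinearMap.mul' ℂ (Module.End ℂ (H ⊗[ℂ] M)) ∘ₗ
    TensorProduct.map
      (LinearMap.rTensorHom M ∘ₗ (LinearMap.mul ℂ H).flip)
      (LinearMap.mul' ℂ (Module.End ℂ (H ⊗[ℂ] M)) ∘ₗ
        TensorProduct.map
          (LinearMap.lTensorHom H ∘ₗ ract H M)
          (LinearMap.rTensorHom M ∘ₗ LinearMap.mul ℂ H ∘ₗ HopfAlgebra.antipode ℂ))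

/-- A right-left stable anti-Yetter-Drinfeld (SAYD) module over `H`: a right `H`-module `M` with a
left coaction `ρ(m) = m₍₋₁₎ ⊗ m₍₀₎` which is coassociative and counital, such that
`ρ(m h) = S(h₃) m₍₋₁₎ h₁ ⊗ m₍₀₎ h₂` and `m₍₀₎ m₍₋₁₎ = m`. -/
class SAYDModule (H : Type v) [Ring H] [HopfAlgebra ℂ H] (M : Type w) [AddCommGroup M] [Module ℂ M]
    [Module Hᵐᵒᵖ M] [IsScalarTower ℂ Hᵐᵒᵖ M] where
  coact : M →ₗ[ℂ] H ⊗[ℂ] M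
  coassoc : ∀ m : M, TensorProduct.assoc ℂ H H M (Coalgebra.comul.rTensor M (coact m)) =
    coact.lTensor H (coact m)
  counit_coact : ∀ m : M, TensorProduct.lid ℂ M (Coalgebra.counit.rTensor M (coact m)) = m
  coact_smul : ∀ (m : M) (h : H), coact (ract H M h m) =
    aydTwist H M (Coalgebra.comul.lTensor H (Coalgebra.comul h)) (coact m)
  stable : ∀ m : M, TensorProduct.lift (ract H M) (coact m) = m

/-! ### `H`-semicategories and `H`-categories -/

/-- A (small, `ℂ`-linear) left `H`-semicategory; `comp g f` is the composite `g f`, and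
`h (g f) = (h₁ g) (h₂ f)`. There need not be identity morphisms. -/
structure HSemicat (H : Type v) [Ring H] [HopfAlgebra ℂ H] where
  Ob : Type u
  Hom : Ob → Ob → Type u
  [addCommGroup : ∀ X Y, AddCommGroup (Hom X Y)]
  [module : ∀ X Y, Module ℂ (Hom X Y)]
  [hmodule : ∀ X Y, Module H (Hom X Y)]
  [tower : ∀ X Y, IsScalarTower ℂ H (Hom X Y)]
  comp : ∀ {X Y Z}, Hom Y Z →ₗ[ℂ] Hom X Y →ₗ[ℂ] Hom X Z
  assoc : ∀ {W X Y Z} (k : Hom Y Z) (g : Hom X Y) (f : Hom W X),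
    comp (comp k g) f = comp k (comp g f)
  smul_comp : ∀ {X Y Z} (h : H) (g : Hom Y Z) (f : Hom X Y),
    h • comp g f = sweedler (comp.compl₁₂ ((lact H (Hom Y Z)).flip g) ((lact H (Hom X Y)).flip f)) h

attribute [instance] HSemicat.addCommGroup HSemicat.module HSemicat.hmodule HSemicat.tower

/-- Identity morphisms in an `H`-semicategory, on which `H` acts through the counit. -/
structure HSemicat.Identities {H : Type v} [Ring H] [HopfAlgebra ℂ H] (C : HSemicat.{u} H) where
  id : ∀ X, C.Hom X X
  id_comp : ∀ {X Y} (f : C.Hom X Y), C.comp (id Y) f = f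
  comp_id : ∀ {X Y} (f : C.Hom X Y), C.comp f (id X) = f
  smul_id : ∀ (h : H) (X : C.Ob), h • id X = (Coalgebra.counit h : ℂ) • id X

/-- A left `H`-category, i.e. a small `ℂ`-linear left `H`-module category. -/
structure HCat (H : Type v) [Ring H] [HopfAlgebra ℂ H] extends HSemicat.{u} H where
  ids : toHSemicat.Identities

/-- An `H`-linear semifunctor with the given map on objects. -/
structure HSemifunctor {H : Type v} [Ring H] [HopfAlgebra ℂ H] (C E : HSemicat.{u} H)
    (obj : C.Ob → E.Ob) where
  map : ∀ {X Y}, C.Hom X Y →ₗ[ℂ] E.Hom (obj X) (obj Y)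
  map_smul : ∀ {X Y} (h : H) (f : C.Hom X Y), map (h • f) = h • map f
  map_comp : ∀ {X Y Z} (g : C.Hom Y Z) (f : C.Hom X Y), map (C.comp g f) = E.comp (map g) (map f)

/-- The `H`-category `E ⊗ M_r(ℂ)`: same objects, morphisms `Hom(X, Y) ⊗ M_r(ℂ)`, composition
`(g ⊗ B) (f ⊗ B') = g f ⊗ B B'` and action `h (f ⊗ B) = h f ⊗ B`. -/
def HCat.tensorMatrix {H : Type v} [Ring H] [HopfAlgebra ℂ H] (E : HCat.{u} H) (r : ℕ) :
    HCat.{u} H where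
  Ob := E.Ob
  Hom X Y := E.Hom X Y ⊗[ℂ] Matrix (Fin r) (Fin r) ℂ
  comp := TensorProduct.map₂ E.comp (LinearMap.mul ℂ (Matrix (Fin r) (Fin r) ℂ))
  assoc k g f := by
    induction k using TensorProduct.induction_on with
    | zero => simp
    | add a b ha hb => simp only [map_add, LinearMap.add_apply, ha, hb]
    | tmul k A =>
      induction g using TensorProduct.induction_on with
      | zero => simp
      | add a b ha hb => simp only [map_add, LinearMap.add_apply, ha, hb]
      | tmul g B =>
        induction f using TensorProduct.induction_on with
        | zero => simp
        | add a b ha hb => simp only [map_add, ha, hb]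
        | tmul f D => simp [E.assoc, mul_assoc]
  smul_comp h g f := by
    rw [sweedler_eq_sum _ (Coalgebra.Repr.arbitrary ℂ h)]
    induction g using TensorProduct.induction_on with
    | zero => simp
    | add a b ha hb =>
      simp only [map_add, LinearMap.add_apply, smul_add, ha, hb, LinearMap.compl₁₂_apply,
        Finset.sum_add_distrib]
    | tmul g A =>
      induction f using TensorProduct.induction_on with
      | zero => simp
      | add a b ha hb =>
        simp only [map_add, LinearMap.add_apply, smul_add, ha, hb, LinearMap.compl₁₂_apply,
          Finset.sum_add_distrib]
      | tmul f B =>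
        simp only [TensorProduct.map₂_apply_tmul, TensorProduct.map_tmul, LinearMap.mul_apply',
          TensorProduct.smul_tmul', E.smul_comp,
          sweedler_eq_sum _ (Coalgebra.Repr.arbitrary ℂ h), LinearMap.compl₁₂_apply,
          LinearMap.flip_apply, lact_apply, TensorProduct.sum_tmul]
  ids :=
    { id := fun X => E.ids.id X ⊗ₜ 1
      id_comp := fun f => by
        induction f using TensorProduct.induction_on with
        | zero => simp
        | add a b ha hb => simp only [map_add, ha, hb]
        | tmul f D => simp [E.ids.id_comp]
      comp_id := fun f => by
        induction f using TensorProduct.induction_on with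
        | zero => simp
        | add a b ha hb => simp only [map_add, LinearMap.add_apply, ha, hb]
        | tmul f D => simp [E.ids.comp_id]
      smul_id := fun h X =>
        congrArg (· ⊗ₜ[ℂ] (1 : Matrix (Fin r) (Fin r) ℂ)) (E.ids.smul_id h X) }

/-- The group `𝕌_H(E)`: families of automorphisms `η(X)` with `h η(X) = ε(h) η(X)`. -/
structure HCat.InvariantAut {H : Type v} [Ring H] [HopfAlgebra ℂ H] (E : HCat.{u} H) where
  hom : ∀ X, E.Hom X X
  inv : ∀ X, E.Hom X X
  hom_inv : ∀ X, E.comp (hom X) (inv X) = E.ids.id X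
  inv_hom : ∀ X, E.comp (inv X) (hom X) = E.ids.id X
  smul_hom : ∀ (h : H) (X), h • hom X = (Coalgebra.counit h : ℂ) • hom X

/-- The inner automorphism `Φ_η(f) = η(Y) f η(X)⁻¹`. -/
def HCat.InvariantAut.conj {H : Type v} [Ring H] [HopfAlgebra ℂ H] {E : HCat.{u} H}
    (η : E.InvariantAut) {X Y : E.Ob} (f : E.Hom X Y) : E.Hom X Y :=
  E.comp (E.comp (η.hom Y) f) (η.inv X)

/-- The hypotheses of the vanishing criterion: there are an `H`-linear semifunctor `υ : E → E`
fixing the objects and an `η ∈ 𝕌_H(E ⊗ M₂(ℂ))` with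
`Φ_η(f ⊗ E₁₁ + υ(f) ⊗ E₂₂) = υ(f) ⊗ E₂₂` for all morphisms `f`. -/
def HCat.SatisfiesVanishing {H : Type v} [Ring H] [HopfAlgebra ℂ H] (E : HCat.{u} H) : Prop :=
  ∃ (υ : HSemifunctor E.toHSemicat E.toHSemicat (fun X => X))
    (η : (E.tensorMatrix 2).InvariantAut),
    ∀ (X Y : E.Ob) (f : E.Hom X Y),
      η.conj (X := X) (Y := Y)
        (f ⊗ₜ[ℂ] Matrix.single (0 : Fin 2) (0 : Fin 2) (1 : ℂ) +
          υ.map f ⊗ₜ[ℂ] Matrix.single (1 : Fin 2) (1 : Fin 2) (1 : ℂ)) =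
        υ.map f ⊗ₜ[ℂ] Matrix.single (1 : Fin 2) (1 : Fin 2) (1 : ℂ)

/-! ### DGH-semicategories, closed graded traces, cycles -/

/-- A left DGH-semicategory: graded `H`-modules of morphisms `Hom n X Y` (degree `n ≥ 0`) with
a graded associative `H`-equivariant composition and an `H`-linear differential of degree one
satisfying the Leibniz rule. Degrees are related by equations, to avoid casts. -/
structure DGHSemicat (H : Type v) [Ring H] [HopfAlgebra ℂ H] where
  Ob : Type u
  Hom : ℕ → Ob → Ob → Type u
  [addCommGroup : ∀ n X Y, AddCommGroup (Hom n X Y)]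
  [module : ∀ n X Y, Module ℂ (Hom n X Y)]
  [hmodule : ∀ n X Y, Module H (Hom n X Y)]
  [tower : ∀ n X Y, IsScalarTower ℂ H (Hom n X Y)]
  comp : ∀ {p q n : ℕ} (_ : p + q = n) {X Y Z}, Hom p Y Z →ₗ[ℂ] Hom q X Y →ₗ[ℂ] Hom n X Z
  assoc : ∀ {p q r s t n : ℕ} (hpq : p + q = s) (hqr : q + r = t) (hs : s + r = n)
    (ht : p + t = n) {W X Y Z} (k : Hom p Y Z) (g : Hom q X Y) (f : Hom r W X),
    comp hs (comp hpq k g) f = comp ht k (comp hqr g f)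
  smul_comp : ∀ {p q n : ℕ} (hn : p + q = n) {X Y Z} (h : H) (g : Hom p Y Z) (f : Hom q X Y),
    h • comp hn g f =
      sweedler ((comp hn).compl₁₂ ((lact H (Hom p Y Z)).flip g) ((lact H (Hom q X Y)).flip f)) h
  d : ∀ {n n' : ℕ} (_ : n + 1 = n') {X Y}, Hom n X Y →ₗ[ℂ] Hom n' X Y
  d_d : ∀ {n n' n'' : ℕ} (h : n + 1 = n') (h' : n' + 1 = n'') {X Y} (f : Hom n X Y),
    d h' (d h f) = 0
  d_smul : ∀ {n n' : ℕ} (hn : n + 1 = n') {X Y} (h : H) (f : Hom n X Y),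
    d hn (h • f) = h • d hn f
  leibniz : ∀ {p q n p' q' n' : ℕ} (hn : p + q = n) (hp' : p + 1 = p') (hq' : q + 1 = q')
    (hn' : n + 1 = n') (h₁ : p' + q = n') (h₂ : p + q' = n') {X Y Z}
    (g : Hom p Y Z) (f : Hom q X Y),
    d hn' (comp hn g f) = comp h₁ (d hp' g) f + (-1 : ℂ) ^ p • comp h₂ g (d hq' f)

attribute [instance] DGHSemicat.addCommGroup DGHSemicat.module DGHSemicat.hmodule DGHSemicat.tower

/-- The degree-zero part of a DGH-semicategory, a left `H`-semicategory. -/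
def DGHSemicat.degZero {H : Type v} [Ring H] [HopfAlgebra ℂ H] (S : DGHSemicat.{u} H) :
    HSemicat.{u} H where
  Ob := S.Ob
  Hom := S.Hom 0
  comp := S.comp (zero_add 0)
  assoc k g f := S.assoc _ _ _ _ k g f
  smul_comp h g f := S.smul_comp _ h g f

/-- A closed graded `(H, M)`-trace of dimension `n` on a DGH-semicategory. -/
structure ClosedGradedTrace {H : Type v} [Ring H] [HopfAlgebra ℂ H] [BijectiveAntipode H]
    (S : DGHSemicat.{u} H) (M : Type w) [AddCommGroup M] [Module ℂ M]
    [Module Hᵐᵒᵖ M] [IsScalarTower ℂ Hᵐᵒᵖ M] [SAYDModule H M] (n : ℕ) where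
  tr : ∀ X, M ⊗[ℂ] S.Hom n X X →ₗ[ℂ] ℂ
  /-- `T_X(m h₁ ⊗ S(h₂) f) = ε(h) T_X(m ⊗ f)` -/
  tr_smul : ∀ (X) (h : H) (m : M) (f : S.Hom n X X),
    sweedler (((TensorProduct.mk ℂ M (S.Hom n X X)).compr₂ (tr X)).compl₁₂
      ((ract H M).flip m) ((lact H (S.Hom n X X)).flip f ∘ₗ HopfAlgebra.antipode ℂ)) h =
      Coalgebra.counit h * tr X (m ⊗ₜ f)
  /-- `T_X(m ⊗ ∂ f') = 0` for `f'` of degree `n - 1` -/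
  tr_d : ∀ (X) (m : M) {p : ℕ} (hp : p + 1 = n) (f' : S.Hom p X X), tr X (m ⊗ₜ S.d hp f') = 0
  /-- `T_X(m ⊗ g' g) = (-1)^{ij} T_Y(m₍₀₎ ⊗ (S⁻¹(m₍₋₁₎) g) g')` -/
  tr_comp : ∀ {X Y} {i j : ℕ} (hij : i + j = n) (hji : j + i = n) (m : M)
    (g : S.Hom i X Y) (g' : S.Hom j Y X),
    tr X (m ⊗ₜ S.comp hji g' g) = (-1 : ℂ) ^ (i * j) *
      TensorProduct.lift
        (((TensorProduct.mk ℂ M (S.Hom n Y Y)).compr₂ (tr Y)).flip ∘ₗ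
          (S.comp hij).flip g' ∘ₗ (lact H (S.Hom i X Y)).flip g ∘ₗ antipodeInv H)
        (SAYDModule.coact m)

/-- An `n`-dimensional cycle over the `H`-category `D`, with coefficients in `M`: a
DGH-semicategory `S` with a closed graded `(H, M)`-trace of dimension `n` and an `H`-linear
semifunctor `ρ : D → S⁰`. -/
structure Cycle {H : Type v} [Ring H] [HopfAlgebra ℂ H] [BijectiveAntipode H]
    (D : HCat.{u} H) (M : Type w) [AddCommGroup M] [Module ℂ M]
    [Module Hᵐᵒᵖ M] [IsScalarTower ℂ Hᵐᵒᵖ M] [SAYDModule H M] (n : ℕ) where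
  S : DGHSemicat.{u} H
  trace : ClosedGradedTrace S M n
  ρobj : D.Ob → S.Ob
  ρ : HSemifunctor D.toHSemicat S.degZero ρobj

/-- The cycle is vanishing: `S⁰` is an `H`-category which satisfies the hypotheses of the vanishing
criterion. -/
def Cycle.IsVanishing {H : Type v} [Ring H] [HopfAlgebra ℂ H] [BijectiveAntipode H]
    {D : HCat.{u} H} {M : Type w} [AddCommGroup M] [Module ℂ M]
    [Module Hᵐᵒᵖ M] [IsScalarTower ℂ Hᵐᵒᵖ M] [SAYDModule H M] {n : ℕ} (Γ : Cycle D M n) : Prop :=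
  ∃ I : Γ.S.degZero.Identities, (HCat.mk Γ.S.degZero I).SatisfiesVanishing

/-! ### The cyclic nerve and Hopf-cyclic cochains -/

open scoped Classical in
/-- `chains C n X Z` is the direct sum over all `(X₁, …, Xₙ)` of
`Hom(X₁, X) ⊗ Hom(X₂, X₁) ⊗ … ⊗ Hom(Z, Xₙ)`, built one tensor factor at a time. -/
def chains {H : Type v} [Ring H] [HopfAlgebra ℂ H] (C : HSemicat.{u} H) :
    ℕ → C.Ob → C.Ob → ModuleCat.{u} ℂ
  | 0, X, Z => ModuleCat.of ℂ (C.Hom Z X)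
  | n + 1, X, Z => ModuleCat.of ℂ (⨁ Y : C.Ob, C.Hom Y X ⊗[ℂ] chains C n Y Z)

section
variable {H : Type v} [Ring H] [HopfAlgebra ℂ H] (C : HSemicat.{u} H)

/-- The identification of `chains C 0 X Z` with `Hom(Z, X)`. -/
def single (X Z : C.Ob) : C.Hom Z X ≃ₗ[ℂ] chains C 0 X Z :=
  LinearEquiv.refl ℂ (C.Hom Z X)

open scoped Classical in
/-- Prepending a morphism: `(f⁰, f¹ ⊗ … ⊗ fⁿ⁺¹) ↦ f⁰ ⊗ f¹ ⊗ … ⊗ fⁿ⁺¹`. -/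
def cons (n : ℕ) (X Y Z : C.Ob) :
    C.Hom Y X ⊗[ℂ] chains C n Y Z →ₗ[ℂ] chains C (n + 1) X Z :=
  DirectSum.lof ℂ C.Ob (fun Y => C.Hom Y X ⊗[ℂ] chains C n Y Z) Y

open scoped Classical in
/-- The linear map out of `chains C (n + 1) X Z` with prescribed components. -/
def consLift {n : ℕ} {X Z : C.Ob} {P : Type w} [AddCommMonoid P] [Module ℂ P]
    (F : ∀ Y, C.Hom Y X ⊗[ℂ] chains C n Y Z →ₗ[ℂ] P) : chains C (n + 1) X Z →ₗ[ℂ] P :=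
  DirectSum.toModule ℂ C.Ob P F

/-- The diagonal action `h (f⁰ ⊗ … ⊗ fⁿ) = h₁ f⁰ ⊗ … ⊗ hₙ₊₁ fⁿ`. -/
def diagAct : ∀ (n : ℕ) (X Z : C.Ob), H →ₗ[ℂ] chains C n X Z →ₗ[ℂ] chains C n X Z
  | 0, X, Z => lact H (C.Hom Z X)
  | n + 1, X, Z => (consLift C fun Y => (sweedler
      ((TensorProduct.mapBilinear (RingHom.id ℂ) (C.Hom Y X) (chains C n Y Z) (C.Hom Y X)
        (chains C n Y Z)).compl₁₂ (lact H (C.Hom Y X)) (diagAct n Y Z))).flip.compr₂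
          (cons C n X Y Z)).flip

/-- The action on the first factor, `a · (f⁰ ⊗ … ⊗ fⁿ) = a f⁰ ⊗ f¹ ⊗ … ⊗ fⁿ`. -/
def headAct : ∀ (n : ℕ) (X Z : C.Ob), H →ₗ[ℂ] chains C n X Z →ₗ[ℂ] chains C n X Z
  | 0, X, Z => lact H (C.Hom Z X)
  | n + 1, X, Z => (consLift C fun Y =>
      (LinearMap.rTensorHom (chains C n Y Z) ∘ₗ lact H (C.Hom Y X)).flip.compr₂
        (cons C n X Y Z)).flip

/-- Composition into the first factor, `(g, f⁰ ⊗ … ⊗ fⁿ) ↦ g f⁰ ⊗ f¹ ⊗ … ⊗ fⁿ`. -/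
def headComp : ∀ (n : ℕ) (W X Z : C.Ob), C.Hom X W →ₗ[ℂ] chains C n X Z →ₗ[ℂ] chains C n W Z
  | 0, _, _, _ => C.comp
  | n + 1, W, X, Z => (consLift C fun Y =>
      (LinearMap.rTensorHom (chains C n Y Z) ∘ₗ
        (C.comp : C.Hom X W →ₗ[ℂ] C.Hom Y X →ₗ[ℂ] C.Hom Y W)).flip.compr₂ (cons C n W Y Z)).flip

/-- The inner faces `f⁰ ⊗ … ⊗ fⁿ⁺¹ ↦ f⁰ ⊗ … ⊗ fⁱ fⁱ⁺¹ ⊗ … ⊗ fⁿ⁺¹`, for `0 ≤ i ≤ n`. -/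
def face : ∀ (n : ℕ) (_ : Fin (n + 1)) (X Z : C.Ob), chains C (n + 1) X Z →ₗ[ℂ] chains C n X Z
  | 0, _, X, Z => consLift C fun Y => TensorProduct.lift (headComp C 0 X Y Z)
  | n + 1, i, X, Z => Fin.cases
      (consLift C fun Y => TensorProduct.lift (headComp C (n + 1) X Y Z))
      (fun j => consLift C fun Y => cons C n X Y Z ∘ₗ (face n j Y Z).lTensor (C.Hom Y X)) i

open scoped Classical in
/-- Splitting off the last factor,
`f⁰ ⊗ … ⊗ fⁿ⁺¹ ↦ (f⁰ ⊗ … ⊗ fⁿ) ⊗ fⁿ⁺¹`, in the summand of the source `Y` of `fⁿ`. -/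
def unsnoc : ∀ (n : ℕ) (X Z : C.Ob),
    chains C (n + 1) X Z →ₗ[ℂ] ⨁ Y : C.Ob, chains C n X Y ⊗[ℂ] C.Hom Z Y
  | 0, X, Z => consLift C fun Y =>
      DirectSum.lof ℂ C.Ob (fun Y => chains C 0 X Y ⊗[ℂ] C.Hom Z Y) Y ∘ₗ
        TensorProduct.map (single C X Y).toLinearMap (single C Y Z).symm.toLinearMap
  | n + 1, X, Z => consLift C fun W =>
      DirectSum.toModule ℂ C.Ob _ (fun Y =>
        DirectSum.lof ℂ C.Ob (fun Y => chains C (n + 1) X Y ⊗[ℂ] C.Hom Z Y) Y ∘ₗ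
          (cons C n X W Y).rTensor (C.Hom Z Y) ∘ₗ
          (TensorProduct.assoc ℂ (C.Hom W X) (chains C n W Y) (C.Hom Z Y)).symm.toLinearMap) ∘ₗ
      (TensorProduct.directSumRight ℂ ℂ (C.Hom W X)
        (fun Y => chains C n W Y ⊗[ℂ] C.Hom Z Y)).toLinearMap ∘ₗ
      (unsnoc n W Z).lTensor (C.Hom W X)

/-- The cyclic nerve `CN_n(C)`: the direct sum over all `(X₀, …, Xₙ)` of
`Hom(X₁, X₀) ⊗ Hom(X₂, X₁) ⊗ … ⊗ Hom(X₀, Xₙ)`. -/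
abbrev CN (n : ℕ) : Type u := ⨁ X : C.Ob, chains C n X X

open scoped Classical in
/-- The inclusion of the summands with `X₀ = X`. -/
def loop (n : ℕ) (X : C.Ob) : chains C n X X →ₗ[ℂ] CN C n :=
  DirectSum.lof ℂ C.Ob (fun X => chains C n X X) X

open scoped Classical in
/-- The linear map out of the cyclic nerve with prescribed components. -/
def loopLift {n : ℕ} {P : Type w} [AddCommMonoid P] [Module ℂ P]
    (F : ∀ X, chains C n X X →ₗ[ℂ] P) : CN C n →ₗ[ℂ] P :=
  DirectSum.toModule ℂ C.Ob P F

/-- The diagonal action of `H` on the cyclic nerve. -/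
def cnDiagAct (n : ℕ) : H →ₗ[ℂ] CN C n →ₗ[ℂ] CN C n :=
  (loopLift C fun X => (diagAct C n X X).flip.compr₂ (loop C n X)).flip

/-- The action of `H` on the first factor of the cyclic nerve. -/
def cnHeadAct (n : ℕ) : H →ₗ[ℂ] CN C n →ₗ[ℂ] CN C n :=
  (loopLift C fun X => (headAct C n X X).flip.compr₂ (loop C n X)).flip

/-- The inner faces of the cyclic nerve. -/
def cnFace (n : ℕ) (i : Fin (n + 1)) : CN C (n + 1) →ₗ[ℂ] CN C n :=
  loopLift C fun X => loop C n X ∘ₗ face C n i X X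

open scoped Classical in
/-- The rotation `f⁰ ⊗ … ⊗ fⁿ ↦ fⁿ ⊗ f⁰ ⊗ … ⊗ fⁿ⁻¹` of the cyclic nerve. -/
def rotate : ∀ n : ℕ, CN C n →ₗ[ℂ] CN C n
  | 0 => LinearMap.id
  | n + 1 => loopLift C fun X =>
      DirectSum.toModule ℂ C.Ob _ (fun Y =>
        loop C (n + 1) Y ∘ₗ cons C n Y X Y ∘ₗ
          (TensorProduct.comm ℂ (chains C n X Y) (C.Hom X Y)).toLinearMap) ∘ₗ unsnoc C n X X

variable (M : Type w) [AddCommGroup M] [Module ℂ M] [Module Hᵐᵒᵖ M] [IsScalarTower ℂ Hᵐᵒᵖ M]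

/-- The right action `(m ⊗ x) h = m h₁ ⊗ S(h₂) x` of `h ∈ H` on `M ⊗ CN_n(C)`. -/
def rightAct (n : ℕ) : H →ₗ[ℂ] M ⊗[ℂ] CN C n →ₗ[ℂ] M ⊗[ℂ] CN C n :=
  sweedler ((TensorProduct.mapBilinear (RingHom.id ℂ) M (CN C n) M (CN C n)).compl₁₂
    (ract H M) (cnDiagAct C n ∘ₗ HopfAlgebra.antipode ℂ))

/-- `C^n_H(C, M)`: the linear maps `φ : M ⊗ CN_n(C) → ℂ` such that
`φ(m h₁ ⊗ S(h₂) x) = ε(h) φ(m ⊗ x)`. -/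
def hopfCochains (n : ℕ) : Submodule ℂ (M ⊗[ℂ] CN C n →ₗ[ℂ] ℂ) where
  carrier := {φ | ∀ (h : H) (z : M ⊗[ℂ] CN C n), φ (rightAct C M n h z) = Coalgebra.counit h * φ z}
  add_mem' := fun ha hb h z => by simp [ha h z, hb h z, mul_add]
  zero_mem' := fun h z => by simp
  smul_mem' := fun c φ hφ h z => by simp [hφ h z, mul_left_comm]

variable [BijectiveAntipode H] [SAYDModule H M]

/-- The cyclic operator
`t(m ⊗ f⁰ ⊗ … ⊗ fⁿ) = m₍₀₎ ⊗ S⁻¹(m₍₋₁₎) fⁿ ⊗ f⁰ ⊗ … ⊗ fⁿ⁻¹` on `M ⊗ CN_n(C)`. -/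
def cyclicOp (n : ℕ) : M ⊗[ℂ] CN C n →ₗ[ℂ] M ⊗[ℂ] CN C n :=
  TensorProduct.lift (LinearMap.lTensorHom M ∘ₗ cnHeadAct C n ∘ₗ antipodeInv H) ∘ₗ
    (TensorProduct.assoc ℂ H M (CN C n)).toLinearMap ∘ₗ
      TensorProduct.map (SAYDModule.coact : M →ₗ[ℂ] H ⊗[ℂ] M) (rotate C n)

/-- The cofaces `δ_i : C^n(C, M) → C^{n+1}(C, M)`, `0 ≤ i ≤ n + 1`: for `i ≤ n`,
`(δ_i φ)(m ⊗ f⁰ ⊗ … ⊗ fⁿ⁺¹) = φ(m ⊗ f⁰ ⊗ … ⊗ fⁱ fⁱ⁺¹ ⊗ … ⊗ fⁿ⁺¹)`, and the last one is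
`φ(m₍₀₎ ⊗ (S⁻¹(m₍₋₁₎) fⁿ⁺¹) f⁰ ⊗ f¹ ⊗ … ⊗ fⁿ)`. -/
def coface (n : ℕ) (i : Fin (n + 2)) :
    (M ⊗[ℂ] CN C n →ₗ[ℂ] ℂ) →ₗ[ℂ] (M ⊗[ℂ] CN C (n + 1) →ₗ[ℂ] ℂ) :=
  Fin.lastCases
    (LinearMap.lcomp ℂ ℂ ((cnFace C n 0).lTensor M ∘ₗ cyclicOp C M (n + 1)))
    (fun j => LinearMap.lcomp ℂ ℂ ((cnFace C n j).lTensor M)) i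

/-- The Hochschild differential `b = ∑ (-1)^i δ_i`. -/
def hochschild (n : ℕ) :
    (M ⊗[ℂ] CN C n →ₗ[ℂ] ℂ) →ₗ[ℂ] (M ⊗[ℂ] CN C (n + 1) →ₗ[ℂ] ℂ) :=
  ∑ i : Fin (n + 2), (-1 : ℂ) ^ (i : ℕ) • coface C M n i

/-- The signed cyclic operator `λ = (-1)^n τ`, where `τ φ = φ ∘ t`. -/
def signedCyclic (n : ℕ) : (M ⊗[ℂ] CN C n →ₗ[ℂ] ℂ) →ₗ[ℂ] (M ⊗[ℂ] CN C n →ₗ[ℂ] ℂ) :=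
  (-1 : ℂ) ^ n • LinearMap.lcomp ℂ ℂ (cyclicOp C M n)

/-- The cyclic cochains `Ker(1 - λ)` in `C^n_H(C, M)`. -/
def cyclicCochains (n : ℕ) : Submodule ℂ (M ⊗[ℂ] CN C n →ₗ[ℂ] ℂ) :=
  hopfCochains C M n ⊓ LinearMap.ker (LinearMap.id - signedCyclic C M n)

/-- The Hopf-cyclic coboundaries `B^n_H(C, M)`: the image under `b` of the cyclic cochains of
degree `n - 1`, and zero for `n = 0`. -/
def coboundaries : ∀ n : ℕ, Submodule ℂ (M ⊗[ℂ] CN C n →ₗ[ℂ] ℂ)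
  | 0 => ⊥
  | n + 1 => (cyclicCochains C M n).map (hochschild C M n)

end

/-! ### The character of a cycle -/

section
variable {H : Type v} [Ring H] [HopfAlgebra ℂ H] {C : HSemicat.{u} H} {S : DGHSemicat.{u} H}
  {obj : C.Ob → S.Ob} (ρ : HSemifunctor C S.degZero obj)

/-- A morphism `f` of `C` is sent to `ρ(f)`, a morphism of degree zero. -/
def rhoMap (X Z : C.Ob) : C.Hom Z X →ₗ[ℂ] S.Hom 0 (obj Z) (obj X) := ρ.map

/-- `f⁰ ⊗ … ⊗ fⁿ ↦ ∂ρ(f⁰) ∂ρ(f¹) … ∂ρ(fⁿ)`. -/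
def diffProd : ∀ (n : ℕ) (X Z : C.Ob), chains C n X Z →ₗ[ℂ] S.Hom (n + 1) (obj Z) (obj X)
  | 0, X, Z => S.d (zero_add 1) ∘ₗ rhoMap ρ X Z
  | n + 1, X, Z => consLift C fun Y => TensorProduct.lift
      ((S.comp (Nat.add_comm 1 (n + 1))).compl₁₂ (S.d (zero_add 1) ∘ₗ rhoMap ρ X Y)
        (diffProd n Y Z))

/-- `f⁰ ⊗ f¹ ⊗ … ⊗ fⁿ ↦ ρ(f⁰) ∂ρ(f¹) … ∂ρ(fⁿ)`. -/
def charProd : ∀ (n : ℕ) (X Z : C.Ob), chains C n X Z →ₗ[ℂ] S.Hom n (obj Z) (obj X)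
  | 0, X, Z => rhoMap ρ X Z
  | n + 1, X, Z => consLift C fun Y => TensorProduct.lift
      ((S.comp (Nat.zero_add (n + 1))).compl₁₂ (rhoMap ρ X Y) (diffProd ρ n Y Z))

end

/-- The character
`m ⊗ f⁰ ⊗ … ⊗ fⁿ ↦ T_{X₀}(m ⊗ ρ(f⁰) ∂ρ(f¹) … ∂ρ(fⁿ))` of a cycle over `D`, with `T_{X₀}` the trace at
the image of the object `X₀`. -/
def Cycle.character {H : Type v} [Ring H] [HopfAlgebra ℂ H] [BijectiveAntipode H]
    {D : HCat.{u} H} {M : Type w} [AddCommGroup M] [Module ℂ M]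
    [Module Hᵐᵒᵖ M] [IsScalarTower ℂ Hᵐᵒᵖ M] [SAYDModule H M] {n : ℕ} (Γ : Cycle D M n) :
    M ⊗[ℂ] CN D.toHSemicat n →ₗ[ℂ] ℂ :=
  TensorProduct.lift (loopLift D.toHSemicat fun X =>
    (TensorProduct.curry (Γ.trace.tr (Γ.ρobj X))).flip ∘ₗ charProd Γ.ρ n X X).flip

end

end HopfCyclic

namespace HopfCyclic

noncomputable section

open Coalgebra (Repr)

/-! ### Sweedler sums -/

section Sweedler

variable {H : Type v} [Ring H] [HopfAlgebra ℂ H]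

/-! Both directions compare the character of a cycle with `b` of an explicit cyclic cochain.

A vanishing cycle has a coboundary as character because conjugate semifunctors have cohomologous
characters (`character_sub_mem_of_sandwich`). Let `α` take values in `S⁰` and let `w₀, w₁` be
invariant degree-zero endomorphisms, with `v₀, v₁` inverse to them as far as `α` can see. In 2 × 2
matrices over `S`, the semifunctors `γ_t(f)_{ab} = c_b w_a α(f) v_b` with `(c₀, c₁) = (1 - t, t)`
form an affine path. At `t = 0` and `t = 1` only one column is nonzero, so the characters of `γ₀`
and `γ₁` are those of `w₀ α v₀` and `w₁ α v₁`. The velocity is `δ = -γ_t ξ` for an invariant `ξ`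
with `ξ γ_t = 0`, that is, an inner derivation. Closedness of the trace turns the derivative of the
character into an alternating sum of products with one factor `δ` (`polyPath_trace`). This sum is
`b` of the cyclic cochain that inserts `ξ` into products of differentials (`insProd_cyclic`,
`hochschild_insProd`), and integration over `[0, 1]` gives the claim (`character_sub_mem`). For a
vanishing cycle, `η` conjugates `ρ ⊕ υρ` to `0 ⊕ υρ`. The characters of these two differ by the
character of `ρ`, which is therefore a coboundary.

Conversely let `ψ` be a cyclic cochain of degree `k`. Let `R` be the endomorphism algebra of a space
`V` isomorphic to `V^ℤ`; an infinite swindle makes `D ⊗ R` satisfy the vanishing condition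
(`satisfiesVanishing_end`). It is the degree-zero part of `universalDGH`, whose morphisms of degree
`n` are tensors `f⁰ ⊗ … ⊗ fⁿ`, with multiplication at the junction and a differential inserting
identities. Choose an idempotent `p` of `R` and a functional `χ` with `χ(1) = 0` and `χ(p) = 1`.
Applying `χ` to every factor pulls `ψ` back to `D ⊗ R`, and the last coface of the pullback, up to
sign, is a closed graded trace (`cyclicTrace`). It is closed because `χ(1) = 0` kills the inner
identities while cyclicity cancels the two outer ones. With the semifunctor `f ↦ f ⊗ p` the
character is exactly `bψ` (`cyclicCycle_character`). In degree zero the only coboundary is `0`,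
which is the character of a cycle with zero trace. -/

theorem sum_coassoc {P : Type*} [AddCommMonoid P] [Module ℂ P]
    (F : H →ₗ[ℂ] H →ₗ[ℂ] H →ₗ[ℂ] P) {h : H} {ι : Type*} {κ κ' : ι → Type*} (R : Repr ℂ h ι)
    (A : ∀ i, Repr ℂ (R.left i) (κ i)) (B : ∀ i, Repr ℂ (R.right i) (κ' i)) :
    ∑ i ∈ R.index, ∑ j ∈ (A i).index, F ((A i).left j) ((A i).right j) (R.right i) =
      ∑ i ∈ R.index, ∑ j ∈ (B i).index, F (R.left i) ((B i).left j) ((B i).right j) := by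
  have := congrArg (TensorProduct.lift (TensorProduct.uncurry (RingHom.id ℂ) H H P ∘ₗ F))
    (Coalgebra.sum_tmul_tmul_eq R A B)
  simpa [TensorProduct.lift.tmul] using this

theorem sum_counit_left {V : Type*} [AddCommMonoid V] [Module ℂ V] (F : H →ₗ[ℂ] V) {h : H}
    {ι : Type*} (R : Repr ℂ h ι) :
    ∑ i ∈ R.index, (Coalgebra.counit (R.left i) : ℂ) • F (R.right i) = F h := by
  simp only [← map_smul, ← map_sum, Coalgebra.sum_counit_smul]

theorem sum_counit_right {V : Type*} [AddCommMonoid V] [Module ℂ V] (F : H →ₗ[ℂ] V) {h : H}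
    {ι : Type*} (R : Repr ℂ h ι) :
    ∑ i ∈ R.index, (Coalgebra.counit (R.right i) : ℂ) • F (R.left i) = F h := by
  have := congrArg (TensorProduct.rid ℂ H) (Coalgebra.sum_tmul_counit_eq R)
  simp only [map_sum, TensorProduct.rid_tmul, one_smul] at this
  simp only [← map_smul, ← map_sum, this]

theorem HSemicat.smul_comp_sum (C : HSemicat.{u} H) {X Y Z : C.Ob} {h : H} {ι : Type*}
    (R : Repr ℂ h ι) (g : C.Hom Y Z) (f : C.Hom X Y) :
    h • C.comp g f = ∑ i ∈ R.index, C.comp (R.left i • g) (R.right i • f) := by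
  rw [C.smul_comp, sweedler_eq_sum _ R]; rfl

theorem DGHSemicat.smul_comp_sum (S : DGHSemicat.{u} H) {p q n : ℕ} (hn : p + q = n)
    {X Y Z : S.Ob} {h : H} {ι : Type*} (R : Repr ℂ h ι) (g : S.Hom p Y Z) (f : S.Hom q X Y) :
    h • S.comp hn g f = ∑ i ∈ R.index, S.comp hn (R.left i • g) (R.right i • f) := by
  rw [S.smul_comp, sweedler_eq_sum _ R]; rfl

theorem DGHSemicat.smul_comp_of_invariant_left (S : DGHSemicat.{u} H) {p q n : ℕ} (hn : p + q = n)
    {X Y Z : S.Ob} {g : S.Hom p Y Z} (hg : ∀ h : H, h • g = (Coalgebra.counit h : ℂ) • g)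
    (h : H) (f : S.Hom q X Y) : h • S.comp hn g f = S.comp hn g (h • f) := by
  rw [S.smul_comp_sum hn (Repr.arbitrary ℂ h)]
  simp only [hg, map_smul, LinearMap.smul_apply]
  exact sum_counit_left (S.comp hn g ∘ₗ (lact H (S.Hom q X Y)).flip f) _

theorem DGHSemicat.smul_comp_of_invariant_right (S : DGHSemicat.{u} H) {p q n : ℕ} (hn : p + q = n)
    {X Y Z : S.Ob} {f : S.Hom q X Y} (hf : ∀ h : H, h • f = (Coalgebra.counit h : ℂ) • f)
    (h : H) (g : S.Hom p Y Z) : h • S.comp hn g f = S.comp hn (h • g) f := by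
  rw [S.smul_comp_sum hn (Repr.arbitrary ℂ h)]
  simp only [hf, map_smul]
  exact sum_counit_right ((S.comp hn).flip f ∘ₗ (lact H (S.Hom p Y Z)).flip g) _

/-! ### The inverse antipode -/

local notation "S" => HopfAlgebra.antipode ℂ (A := H)

-- `S(h₁) h₂ ⊗ h₃ = 1 ⊗ h`: coassociativity brings the antipode next to its partner. This is the
-- inner cancellation in `comul_antipode`.
open HopfAlgebra in
theorem sum_antipode_tmul_one_mul_comul {h : H} {ι : Type*} (R : Repr ℂ h ι) :
    ∑ i ∈ R.index, (S (R.left i) ⊗ₜ[ℂ] (1 : H)) * Coalgebra.comul (R := ℂ) (R.right i) =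
      1 ⊗ₜ[ℂ] h := by
  let F : H →ₗ[ℂ] H →ₗ[ℂ] H →ₗ[ℂ] H ⊗[ℂ] H :=
    (LinearMap.mul ℂ H ∘ₗ S).compr₂ (TensorProduct.mk ℂ H H)
  have key := sum_coassoc F R (fun i => Repr.arbitrary ℂ (R.left i))
    (fun i => Repr.arbitrary ℂ (R.right i))
  have e₁ : ∀ i, (S (R.left i) ⊗ₜ[ℂ] (1 : H)) * Coalgebra.comul (R := ℂ) (R.right i) =
      ∑ j ∈ (Repr.arbitrary ℂ (R.right i)).index, F (R.left i)
        ((Repr.arbitrary ℂ (R.right i)).left j) ((Repr.arbitrary ℂ (R.right i)).right j) := by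
    intro i
    rw [← (Repr.arbitrary ℂ (R.right i)).eq, Finset.mul_sum]
    refine Finset.sum_congr rfl fun j _ => ?_
    rw [Algebra.TensorProduct.tmul_mul_tmul, one_mul]; rfl
  rw [Finset.sum_congr rfl fun i _ => e₁ i, ← key]
  have e₂ : ∀ i, ∑ j ∈ (Repr.arbitrary ℂ (R.left i)).index,
      F ((Repr.arbitrary ℂ (R.left i)).left j) ((Repr.arbitrary ℂ (R.left i)).right j)
        (R.right i) = (Coalgebra.counit (R.left i) : ℂ) • ((1 : H) ⊗ₜ[ℂ] R.right i) := by
    intro i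
    rw [TensorProduct.smul_tmul', ← sum_antipode_mul_eq_smul (Repr.arbitrary ℂ (R.left i)),
      TensorProduct.sum_tmul]
    rfl
  rw [Finset.sum_congr rfl fun i _ => e₂ i]
  exact sum_counit_left (TensorProduct.mk ℂ H H 1) R

open HopfAlgebra WithConv in
/-- The antipode reverses the comultiplication. -/
theorem comul_antipode (h : H) :
    Coalgebra.comul (S h) =
      TensorProduct.map S S (TensorProduct.comm ℂ H H (Coalgebra.comul (R := ℂ) h)) := by
  let G : H →ₗ[ℂ] H ⊗[ℂ] H :=
    TensorProduct.map S S ∘ₗ (TensorProduct.comm ℂ H H).toLinearMap ∘ₗ Coalgebra.comul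
  -- Inverses in the convolution algebra `Hom(H, H ⊗ H)` are unique. The composite `Δ ∘ S` is a
  -- right inverse of `Δ`, so it suffices that the candidate `G` is a left inverse.
  suffices hG : toConv G * toConv (Coalgebra.comul : H →ₗ[ℂ] H ⊗[ℂ] H) = 1 by
    have := left_inv_eq_right_inv hG (LinearMap.comul_right_inv (R := ℂ) (C := H))
    exact (LinearMap.congr_fun (WithConv.toConv_injective this) h).symm
  ext c
  set R := Repr.arbitrary ℂ c
  rw [R.convMul_apply]
  let N : H →ₗ[ℂ] H →ₗ[ℂ] H ⊗[ℂ] H := (LinearMap.mul ℂ (H ⊗[ℂ] H)).compl₁₂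
    ((TensorProduct.mk ℂ H H).flip 1 ∘ₗ S) Coalgebra.comul
  let F : H →ₗ[ℂ] H →ₗ[ℂ] H →ₗ[ℂ] H ⊗[ℂ] H :=
    { toFun := fun a => N.compr₂ (LinearMap.mulLeft ℂ (1 ⊗ₜ S a))
      map_add' := fun a b => by ext; simp [TensorProduct.tmul_add, add_mul]
      map_smul' := fun a b => by ext; simp [TensorProduct.tmul_smul] }
  have key := sum_coassoc F R (fun i => Repr.arbitrary ℂ (R.left i))
    (fun i => Repr.arbitrary ℂ (R.right i))
  have e₁ : ∀ i, G (R.left i) * Coalgebra.comul (R := ℂ) (R.right i) =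
      ∑ j ∈ (Repr.arbitrary ℂ (R.left i)).index, F ((Repr.arbitrary ℂ (R.left i)).left j)
        ((Repr.arbitrary ℂ (R.left i)).right j) (R.right i) := by
    intro i
    change TensorProduct.map S S (TensorProduct.comm ℂ H H (Coalgebra.comul (R.left i))) * _ = _
    rw [← (Repr.arbitrary ℂ (R.left i)).eq, map_sum, map_sum, Finset.sum_mul]
    refine Finset.sum_congr rfl fun j _ => ?_
    change _ = ((1 : H) ⊗ₜ[ℂ] S _) * ((S _ ⊗ₜ[ℂ] (1 : H)) * _)
    rw [← mul_assoc, Algebra.TensorProduct.tmul_mul_tmul, one_mul, mul_one]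
    rfl
  have e₂ : ∀ i, ∑ j ∈ (Repr.arbitrary ℂ (R.right i)).index, F (R.left i)
      ((Repr.arbitrary ℂ (R.right i)).left j) ((Repr.arbitrary ℂ (R.right i)).right j) =
        TensorProduct.mk ℂ H H 1 (S (R.left i) * R.right i) := by
    intro i
    change ∑ j ∈ _, ((1 : H) ⊗ₜ[ℂ] S _) * ((S _ ⊗ₜ[ℂ] (1 : H)) * _) = _
    rw [← Finset.mul_sum, sum_antipode_tmul_one_mul_comul, Algebra.TensorProduct.tmul_mul_tmul,
      one_mul]
    rfl
  refine (Finset.sum_congr rfl fun i _ => e₁ i).trans (key.trans ?_)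
  rw [Finset.sum_congr rfl fun i _ => e₂ i, ← map_sum, sum_antipode_mul_eq_smul]
  simp [Algebra.algebraMap_eq_smul_one, Algebra.TensorProduct.one_def]

variable [BijectiveAntipode H]

theorem antipode_antipodeInv (h : H) : S (antipodeInv H h) = h :=
  (LinearEquiv.ofBijective S BijectiveAntipode.bijective).apply_symm_apply h

theorem antipodeInv_antipode (h : H) : antipodeInv H (S h) = h :=
  (LinearEquiv.ofBijective S BijectiveAntipode.bijective).symm_apply_apply h

theorem antipodeInv_mul (a b : H) :
    antipodeInv H (a * b) = antipodeInv H b * antipodeInv H a := by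
  apply (BijectiveAntipode.bijective (H := H)).injective
  rw [HopfAlgebra.antipode_mul_antidistrib]
  simp only [antipode_antipodeInv]

theorem counit_antipodeInv (h : H) :
    (Coalgebra.counit (antipodeInv H h) : ℂ) = Coalgebra.counit h := by
  rw [← HopfAlgebra.counit_antipode, antipode_antipodeInv]

/-- The inverse antipode reverses the comultiplication. -/
def antipodeInvRepr {h : H} {ι : Type*} (R : Repr ℂ h ι) : Repr ℂ (antipodeInv H h) ι where
  index := R.index
  left i := antipodeInv H (R.right i)
  right i := antipodeInv H (R.left i)
  eq := by
    have h₁ := comul_antipode (antipodeInv H h)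
    rw [antipode_antipodeInv] at h₁
    have h₂ := congrArg (TensorProduct.comm ℂ H H)
      (congrArg (TensorProduct.map (antipodeInv H) (antipodeInv H)) h₁)
    rw [← R.eq, ← LinearMap.comp_apply, ← TensorProduct.map_comp] at h₂
    have h₃ : antipodeInv H ∘ₗ S = LinearMap.id := LinearMap.ext antipodeInv_antipode
    rw [h₃, TensorProduct.map_id] at h₂
    simpa using h₂

/-- The antipode axiom at `S⁻¹(h)`, whose coproduct is `S⁻¹(h₂) ⊗ S⁻¹(h₁)`. This cancellation is
what makes the anti-Yetter–Drinfeld condition effective later. -/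
theorem sum_right_mul_antipodeInv_left {h : H} {ι : Type*} (R : Repr ℂ h ι) :
    ∑ i ∈ R.index, R.right i * antipodeInv H (R.left i) = (Coalgebra.counit h : ℂ) • 1 := by
  have := HopfAlgebra.sum_antipode_mul_eq_smul (antipodeInvRepr R)
  rw [counit_antipodeInv] at this
  rw [← this]
  refine Finset.sum_congr rfl fun i _ => ?_
  change _ = S (antipodeInv H _) * _
  rw [antipode_antipodeInv]; rfl

end Sweedler

/-! ### Chains -/

section Chains

variable {H : Type v} [Ring H] [HopfAlgebra ℂ H] (C : HSemicat.{u} H)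

/-- Prepending a morphism to a chain, as a bilinear map. -/
def pre (n : ℕ) (X Y Z : C.Ob) : C.Hom Y X →ₗ[ℂ] chains C n Y Z →ₗ[ℂ] chains C (n + 1) X Z :=
  TensorProduct.curry (cons C n X Y Z)

variable {C}

theorem consLift_pre {n : ℕ} {X Y Z : C.Ob} {P : Type w} [AddCommMonoid P] [Module ℂ P]
    (F : ∀ Y, C.Hom Y X ⊗[ℂ] chains C n Y Z →ₗ[ℂ] P) (f : C.Hom Y X) (x : chains C n Y Z) :
    consLift C F (pre C n X Y Z f x) = F Y (f ⊗ₜ x) := by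
  classical
  exact DirectSum.toModule_lof ℂ Y _

theorem chains_succ_induction {n : ℕ} {X Z : C.Ob} {p : chains C (n + 1) X Z → Prop}
    (zero : p 0) (add : ∀ x y, p x → p y → p (x + y))
    (pre : ∀ (Y : C.Ob) (f : C.Hom Y X) (x : chains C n Y Z), p (pre C n X Y Z f x))
    (x : chains C (n + 1) X Z) : p x := by
  classical
  refine DirectSum.induction_on x zero (fun Y t => ?_) add
  induction t using TensorProduct.induction_on with
  | zero => rw [map_zero]; exact zero
  | tmul f x => exact pre Y f x
  | add a b ha hb => rw [map_add]; exact add _ _ ha hb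

variable (C) in
/-- Appending a morphism to a chain. -/
def snoc : ∀ (n : ℕ) (X Y Z : C.Ob),
    chains C n X Y →ₗ[ℂ] C.Hom Z Y →ₗ[ℂ] chains C (n + 1) X Z
  | 0, X, Y, Z => pre C 0 X Y Z
  | n + 1, X, Y, Z => consLift C fun W => TensorProduct.lift
      (LinearMap.mk₂ ℂ (fun g x => pre C (n + 1) X W Z g ∘ₗ snoc n W Y Z x)
        (fun _ _ _ => by ext; simp) (fun _ _ _ => by ext; simp)
        (fun _ _ _ => by ext; simp) (fun _ _ _ => by ext; simp))

theorem chains_zero_induction {X Z : C.Ob} {p : chains C 0 X Z → Prop}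
    (single : ∀ f : C.Hom Z X, p (single C X Z f)) (x : chains C 0 X Z) : p x := single x

theorem snoc_single {X Y Z : C.Ob} (g : C.Hom Y X) (f : C.Hom Z Y) :
    snoc C 0 X Y Z (single C X Y g) f = pre C 0 X Y Z g (single C Y Z f) := rfl

theorem snoc_pre {n : ℕ} {X Y Z W : C.Ob} (g : C.Hom W X) (x : chains C n W Y) (f : C.Hom Z Y) :
    snoc C (n + 1) X Y Z (pre C n X W Y g x) f = pre C (n + 1) X W Z g (snoc C n W Y Z x f) := by
  rw [snoc, consLift_pre]; rfl

/-- Chains are built from the left, whereas rotation and the last coface act on the last factor.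
This induction gives access to that factor. -/
theorem chains_snoc_induction : ∀ {n : ℕ} {X Z : C.Ob} {p : chains C (n + 1) X Z → Prop}
    (_zero : p 0) (_add : ∀ x y, p x → p y → p (x + y))
    (_snoc : ∀ (Y : C.Ob) (x : chains C n X Y) (f : C.Hom Z Y), p (snoc C n X Y Z x f))
    (x : chains C (n + 1) X Z), p x
  | 0, _, _, _, zero, add, snoc, x => chains_succ_induction zero add (fun Y f x => snoc Y f x) x
  | n + 1, X, Z, p, zero, add, sno, x => by
    refine chains_succ_induction zero add (fun Y f x => ?_) x
    refine chains_snoc_induction (p := fun x => p (pre C (n + 1) X Y Z f x)) ?_ ?_ ?_ x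
    · simpa using zero
    · intro a b ha hb; simpa using add _ _ ha hb
    · intro W x g
      rw [← snoc_pre]; exact sno _ _ _

theorem headComp_single {W X Z : C.Ob} (g : C.Hom X W) (f : C.Hom Z X) :
    headComp C 0 W X Z g (single C X Z f) = single C W Z (C.comp g f) := rfl

theorem headComp_pre {n : ℕ} {W X Y Z : C.Ob} (g : C.Hom X W) (f : C.Hom Y X)
    (x : chains C n Y Z) :
    headComp C (n + 1) W X Z g (pre C n X Y Z f x) = pre C n W Y Z (C.comp g f) x := by
  rw [headComp, LinearMap.flip_apply, consLift_pre]; rfl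

theorem headAct_pre {n : ℕ} {X Y Z : C.Ob} (h : H) (f : C.Hom Y X) (x : chains C n Y Z) :
    headAct C (n + 1) X Z h (pre C n X Y Z f x) = pre C n X Y Z (h • f) x := by
  rw [headAct, LinearMap.flip_apply, consLift_pre]; rfl

theorem headAct_single {X Z : C.Ob} (h : H) (f : C.Hom Z X) :
    headAct C 0 X Z h (single C X Z f) = single C X Z (h • f) := rfl

theorem diagAct_single {X Z : C.Ob} (h : H) (f : C.Hom Z X) :
    diagAct C 0 X Z h (single C X Z f) = single C X Z (h • f) := rfl

theorem diagAct_pre {n : ℕ} {X Y Z : C.Ob} {h : H} {ι : Type*} (R : Repr ℂ h ι) (f : C.Hom Y X)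
    (x : chains C n Y Z) :
    diagAct C (n + 1) X Z h (pre C n X Y Z f x) =
      ∑ i ∈ R.index, pre C n X Y Z (R.left i • f) (diagAct C n Y Z (R.right i) x) := by
  rw [diagAct, LinearMap.flip_apply, consLift_pre, LinearMap.compr₂_apply, LinearMap.flip_apply,
    sweedler_eq_sum _ R]
  simp only [LinearMap.sum_apply, map_sum]
  rfl

theorem unsnoc_snoc : ∀ {n : ℕ} {X Y Z : C.Ob} (x : chains C n X Y) (f : C.Hom Z Y),
    unsnoc C n X Z (snoc C n X Y Z x f) =
      open scoped Classical in
      DirectSum.lof ℂ C.Ob (fun Y => chains C n X Y ⊗[ℂ] C.Hom Z Y) Y (x ⊗ₜ f)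
  | 0, X, Y, Z, x, f => by
    exact (consLift_pre (n := 0) _ (x : C.Hom Y X) f).trans rfl
  | n + 1, X, Y, Z, x, f => by
    classical
    induction x using chains_succ_induction with
    | zero => simp
    | add a b ha hb => simp only [map_add, LinearMap.add_apply, ha, hb, TensorProduct.add_tmul]
    | pre W g x =>
      rw [snoc_pre, unsnoc, consLift_pre]
      simp only [LinearMap.comp_apply, LinearMap.lTensor_tmul, unsnoc_snoc x f]
      erw [TensorProduct.directSumRight_tmul_lof]
      rw [DirectSum.toModule_lof]
      rfl

/-- The alternating sum of the inner faces. -/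
def innerFaces (n : ℕ) (X Z : C.Ob) : chains C (n + 1) X Z →ₗ[ℂ] chains C n X Z :=
  ∑ i : Fin (n + 1), (-1 : ℂ) ^ (i : ℕ) • face C n i X Z

theorem face_zero_pre {n : ℕ} {X Y Z : C.Ob} (f : C.Hom Y X) (x : chains C n Y Z) :
    face C n 0 X Z (pre C n X Y Z f x) = headComp C n X Y Z f x := by
  cases n <;> (rw [face]; erw [consLift_pre]; rfl)

theorem face_succ_pre {n : ℕ} (j : Fin (n + 1)) {X Y Z : C.Ob} (f : C.Hom Y X)
    (x : chains C (n + 1) Y Z) :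
    face C (n + 1) j.succ X Z (pre C (n + 1) X Y Z f x) = pre C n X Y Z f (face C n j Y Z x) := by
  rw [face, Fin.cases_succ, consLift_pre]; rfl

theorem innerFaces_single {X Y Z : C.Ob} (g : C.Hom Y X) (f : C.Hom Z Y) :
    innerFaces 0 X Z (pre C 0 X Y Z g (single C Y Z f)) = single C X Z (C.comp g f) := by
  rw [innerFaces, Fin.sum_univ_one, Fin.val_zero, pow_zero, one_smul]
  exact face_zero_pre g (single C Y Z f)

/-- The zeroth face multiplies `f` into the head; every other face is a face of `x` with its index
raised by one, hence with opposite sign. All telescoping arguments below run through this recursion.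
-/
theorem innerFaces_pre {n : ℕ} {X Y Z : C.Ob} (f : C.Hom Y X) (x : chains C (n + 1) Y Z) :
    innerFaces (n + 1) X Z (pre C (n + 1) X Y Z f x) =
      headComp C (n + 1) X Y Z f x - pre C n X Y Z f (innerFaces n Y Z x) := by
  rw [innerFaces, Fin.sum_univ_succ, LinearMap.add_apply, innerFaces, LinearMap.sum_apply,
    LinearMap.sum_apply, map_sum, sub_eq_add_neg, ← Finset.sum_neg_distrib]
  congr 1
  · simp [face_zero_pre]
  · refine Finset.sum_congr rfl fun j _ => ?_
    simp only [LinearMap.smul_apply, face_succ_pre, map_smul, Fin.val_succ, pow_succ]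
    simp

end Chains

end

end HopfCyclic

namespace HopfCyclic

noncomputable section

open Coalgebra (Repr)

/-! ### Cochains evaluated on elementary loops of the cyclic nerve -/

section Nerve

variable {H : Type v} [Ring H] [HopfAlgebra ℂ H] {C : HSemicat.{u} H}

theorem loopLift_loop {n : ℕ} {P : Type w} [AddCommMonoid P] [Module ℂ P]
    (F : ∀ X, chains C n X X →ₗ[ℂ] P) (X : C.Ob) (x : chains C n X X) :
    loopLift C F (loop C n X x) = F X x := by
  classical
  exact DirectSum.toModule_lof ℂ X _

theorem cnHeadAct_loop {n : ℕ} (h : H) {X : C.Ob} (x : chains C n X X) :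
    cnHeadAct C n h (loop C n X x) = loop C n X (headAct C n X X h x) := by
  rw [cnHeadAct, LinearMap.flip_apply, loopLift_loop]; rfl

theorem cnDiagAct_loop {n : ℕ} (h : H) {X : C.Ob} (x : chains C n X X) :
    cnDiagAct C n h (loop C n X x) = loop C n X (diagAct C n X X h x) := by
  rw [cnDiagAct, LinearMap.flip_apply, loopLift_loop]; rfl

theorem cnFace_loop {n : ℕ} (i : Fin (n + 1)) {X : C.Ob} (x : chains C (n + 1) X X) :
    cnFace C n i (loop C (n + 1) X x) = loop C n X (face C n i X X x) := by
  rw [cnFace, loopLift_loop]; rfl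

theorem rotate_loop_snoc {n : ℕ} {X Y : C.Ob} (x : chains C n X Y) (f : C.Hom X Y) :
    rotate C (n + 1) (loop C (n + 1) X (snoc C n X Y X x f)) =
      loop C (n + 1) Y (pre C n Y X Y f x) := by
  rw [rotate, loopLift_loop, LinearMap.comp_apply, unsnoc_snoc, DirectSum.toModule_lof]
  rfl

theorem CN_induction {n : ℕ} {p : CN C n → Prop} (zero : p 0)
    (add : ∀ x y, p x → p y → p (x + y)) (loop : ∀ X (x : chains C n X X), p (loop C n X x))
    (x : CN C n) : p x := by
  classical
  exact DirectSum.induction_on x zero (fun X t => loop X t) add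

variable (M : Type w) [AddCommGroup M] [Module ℂ M]

variable {M} in
theorem cochain_ext {n : ℕ} {φ ψ : M ⊗[ℂ] CN C n →ₗ[ℂ] ℂ}
    (h : ∀ (m : M) (X : C.Ob) (x : chains C n X X),
      φ (m ⊗ₜ loop C n X x) = ψ (m ⊗ₜ loop C n X x)) : φ = ψ := by
  refine TensorProduct.ext' fun m x => ?_
  induction x using CN_induction with
  | zero => simp
  | add x y hx hy => simp only [TensorProduct.tmul_add, map_add, hx, hy]
  | loop X x => exact h m X x

variable {M} in
theorem cochain_ext_snoc {n : ℕ} {φ ψ : M ⊗[ℂ] CN C (n + 1) →ₗ[ℂ] ℂ}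
    (h : ∀ (m : M) (X Y : C.Ob) (x : chains C n X Y) (f : C.Hom X Y),
      φ (m ⊗ₜ loop C (n + 1) X (snoc C n X Y X x f)) =
        ψ (m ⊗ₜ loop C (n + 1) X (snoc C n X Y X x f))) : φ = ψ := by
  refine cochain_ext fun m X x => ?_
  refine chains_snoc_induction (p := fun x =>
    φ (m ⊗ₜ loop C (n + 1) X x) = ψ (m ⊗ₜ loop C (n + 1) X x)) (by simp) (fun x y hx hy => ?_)
    (fun Y x f => h m X Y x f) x
  simp only [TensorProduct.tmul_add, map_add, hx, hy]

variable [Module Hᵐᵒᵖ M] [IsScalarTower ℂ Hᵐᵒᵖ M]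

theorem rightAct_tmul {n : ℕ} {h : H} {ι : Type*} (R : Repr ℂ h ι) (m : M) {X : C.Ob}
    (x : chains C n X X) :
    rightAct C M n h (m ⊗ₜ loop C n X x) = ∑ i ∈ R.index,
      ract H M (R.left i) m ⊗ₜ
        loop C n X (diagAct C n X X (HopfAlgebra.antipode ℂ (R.right i)) x) := by
  rw [rightAct, sweedler_eq_sum _ R, LinearMap.sum_apply]
  refine Finset.sum_congr rfl fun i _ => ?_
  rw [← cnDiagAct_loop]; rfl

theorem mem_hopfCochains_iff {n : ℕ} (φ : M ⊗[ℂ] CN C n →ₗ[ℂ] ℂ) :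
    φ ∈ hopfCochains C M n ↔ ∀ (h : H) (m : M) (X : C.Ob) (x : chains C n X X),
      φ (rightAct C M n h (m ⊗ₜ loop C n X x)) = Coalgebra.counit h * φ (m ⊗ₜ loop C n X x) := by
  refine ⟨fun hφ h m X x => hφ h _, fun hφ h z => ?_⟩
  have : φ ∘ₗ rightAct C M n h = (Coalgebra.counit h : ℂ) • φ :=
    cochain_ext fun m X x => hφ h m X x
  exact LinearMap.congr_fun this z

variable [BijectiveAntipode H] [SAYDModule H M]

theorem cyclicOp_tmul {n : ℕ} (m : M) (x : CN C n) :
    cyclicOp C M n (m ⊗ₜ x) = TensorProduct.lift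
      (((TensorProduct.mk ℂ M (CN C n)).flip ∘ₗ
        (cnHeadAct C n ∘ₗ antipodeInv H).flip (rotate C n x))) (SAYDModule.coact m : H ⊗[ℂ] M) := by
  rw [cyclicOp, LinearMap.comp_apply, LinearMap.comp_apply, TensorProduct.map_tmul]
  generalize (SAYDModule.coact m : H ⊗[ℂ] M) = t
  induction t using TensorProduct.induction_on with
  | zero => simp
  | add a b ha hb => simp only [map_add, TensorProduct.add_tmul, ha, hb]
  | tmul a m => rfl

/-! ### Functionals twisted by the coaction -/

section Cotwist

variable {M} {P : Type*} [AddCommGroup P] [Module ℂ P]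
  {V V' V'' : Type*} [AddCommGroup V] [Module ℂ V] [Module H V] [IsScalarTower ℂ H V]
  [AddCommGroup V'] [Module ℂ V'] [Module H V'] [IsScalarTower ℂ H V']
  [AddCommGroup V''] [Module ℂ V''] [Module H V''] [IsScalarTower ℂ H V'']

/-- The map `(a ⊗ m, f) ↦ F(m, S⁻¹(a) f)`. -/
def twist (F : M →ₗ[ℂ] V →ₗ[ℂ] P) : V →ₗ[ℂ] H ⊗[ℂ] M →ₗ[ℂ] P :=
  TensorProduct.uncurry (RingHom.id ℂ) H M P ∘ₗ (lact H V ∘ₗ antipodeInv H).flip.compr₂ F.flip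

/-- The map `(m, f) ↦ F(m₍₀₎, S⁻¹(m₍₋₁₎) f)`. -/
def cotwist (F : M →ₗ[ℂ] V →ₗ[ℂ] P) : M →ₗ[ℂ] V →ₗ[ℂ] P :=
  (twist (H := H) F).flip ∘ₗ SAYDModule.coact

theorem twist_tmul (F : M →ₗ[ℂ] V →ₗ[ℂ] P) (a : H) (m : M) (f : V) :
    twist (H := H) F f (a ⊗ₜ m) = F m (antipodeInv H a • f) := rfl

theorem cotwist_eq_twist (F : M →ₗ[ℂ] V →ₗ[ℂ] P) (m : M) (f : V) :
    cotwist (H := H) F m f = twist F f (SAYDModule.coact m : H ⊗[ℂ] M) := rfl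

theorem cotwist_eq_sum (F : M →ₗ[ℂ] V →ₗ[ℂ] P) {m : M} {ι : Type*} {s : Finset ι} {a : ι → H}
    {m' : ι → M} (h : (SAYDModule.coact m : H ⊗[ℂ] M) = ∑ i ∈ s, a i ⊗ₜ m' i) (f : V) :
    cotwist (H := H) F m f = ∑ i ∈ s, F (m' i) (antipodeInv H (a i) • f) := by
  rw [cotwist_eq_twist, h, map_sum]; rfl

theorem exists_coact_eq_sum (m : M) : ∃ s : Finset (H × M),
    (SAYDModule.coact m : H ⊗[ℂ] M) = ∑ i ∈ s, i.1 ⊗ₜ i.2 :=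
  TensorProduct.exists_finset _

theorem cotwist_comp (F : M →ₗ[ℂ] V →ₗ[ℂ] P) (g : V' →ₗ[ℂ] V) (hg : ∀ (h : H) f, g (h • f) = h • g f)
    (m : M) (f : V') : cotwist (H := H) (F.compl₂ g) m f = cotwist (H := H) F m (g f) := by
  obtain ⟨s, hs⟩ := exists_coact_eq_sum (H := H) m
  simp [cotwist_eq_sum _ hs, hg]

/-- On invariant elements `S⁻¹(m₍₋₁₎)` acts by its counit, and the counit axiom of the coaction
removes it. Identities and invariant insertions thus pass through a trace without a twist. -/
theorem cotwist_of_invariant (F : M →ₗ[ℂ] V →ₗ[ℂ] P) {f : V}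
    (hf : ∀ h : H, h • f = (Coalgebra.counit h : ℂ) • f) (m : M) :
    cotwist (H := H) F m f = F m f := by
  obtain ⟨s, hs⟩ := exists_coact_eq_sum (H := H) m
  have h₁ := SAYDModule.counit_coact (H := H) m
  rw [hs] at h₁
  simp only [map_sum, LinearMap.rTensor_tmul, TensorProduct.lid_tmul] at h₁
  conv_rhs => rw [← h₁]
  simp [cotwist_eq_sum _ hs, hf, counit_antipodeInv]

/-- `S⁻¹(a)(g f) = (S⁻¹(a₂) g)(S⁻¹(a₁) f)` because `S⁻¹` reverses the coproduct. Coassociativity of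
the coaction then separates the two twists, so that a product can be rotated past a trace one factor
at a time: first `f`, then `g`. -/
theorem cotwist_bilinear (F : M →ₗ[ℂ] V'' →ₗ[ℂ] P) (B : V →ₗ[ℂ] V' →ₗ[ℂ] V'')
    (hB : ∀ {h : H} (R : Repr ℂ h (H × H)) (g : V) (f : V'),
      h • B g f = ∑ i ∈ R.index, B (R.left i • g) (R.right i • f))
    {m : M} {ι : Type*} {s : Finset ι} {a : ι → H} {m' : ι → M}
    (h : (SAYDModule.coact m : H ⊗[ℂ] M) = ∑ i ∈ s, a i ⊗ₜ m' i) (g : V) (f : V') :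
    cotwist (H := H) F m (B g f) =
      ∑ i ∈ s, cotwist (H := H) (F.compl₂ (B.flip (antipodeInv H (a i) • f))) (m' i) g := by
  let L : V' →ₗ[ℂ] H ⊗[ℂ] M →ₗ[ℂ] P := TensorProduct.uncurry (RingHom.id ℂ) H M P ∘ₗ
    (B.flip.compl₂ ((lact H V).flip g ∘ₗ antipodeInv H)).compr₂ F.flip
  let Θ : H ⊗[ℂ] (H ⊗[ℂ] M) →ₗ[ℂ] P :=
    TensorProduct.lift (L ∘ₗ (lact H V').flip f ∘ₗ antipodeInv H)
  have hL : ∀ f', L f' = twist (F.compl₂ (B.flip f')) g := fun f' => by ext; rfl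
  have key := congrArg Θ (SAYDModule.coassoc (H := H) m)
  rw [h] at key
  simp only [map_sum, LinearMap.rTensor_tmul, LinearMap.lTensor_tmul] at key
  rw [cotwist_eq_sum _ h]
  refine Eq.trans (Finset.sum_congr rfl fun i _ => ?_) (key.trans
    (Finset.sum_congr rfl fun i _ => ?_))
  · rw [hB (antipodeInvRepr (Repr.arbitrary ℂ (a i))), ← (Repr.arbitrary ℂ (a i)).eq]
    simp only [map_sum, TensorProduct.sum_tmul]
    rfl
  · change L (antipodeInv H (a i) • f) _ = _
    rw [hL]; rfl

end Cotwist

variable {M} in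
/-- The last coface of a cochain. -/
theorem coface_last_apply {n : ℕ} (ψ : M ⊗[ℂ] CN C n →ₗ[ℂ] ℂ) (m : M) {X Y : C.Ob}
    (x : chains C n X Y) (f : C.Hom X Y) :
    coface C M n (Fin.last (n + 1)) ψ (m ⊗ₜ loop C (n + 1) X (snoc C n X Y X x f)) =
      cotwist (H := H) ((TensorProduct.curry ψ).compl₂
        (loop C n Y ∘ₗ (headComp C n Y X Y).flip x)) m f := by
  obtain ⟨s, hs⟩ := exists_coact_eq_sum (H := H) m
  rw [coface, Fin.lastCases_last, LinearMap.lcomp_apply', LinearMap.comp_apply,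
    LinearMap.comp_apply, cyclicOp_tmul, cotwist_eq_sum _ hs, hs, rotate_loop_snoc]
  simp only [map_sum]
  refine Finset.sum_congr rfl fun i _ => ?_
  simp only [TensorProduct.lift.tmul, LinearMap.comp_apply, LinearMap.flip_apply,
    TensorProduct.mk_apply, cnHeadAct_loop, headAct_pre, LinearMap.lTensor_tmul, cnFace_loop,
    face_zero_pre]
  rfl

variable {M} in
theorem hochschild_apply {n : ℕ} (ψ : M ⊗[ℂ] CN C n →ₗ[ℂ] ℂ) (m : M) {X Y : C.Ob}
    (x : chains C n X Y) (f : C.Hom X Y) :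
    hochschild C M n ψ (m ⊗ₜ loop C (n + 1) X (snoc C n X Y X x f)) =
      ψ (m ⊗ₜ loop C n X (innerFaces n X X (snoc C n X Y X x f))) +
        (-1 : ℂ) ^ (n + 1) * cotwist (H := H) ((TensorProduct.curry ψ).compl₂
          (loop C n Y ∘ₗ (headComp C n Y X Y).flip x)) m f := by
  rw [hochschild, Fin.sum_univ_castSucc, LinearMap.add_apply, LinearMap.add_apply,
    LinearMap.smul_apply, LinearMap.smul_apply, coface_last_apply, innerFaces]
  congr 1
  simp only [LinearMap.sum_apply, map_sum, TensorProduct.tmul_sum]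
  refine Finset.sum_congr rfl fun i _ => ?_
  simp only [LinearMap.smul_apply, coface, Fin.lastCases_castSucc, LinearMap.lcomp_apply,
    LinearMap.lTensor_tmul, cnFace_loop, map_smul, TensorProduct.tmul_smul, Fin.val_castSucc]

end Nerve

end

end HopfCyclic

namespace HopfCyclic

noncomputable section

open Coalgebra (Repr)

/-! ### Products of differentials in a DGH-semicategory -/

section Products

variable {H : Type v} [Ring H] [HopfAlgebra ℂ H] {C : HSemicat.{u} H} {S : DGHSemicat.{u} H}
  {obj : C.Ob → S.Ob} (ρ : HSemifunctor C S.degZero obj)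

/-- The differential `∂ρ(f)` of the image of a morphism. -/
def dRho (X Z : C.Ob) : C.Hom Z X →ₗ[ℂ] S.Hom 1 (obj Z) (obj X) := S.d (zero_add 1) ∘ₗ rhoMap ρ X Z

theorem rhoMap_comp {X Y Z : C.Ob} (g : C.Hom Y X) (f : C.Hom Z Y) :
    rhoMap ρ X Z (C.comp g f) = S.comp (zero_add 0) (rhoMap ρ X Y g) (rhoMap ρ Y Z f) :=
  ρ.map_comp g f

theorem rhoMap_smul {X Z : C.Ob} (h : H) (f : C.Hom Z X) :
    rhoMap ρ X Z (h • f) = h • rhoMap ρ X Z f := ρ.map_smul h f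

theorem dRho_smul {X Z : C.Ob} (h : H) (f : C.Hom Z X) :
    dRho ρ X Z (h • f) = h • dRho ρ X Z f := by
  rw [dRho, LinearMap.comp_apply, rhoMap_smul, S.d_smul]; rfl

theorem dRho_comp {X Y Z : C.Ob} (g : C.Hom Y X) (f : C.Hom Z Y) :
    dRho ρ X Z (C.comp g f) = S.comp (add_zero 1) (dRho ρ X Y g) (rhoMap ρ Y Z f) +
      S.comp (zero_add 1) (rhoMap ρ X Y g) (dRho ρ Y Z f) := by
  rw [dRho, LinearMap.comp_apply, rhoMap_comp, S.leibniz _ (zero_add 1) (zero_add 1) _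
    (add_zero 1) (zero_add 1)]
  simp [dRho]

theorem DGHSemicat.d_comp_degZero (S : DGHSemicat.{u} H) {q q' : ℕ} (hq : q + 1 = q')
    {X Y Z : S.Ob} (g : S.Hom 0 Y Z) (f : S.Hom q X Y) :
    S.d hq (S.comp (zero_add q) g f) =
      S.comp (by omega : 1 + q = q') (S.d (zero_add 1) g) f + S.comp (zero_add q') g (S.d hq f) := by
  rw [S.leibniz _ (zero_add 1) hq hq (by omega) (by omega)]
  simp

theorem DGHSemicat.d_comp_d (S : DGHSemicat.{u} H) {q q' q'' : ℕ} (hq : 1 + q = q')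
    (hq' : q' + 1 = q'') {X Y Z : S.Ob} (g : S.Hom 0 Y Z) (f : S.Hom q X Y) :
    S.d hq' (S.comp hq (S.d (zero_add 1) g) f) =
      - S.comp (by omega : 1 + q' = q'') (S.d (zero_add 1) g) (S.d (by omega) f) := by
  rw [S.leibniz hq (p' := 2) (by omega) (q' := q') (by omega) hq' (by omega) (by omega), S.d_d]
  simp

theorem diffProd_single {X Z : C.Ob} (f : C.Hom Z X) :
    diffProd ρ 0 X Z (single C X Z f) = dRho ρ X Z f := rfl

theorem diffProd_pre {n : ℕ} {X Y Z : C.Ob} (f : C.Hom Y X) (x : chains C n Y Z) :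
    diffProd ρ (n + 1) X Z (pre C n X Y Z f x) =
      S.comp (Nat.add_comm 1 (n + 1)) (dRho ρ X Y f) (diffProd ρ n Y Z x) := by
  rw [diffProd, consLift_pre]; rfl

theorem charProd_single {X Z : C.Ob} (f : C.Hom Z X) :
    charProd ρ 0 X Z (single C X Z f) = rhoMap ρ X Z f := rfl

theorem charProd_pre {n : ℕ} {X Y Z : C.Ob} (f : C.Hom Y X) (x : chains C n Y Z) :
    charProd ρ (n + 1) X Z (pre C n X Y Z f x) =
      S.comp (zero_add (n + 1)) (rhoMap ρ X Y f) (diffProd ρ n Y Z x) := by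
  rw [charProd, consLift_pre]; rfl

/-- `f⁰ ⊗ … ⊗ fⁿ ↦ ∂ρ(f⁰) … ∂ρ(fⁿ⁻¹) ρ(fⁿ)`. -/
def rightProd : ∀ (n : ℕ) (X Z : C.Ob), chains C n X Z →ₗ[ℂ] S.Hom n (obj Z) (obj X)
  | 0, X, Z => rhoMap ρ X Z
  | n + 1, X, Z => consLift C fun Y => TensorProduct.lift
      ((S.comp (Nat.add_comm 1 n)).compl₁₂ (dRho ρ X Y) (rightProd n Y Z))

theorem rightProd_single {X Z : C.Ob} (f : C.Hom Z X) :
    rightProd ρ 0 X Z (single C X Z f) = rhoMap ρ X Z f := rfl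

theorem rightProd_pre {n : ℕ} {X Y Z : C.Ob} (f : C.Hom Y X) (x : chains C n Y Z) :
    rightProd ρ (n + 1) X Z (pre C n X Y Z f x) =
      S.comp (Nat.add_comm 1 n) (dRho ρ X Y f) (rightProd ρ n Y Z x) := by
  rw [rightProd, consLift_pre]; rfl

theorem d_diffProd : ∀ {n : ℕ} {X Z : C.Ob} (x : chains C n X Z),
    S.d rfl (diffProd ρ n X Z x) = 0
  | 0, X, Z, x => S.d_d _ _ _
  | n + 1, X, Z, x => by
    induction x using chains_succ_induction with
    | zero => simp
    | add a b ha hb => rw [map_add, map_add, ha, hb, add_zero]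
    | pre Y f x =>
      rw [diffProd_pre, dRho, LinearMap.comp_apply, S.d_comp_d, d_diffProd x, map_zero, neg_zero]

theorem diffProd_smul : ∀ {n : ℕ} {X Z : C.Ob} (h : H) (x : chains C n X Z),
    diffProd ρ n X Z (diagAct C n X Z h x) = h • diffProd ρ n X Z x
  | 0, X, Z, h, x => dRho_smul ρ h x
  | n + 1, X, Z, h, x => by
    induction x using chains_succ_induction with
    | zero => simp
    | add a b ha hb => simp only [map_add, smul_add, ha, hb]
    | pre Y f x =>
      rw [diagAct_pre (Repr.arbitrary ℂ h), diffProd_pre, S.smul_comp_sum _ (Repr.arbitrary ℂ h),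
        map_sum]
      simp only [diffProd_pre, dRho_smul, diffProd_smul]

theorem diffProd_headComp : ∀ {n : ℕ} {W X Z : C.Ob} (g : C.Hom X W) (x : chains C n X Z),
    diffProd ρ n W Z (headComp C n W X Z g x) =
      S.comp (Nat.add_comm 1 n) (dRho ρ W X g) (charProd ρ n X Z x) +
        S.comp (zero_add (n + 1)) (rhoMap ρ W X g) (diffProd ρ n X Z x)
  | 0, W, X, Z, g, x => dRho_comp ρ g x
  | n + 1, W, X, Z, g, x => by
    induction x using chains_succ_induction with
    | zero => simp
    | add a b ha hb => simp only [map_add, ha, hb]; abel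
    | pre Y f x =>
      rw [headComp_pre, diffProd_pre, dRho_comp, charProd_pre, diffProd_pre, map_add,
        LinearMap.add_apply, S.assoc _ (zero_add (n + 1)) _ (Nat.add_comm 1 (n + 1)),
        S.assoc _ (Nat.add_comm 1 (n + 1)) _ (zero_add (n + 2))]

theorem charProd_headComp : ∀ {n : ℕ} {W X Z : C.Ob} (g : C.Hom X W) (x : chains C n X Z),
    charProd ρ n W Z (headComp C n W X Z g x) =
      S.comp (zero_add n) (rhoMap ρ W X g) (charProd ρ n X Z x)
  | 0, W, X, Z, g, x => rhoMap_comp ρ g x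
  | n + 1, W, X, Z, g, x => by
    induction x using chains_succ_induction with
    | zero => simp
    | add a b ha hb => simp only [map_add, ha, hb]
    | pre Y f x =>
      rw [headComp_pre, charProd_pre, rhoMap_comp, charProd_pre,
        S.assoc _ (zero_add (n + 1)) _ (zero_add (n + 1))]

/-- The Leibniz rule splits each `∂(fⁱ fⁱ⁺¹)` into two terms. An undifferentiated factor strictly
inside the product comes from two neighbouring faces with opposite signs and cancels; only those at
the two ends survive. -/
theorem diffProd_innerFaces : ∀ {n : ℕ} {X Z : C.Ob} (x : chains C (n + 1) X Z),
    diffProd ρ n X Z (innerFaces n X Z x) =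
      charProd ρ (n + 1) X Z x + (-1 : ℂ) ^ n • rightProd ρ (n + 1) X Z x
  | 0, X, Z, x => by
    induction x using chains_succ_induction with
    | zero => simp
    | add a b ha hb => simp only [map_add, ha, hb, smul_add]; abel
    | pre Y f x =>
      induction x using chains_zero_induction with
      | single x =>
        rw [innerFaces_single, charProd_pre, rightProd_pre, pow_zero, one_smul, diffProd_single,
          diffProd_single, rightProd_single, dRho_comp]
        exact add_comm _ _
  | n + 1, X, Z, x => by
    induction x using chains_succ_induction with
    | zero => simp
    | add a b ha hb => simp only [map_add, ha, hb, smul_add]; abel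
    | pre Y f x =>
      rw [innerFaces_pre, map_sub, diffProd_headComp, diffProd_pre, diffProd_innerFaces x,
        charProd_pre, rightProd_pre, map_add, map_smul, pow_succ]
      module

theorem diffProd_snoc : ∀ {n : ℕ} {X Y Z : C.Ob} (x : chains C n X Y) (f : C.Hom Z Y),
    diffProd ρ (n + 1) X Z (snoc C n X Y Z x f) =
      S.comp rfl (diffProd ρ n X Y x) (dRho ρ Y Z f)
  | 0, X, Y, Z, x, f => diffProd_pre ρ (n := 0) _ _
  | n + 1, X, Y, Z, x, f => by
    induction x using chains_succ_induction with
    | zero => simp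
    | add a b ha hb => simp only [map_add, LinearMap.add_apply, ha, hb]
    | pre W g x =>
      rw [snoc_pre, diffProd_pre, diffProd_pre, diffProd_snoc x,
        S.assoc (Nat.add_comm 1 (n + 1)) rfl rfl (Nat.add_comm 1 (n + 2))]

theorem charProd_snoc : ∀ {n : ℕ} {X Y Z : C.Ob} (x : chains C n X Y) (f : C.Hom Z Y),
    charProd ρ (n + 1) X Z (snoc C n X Y Z x f) =
      S.comp rfl (charProd ρ n X Y x) (dRho ρ Y Z f)
  | 0, X, Y, Z, x, f => charProd_pre ρ (n := 0) _ _
  | n + 1, X, Y, Z, x, f => by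
    induction x using chains_succ_induction with
    | zero => simp
    | add a b ha hb => simp only [map_add, LinearMap.add_apply, ha, hb]
    | pre W g x =>
      rw [snoc_pre, charProd_pre, charProd_pre, diffProd_snoc ρ x,
        S.assoc (zero_add (n + 1)) rfl rfl (zero_add (n + 2))]

theorem rightProd_snoc : ∀ {n : ℕ} {X Y Z : C.Ob} (x : chains C n X Y) (f : C.Hom Z Y),
    rightProd ρ (n + 1) X Z (snoc C n X Y Z x f) =
      S.comp (add_zero (n + 1)) (diffProd ρ n X Y x) (rhoMap ρ Y Z f)
  | 0, X, Y, Z, x, f => rightProd_pre ρ (n := 0) _ _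
  | n + 1, X, Y, Z, x, f => by
    induction x using chains_succ_induction with
    | zero => simp
    | add a b ha hb => simp only [map_add, LinearMap.add_apply, ha, hb]
    | pre W g x =>
      rw [snoc_pre, rightProd_pre, diffProd_pre, rightProd_snoc x,
        S.assoc _ (add_zero (n + 1)) _ (Nat.add_comm 1 (n + 1))]

/-! #### Insertion of an endomorphism -/

variable (ξ : ∀ X : C.Ob, S.Hom 0 (obj X) (obj X))

/-- `f⁰ ⊗ … ⊗ fⁿ ↦ ∑ⱼ ∂ρ(f⁰) … ∂ρ(fʲ⁻¹) ξ ∂ρ(fʲ) … ∂ρ(fⁿ)`. -/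
def insProd : ∀ (n : ℕ) (X Z : C.Ob), chains C n X Z →ₗ[ℂ] S.Hom (n + 1) (obj Z) (obj X)
  | 0, X, Z => S.comp (zero_add 1) (ξ X) ∘ₗ diffProd ρ 0 X Z
  | n + 1, X, Z => S.comp (zero_add (n + 2)) (ξ X) ∘ₗ diffProd ρ (n + 1) X Z +
      consLift C fun Y => TensorProduct.lift
        ((S.comp (Nat.add_comm 1 (n + 1))).compl₁₂ (dRho ρ X Y) (insProd n Y Z))

/-- `f⁰ ⊗ … ⊗ fⁿ ↦ ∑_{j ≥ 1} ρ(f⁰) ∂ρ(f¹) … ∂ρ(fʲ⁻¹) ξ ∂ρ(fʲ) … ∂ρ(fⁿ)`. -/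
def charInsProd : ∀ (n : ℕ) (X Z : C.Ob), chains C n X Z →ₗ[ℂ] S.Hom n (obj Z) (obj X)
  | 0, _, _ => 0
  | n + 1, X, Z => consLift C fun Y => TensorProduct.lift
      ((S.comp (zero_add (n + 1))).compl₁₂ (rhoMap ρ X Y) (insProd ρ ξ n Y Z))

/-- `f⁰ ⊗ … ⊗ fⁿ ↦ ∑_{j < n} ∂ρ(f⁰) … ∂ρ(fʲ⁻¹) ξ ∂ρ(fʲ) … ∂ρ(fⁿ⁻¹) ρ(fⁿ)`. -/
def rightInsProd : ∀ (n : ℕ) (X Z : C.Ob), chains C n X Z →ₗ[ℂ] S.Hom n (obj Z) (obj X)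
  | 0, _, _ => 0
  | n + 1, X, Z => S.comp (zero_add (n + 1)) (ξ X) ∘ₗ rightProd ρ (n + 1) X Z +
      consLift C fun Y => TensorProduct.lift
        ((S.comp (Nat.add_comm 1 n)).compl₁₂ (dRho ρ X Y) (rightInsProd n Y Z))

/-- `f⁰ ⊗ … ⊗ fⁿ ↦ ∑ⱼ (-1)ʲ ∂ρ(f⁰) … ∂ρ(fʲ⁻¹) δ(fʲ) ∂ρ(fʲ⁺¹) … ∂ρ(fⁿ)`. -/
def derivProd (δ : ∀ X Z : C.Ob, C.Hom Z X →ₗ[ℂ] S.Hom 0 (obj Z) (obj X)) :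
    ∀ (n : ℕ) (X Z : C.Ob), chains C n X Z →ₗ[ℂ] S.Hom n (obj Z) (obj X)
  | 0, X, Z => δ X Z
  | n + 1, X, Z => consLift C fun Y => TensorProduct.lift
      ((S.comp (zero_add (n + 1))).compl₁₂ (δ X Y) (diffProd ρ n Y Z) -
        (S.comp (Nat.add_comm 1 n)).compl₁₂ (dRho ρ X Y) (derivProd δ n Y Z))

theorem insProd_single {X Z : C.Ob} (f : C.Hom Z X) :
    insProd ρ ξ 0 X Z (single C X Z f) = S.comp (zero_add 1) (ξ X) (dRho ρ X Z f) := rfl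

theorem insProd_pre {n : ℕ} {X Y Z : C.Ob} (f : C.Hom Y X) (x : chains C n Y Z) :
    insProd ρ ξ (n + 1) X Z (pre C n X Y Z f x) =
      S.comp (zero_add (n + 2)) (ξ X)
        (S.comp (Nat.add_comm 1 (n + 1)) (dRho ρ X Y f) (diffProd ρ n Y Z x)) +
      S.comp (Nat.add_comm 1 (n + 1)) (dRho ρ X Y f) (insProd ρ ξ n Y Z x) := by
  rw [insProd, LinearMap.add_apply, consLift_pre, LinearMap.comp_apply, diffProd_pre]; rfl

theorem charInsProd_pre {n : ℕ} {X Y Z : C.Ob} (f : C.Hom Y X) (x : chains C n Y Z) :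
    charInsProd ρ ξ (n + 1) X Z (pre C n X Y Z f x) =
      S.comp (zero_add (n + 1)) (rhoMap ρ X Y f) (insProd ρ ξ n Y Z x) := by
  rw [charInsProd, consLift_pre]; rfl

theorem rightInsProd_pre {n : ℕ} {X Y Z : C.Ob} (f : C.Hom Y X) (x : chains C n Y Z) :
    rightInsProd ρ ξ (n + 1) X Z (pre C n X Y Z f x) =
      S.comp (zero_add (n + 1)) (ξ X)
        (S.comp (Nat.add_comm 1 n) (dRho ρ X Y f) (rightProd ρ n Y Z x)) +
      S.comp (Nat.add_comm 1 n) (dRho ρ X Y f) (rightInsProd ρ ξ n Y Z x) := by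
  rw [rightInsProd, LinearMap.add_apply, consLift_pre, LinearMap.comp_apply, rightProd_pre]; rfl

theorem derivProd_pre (δ : ∀ X Z : C.Ob, C.Hom Z X →ₗ[ℂ] S.Hom 0 (obj Z) (obj X)) {n : ℕ}
    {X Y Z : C.Ob} (f : C.Hom Y X) (x : chains C n Y Z) :
    derivProd ρ δ (n + 1) X Z (pre C n X Y Z f x) =
      S.comp (zero_add (n + 1)) (δ X Y f) (diffProd ρ n Y Z x) -
      S.comp (Nat.add_comm 1 n) (dRho ρ X Y f) (derivProd ρ δ n Y Z x) := by
  rw [derivProd, consLift_pre]; rfl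

theorem insProd_snoc : ∀ {n : ℕ} {X Y Z : C.Ob} (x : chains C n X Y) (f : C.Hom Z Y),
    insProd ρ ξ (n + 1) X Z (snoc C n X Y Z x f) =
      S.comp rfl (insProd ρ ξ n X Y x) (dRho ρ Y Z f) +
        S.comp rfl (diffProd ρ n X Y x) (S.comp (zero_add 1) (ξ Y) (dRho ρ Y Z f))
  | 0, X, Y, Z, x, f => by
    induction x using chains_zero_induction with
    | single x =>
      rw [snoc_single, insProd_pre, insProd_single, insProd_single, diffProd_single,
        S.assoc (zero_add 1) rfl rfl (zero_add 2)]
      rfl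
  | n + 1, X, Y, Z, x, f => by
    induction x using chains_succ_induction with
    | zero => simp
    | add a b ha hb => simp only [map_add, LinearMap.add_apply, ha, hb]; abel
    | pre W g x =>
      rw [snoc_pre, insProd_pre, insProd_pre, insProd_snoc x, diffProd_snoc ρ x, diffProd_pre,
        map_add, map_add, LinearMap.add_apply, S.assoc (zero_add (n + 2)) rfl rfl (zero_add (n + 3)),
        S.assoc (Nat.add_comm 1 (n + 1)) rfl rfl (Nat.add_comm 1 (n + 2)),
        S.assoc (Nat.add_comm 1 (n + 1)) rfl rfl (Nat.add_comm 1 (n + 2)),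
        S.assoc (Nat.add_comm 1 (n + 1)) rfl rfl (Nat.add_comm 1 (n + 2))]
      abel

theorem charInsProd_snoc : ∀ {n : ℕ} {X Y Z : C.Ob} (x : chains C n X Y) (f : C.Hom Z Y),
    charInsProd ρ ξ (n + 1) X Z (snoc C n X Y Z x f) =
      S.comp rfl (charInsProd ρ ξ n X Y x) (dRho ρ Y Z f) +
        S.comp rfl (charProd ρ n X Y x) (S.comp (zero_add 1) (ξ Y) (dRho ρ Y Z f))
  | 0, X, Y, Z, x, f => by
    induction x using chains_zero_induction with
    | single x =>
      rw [snoc_single, charInsProd_pre, insProd_single, charProd_single, charInsProd,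
        LinearMap.zero_apply, map_zero, LinearMap.zero_apply]
      exact (zero_add _).symm
  | n + 1, X, Y, Z, x, f => by
    induction x using chains_succ_induction with
    | zero => simp
    | add a b ha hb => simp only [map_add, LinearMap.add_apply, ha, hb]; abel
    | pre W g x =>
      rw [snoc_pre, charInsProd_pre, charInsProd_pre, insProd_snoc ρ ξ x, charProd_pre, map_add,
        S.assoc (zero_add (n + 1)) rfl rfl (zero_add (n + 2)),
        S.assoc (zero_add (n + 1)) rfl rfl (zero_add (n + 2))]

variable {ξ} (hξ : ∀ {X Y : C.Ob} (f : C.Hom X Y), S.comp (zero_add 0) (ξ Y) (rhoMap ρ Y X f) = 0)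

include hξ in
theorem comp_rho_comp_eq_zero {X Y : C.Ob} {n : ℕ} {W : S.Ob} (f : C.Hom X Y)
    (ω : S.Hom n W (obj X)) :
    S.comp (zero_add n) (ξ Y) (S.comp (zero_add n) (rhoMap ρ Y X f) ω) = 0 := by
  rw [← S.assoc (zero_add 0) _ (zero_add n), hξ, map_zero, LinearMap.zero_apply]

-- By the Leibniz rule the head `∂(g f)` has a term beginning with `ρ(g)`; an insertion in front of
-- that term dies since `ξ ρ = 0`. Hence the leading insertion is subtracted in the last summand.
include hξ in
theorem insProd_headComp : ∀ {n : ℕ} {W X Z : C.Ob} (g : C.Hom X W) (x : chains C n X Z),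
    insProd ρ ξ n W Z (headComp C n W X Z g x) =
      S.comp (zero_add (n + 1)) (ξ W)
        (S.comp (Nat.add_comm 1 n) (dRho ρ W X g) (charProd ρ n X Z x)) +
      S.comp (Nat.add_comm 1 n) (dRho ρ W X g) (charInsProd ρ ξ n X Z x) +
      S.comp (zero_add (n + 1)) (rhoMap ρ W X g) (insProd ρ ξ n X Z x -
        S.comp (zero_add (n + 1)) (ξ X) (diffProd ρ n X Z x))
  | 0, W, X, Z, g, x => by
    induction x using chains_zero_induction with
    | single x =>
      rw [headComp_single, insProd_single, insProd_single, dRho_comp, charProd_single,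
        diffProd_single, charInsProd, LinearMap.zero_apply, sub_self, map_add,
        comp_rho_comp_eq_zero ρ hξ, map_zero, map_zero]
      abel
  | n + 1, W, X, Z, g, x => by
    induction x using chains_succ_induction with
    | zero => simp
    | add a b ha hb => simp only [map_add, map_sub, ha, hb]; abel
    | pre Y f x =>
      rw [headComp_pre, insProd_pre, dRho_comp, charProd_pre, insProd_pre, diffProd_pre,
        charInsProd_pre, map_add, LinearMap.add_apply, LinearMap.add_apply,
        S.assoc _ (zero_add (n + 1)) _ (Nat.add_comm 1 (n + 1)),
        S.assoc _ (Nat.add_comm 1 (n + 1)) _ (zero_add (n + 2)),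
        S.assoc _ (zero_add (n + 1)) _ (Nat.add_comm 1 (n + 1)),
        S.assoc _ (Nat.add_comm 1 (n + 1)) _ (zero_add (n + 2)), map_add,
        comp_rho_comp_eq_zero ρ hξ, add_sub_cancel_left]
      abel

theorem rightInsProd_snoc : ∀ {n : ℕ} {X Y Z : C.Ob} (x : chains C n X Y) (f : C.Hom Z Y),
    rightInsProd ρ ξ (n + 1) X Z (snoc C n X Y Z x f) =
      S.comp (add_zero (n + 1)) (insProd ρ ξ n X Y x) (rhoMap ρ Y Z f)
  | 0, X, Y, Z, x, f => by
    induction x using chains_zero_induction with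
    | single x =>
      rw [snoc_single, rightInsProd_pre, insProd_single, rightProd_single, rightInsProd,
        LinearMap.zero_apply, map_zero, S.assoc (zero_add 1) (add_zero 1) rfl (zero_add 1)]
      exact add_zero _
  | n + 1, X, Y, Z, x, f => by
    induction x using chains_succ_induction with
    | zero => simp
    | add a b ha hb => simp only [map_add, LinearMap.add_apply, ha, hb]
    | pre W g x =>
      rw [snoc_pre, rightInsProd_pre, insProd_pre, rightInsProd_snoc x, rightProd_snoc ρ x,
        map_add, LinearMap.add_apply, S.assoc (zero_add (n + 2)) (add_zero (n + 2)) _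
        (zero_add (n + 2)), S.assoc _ (add_zero (n + 1)) _ (Nat.add_comm 1 (n + 1)),
        S.assoc _ (add_zero (n + 1)) _ (Nat.add_comm 1 (n + 1))]

variable {δ : ∀ X Z : C.Ob, C.Hom Z X →ₗ[ℂ] S.Hom 0 (obj Z) (obj X)}
  (hδ : ∀ {X Y : C.Ob} (f : C.Hom X Y), S.comp (zero_add 0) (rhoMap ρ Y X f) (ξ X) = - δ Y X f)

include hδ in
theorem rho_comp_comp {X Y : C.Ob} {n : ℕ} {W : S.Ob} (f : C.Hom X Y)
    (ω : S.Hom n W (obj X)) :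
    S.comp (zero_add n) (rhoMap ρ Y X f) (S.comp (zero_add n) (ξ X) ω) =
      - S.comp (zero_add n) (δ Y X f) ω := by
  rw [← S.assoc (zero_add 0) _ (zero_add n), hδ, map_neg, LinearMap.neg_apply]

-- The telescoping of `diffProd_innerFaces`, with `ξ` obstructing some cancellations. Of the two
-- faces that leave `ρ(fʲ)` undifferentiated, only face `j - 1` has an insertion directly to its
-- right, and `ρ(fʲ) ξ = -δ(fʲ)` turns this into a term of `derivProd`. An insertion directly to its
-- left, from face `j`, vanishes by `ξ ρ = 0`. The remaining terms correct the two ends.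
include hξ hδ in
theorem insProd_innerFaces : ∀ {n : ℕ} {X Z : C.Ob} (x : chains C (n + 1) X Z),
    insProd ρ ξ n X Z (innerFaces n X Z x) =
      charInsProd ρ ξ (n + 1) X Z x + derivProd ρ δ (n + 1) X Z x +
        (-1 : ℂ) ^ n • (rightInsProd ρ ξ (n + 1) X Z x -
          S.comp (add_zero (n + 1)) (rightProd ρ (n + 1) X Z x) (ξ Z))
  | 0, X, Z, x => by
    induction x using chains_succ_induction with
    | zero => simp
    | add a b ha hb => simp only [map_add, LinearMap.add_apply, ha, hb]; module
    | pre Y f x =>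
      induction x using chains_zero_induction with
      | single x =>
        have h₁ : charInsProd ρ ξ 0 Y Z (single C Y Z x) = 0 := rfl
        have h₂ : rightInsProd ρ ξ 0 Y Z (single C Y Z x) = 0 := rfl
        have h₃ : derivProd ρ δ 0 Y Z (single C Y Z x) = δ Y Z x := rfl
        rw [innerFaces_single, ← headComp_single, insProd_headComp ρ hξ, charInsProd_pre,
          derivProd_pre, rightInsProd_pre, rightProd_pre, map_sub, rho_comp_comp ρ hδ,
          S.assoc (Nat.add_comm 1 0) (zero_add 0) _ (Nat.add_comm 1 0), h₁, h₂, h₃, rightProd_single,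
          hδ, insProd_single, rho_comp_comp ρ hδ, charProd_single, diffProd_single]
        simp only [map_zero, map_neg, pow_zero, one_smul]
        abel
  | n + 1, X, Z, x => by
    induction x using chains_succ_induction with
    | zero => simp
    | add a b ha hb => simp only [map_add, LinearMap.add_apply, ha, hb]; module
    | pre Y f x =>
      rw [innerFaces_pre, map_sub, insProd_headComp ρ hξ, insProd_pre, diffProd_innerFaces,
        insProd_innerFaces x, charInsProd_pre, derivProd_pre, rightInsProd_pre, rightProd_pre,
        map_sub, rho_comp_comp ρ hδ, S.assoc _ (add_zero (n + 1)) _ (Nat.add_comm 1 (n + 1))]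
      simp only [map_add, map_sub, map_smul, pow_succ]
      module

variable (hinv : ∀ (h : H) (X : C.Ob), h • ξ X = (Coalgebra.counit h : ℂ) • ξ X)

include hinv in
theorem insProd_smul : ∀ {n : ℕ} {X Z : C.Ob} (h : H) (x : chains C n X Z),
    insProd ρ ξ n X Z (diagAct C n X Z h x) = h • insProd ρ ξ n X Z x
  | 0, X, Z, h, x => by
    induction x using chains_zero_induction with
    | single f =>
      rw [diagAct_single, insProd_single, insProd_single,
        S.smul_comp_of_invariant_left _ (fun h => hinv h X), dRho_smul]
  | n + 1, X, Z, h, x => by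
    have h₁ := diffProd_smul ρ h x
    induction x using chains_succ_induction with
    | zero => simp
    | add a b ha hb =>
      simp only [map_add, smul_add, ha (diffProd_smul ρ h a), hb (diffProd_smul ρ h b)]
    | pre Y f x =>
      rw [diffProd_pre] at h₁
      rw [insProd_pre, smul_add, S.smul_comp_of_invariant_left _ (fun h => hinv h X), ← h₁,
        diagAct_pre (Repr.arbitrary ℂ h), S.smul_comp_sum _ (Repr.arbitrary ℂ h), map_sum,
        map_sum, map_sum, ← Finset.sum_add_distrib]
      refine Finset.sum_congr rfl fun i _ => ?_
      rw [insProd_pre, diffProd_pre, insProd_smul, dRho_smul]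

end Products

end

end HopfCyclic

namespace HopfCyclic

noncomputable section

open Coalgebra (Repr)

/-! ### Cochains defined by a trace, and the coboundary of the insertion cochain -/

section TraceCochains

variable {H : Type v} [Ring H] [HopfAlgebra ℂ H] [BijectiveAntipode H]
  {C : HSemicat.{u} H} {S : DGHSemicat.{u} H}
  {M : Type w} [AddCommGroup M] [Module ℂ M] [Module Hᵐᵒᵖ M] [IsScalarTower ℂ Hᵐᵒᵖ M]
  [SAYDModule H M] {N : ℕ} (T : ClosedGradedTrace S M N) {obj : C.Ob → S.Ob}

/-- The trace as a bilinear map. -/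
def ClosedGradedTrace.trₗ (X : S.Ob) : M →ₗ[ℂ] S.Hom N X X →ₗ[ℂ] ℂ := TensorProduct.curry (T.tr X)

theorem ClosedGradedTrace.trₗ_comp {X Y : S.Ob} {i j : ℕ} (hij : i + j = N) (hji : j + i = N)
    (m : M) (g : S.Hom i X Y) (g' : S.Hom j Y X) :
    T.trₗ X m (S.comp hji g' g) =
      (-1 : ℂ) ^ (i * j) * cotwist (H := H) ((T.trₗ Y).compl₂ ((S.comp hij).flip g')) m g :=
  T.tr_comp hij hji m g g'

/-- The trace property read backwards: `(-1)^{ij}` is its own inverse, and the twist passes through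
`A` because `A` is `H`-linear. -/
theorem ClosedGradedTrace.cotwist_trₗ {V : Type*} [AddCommGroup V] [Module ℂ V] [Module H V]
    [IsScalarTower ℂ H V] {X Y : S.Ob} {i j : ℕ} (hij : i + j = N) (hji : j + i = N)
    (m : M) (A : V →ₗ[ℂ] S.Hom i X Y) (hA : ∀ (h : H) v, A (h • v) = h • A v) (g' : S.Hom j Y X)
    (v : V) :
    cotwist (H := H) ((T.trₗ Y).compl₂ ((S.comp hij).flip g' ∘ₗ A)) m v =
      (-1 : ℂ) ^ (i * j) * T.trₗ X m (S.comp hji g' (A v)) := by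
  rw [T.trₗ_comp hij, ← mul_assoc, ← mul_pow, neg_one_mul, neg_neg, one_pow, one_mul,
    ← cotwist_comp _ A hA]
  rfl

theorem ClosedGradedTrace.trₗ_comp_invariant {X : S.Ob} (m : M) {ξ : S.Hom 0 X X}
    (hξ : ∀ h : H, h • ξ = (Coalgebra.counit h : ℂ) • ξ) (ω : S.Hom N X X) :
    T.trₗ X m (S.comp (add_zero N) ω ξ) = T.trₗ X m (S.comp (zero_add N) ξ ω) := by
  rw [T.trₗ_comp (zero_add N), cotwist_of_invariant _ hξ]
  simp

/-- The cochain `m ⊗ x ↦ T(m ⊗ L(x))`. -/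
def traceCochain {n : ℕ} (L : ∀ X : C.Ob, chains C n X X →ₗ[ℂ] S.Hom N (obj X) (obj X)) :
    M ⊗[ℂ] CN C n →ₗ[ℂ] ℂ :=
  TensorProduct.lift (loopLift C fun X => (TensorProduct.curry (T.tr (obj X))).flip ∘ₗ L X).flip

theorem traceCochain_loop {n : ℕ}
    (L : ∀ X : C.Ob, chains C n X X →ₗ[ℂ] S.Hom N (obj X) (obj X)) (m : M) {X : C.Ob}
    (x : chains C n X X) : traceCochain T L (m ⊗ₜ loop C n X x) = T.trₗ (obj X) m (L X x) := by
  rw [traceCochain, TensorProduct.lift.tmul, LinearMap.flip_apply, loopLift_loop]; rfl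

theorem curry_traceCochain {n : ℕ}
    (L : ∀ X : C.Ob, chains C n X X →ₗ[ℂ] S.Hom N (obj X) (obj X)) {V : Type*} [AddCommGroup V]
    [Module ℂ V] {X : C.Ob} (A : V →ₗ[ℂ] chains C n X X) :
    (TensorProduct.curry (traceCochain T L)).compl₂ (loop C n X ∘ₗ A) =
      (T.trₗ (obj X)).compl₂ (L X ∘ₗ A) :=
  LinearMap.ext₂ fun m f => traceCochain_loop T L m (A f)

theorem traceCochain_mem {n : ℕ} (L : ∀ X : C.Ob, chains C n X X →ₗ[ℂ] S.Hom N (obj X) (obj X))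
    (hL : ∀ (X : C.Ob) (h : H) (x : chains C n X X), L X (diagAct C n X X h x) = h • L X x) :
    traceCochain T L ∈ hopfCochains C M n := by
  rw [mem_hopfCochains_iff]
  intro h m X x
  have := T.tr_smul (obj X) h m (L X x)
  rw [sweedler_eq_sum _ (Repr.arbitrary ℂ h)] at this
  rw [rightAct_tmul _ (Repr.arbitrary ℂ h), map_sum, traceCochain_loop]
  refine Eq.trans (Finset.sum_congr rfl fun i _ => ?_) this
  rw [traceCochain_loop, hL]; rfl

variable (ρ : HSemifunctor C S.degZero obj) {ξ : ∀ X : C.Ob, S.Hom 0 (obj X) (obj X)}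
  (hinv : ∀ (h : H) (X : C.Ob), h • ξ X = (Coalgebra.counit h : ℂ) • ξ X)

variable {n : ℕ} (T : ClosedGradedTrace S M (n + 1))

theorem cyclicOp_loop_single (m : M) {X : C.Ob} (f : C.Hom X X) (ψ : M ⊗[ℂ] CN C 0 →ₗ[ℂ] ℂ) :
    ψ (cyclicOp C M 0 (m ⊗ₜ loop C 0 X (single C X X f))) =
      cotwist (H := H) ((TensorProduct.curry ψ).compl₂ (loop C 0 X ∘ₗ (single C X X).toLinearMap))
        m f := by
  obtain ⟨s, hs⟩ := exists_coact_eq_sum (H := H) m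
  rw [cyclicOp_tmul, cotwist_eq_sum _ hs, hs]
  simp only [map_sum]
  refine Finset.sum_congr rfl fun i _ => ?_
  simp only [TensorProduct.lift.tmul, LinearMap.comp_apply, LinearMap.flip_apply,
    TensorProduct.mk_apply, rotate, LinearMap.id_apply, cnHeadAct_loop, headAct_single]
  rfl

theorem cyclicOp_loop_snoc (m : M) {k : ℕ} {X Y : C.Ob} (x : chains C k X Y) (f : C.Hom X Y)
    (ψ : M ⊗[ℂ] CN C (k + 1) →ₗ[ℂ] ℂ) :
    ψ (cyclicOp C M (k + 1) (m ⊗ₜ loop C (k + 1) X (snoc C k X Y X x f))) =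
      cotwist (H := H) ((TensorProduct.curry ψ).compl₂
        (loop C (k + 1) Y ∘ₗ (pre C k Y X Y).flip x)) m f := by
  obtain ⟨s, hs⟩ := exists_coact_eq_sum (H := H) m
  rw [cyclicOp_tmul, cotwist_eq_sum _ hs, hs, rotate_loop_snoc]
  simp only [map_sum]
  refine Finset.sum_congr rfl fun i _ => ?_
  simp only [TensorProduct.lift.tmul, LinearMap.comp_apply, LinearMap.flip_apply,
    TensorProduct.mk_apply, cnHeadAct_loop, headAct_pre]
  rfl

theorem cotwist_compl₂_add {P : Type*} [AddCommGroup P] [Module ℂ P] {V : Type*} [AddCommGroup V]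
    [Module ℂ V] [Module H V] [IsScalarTower ℂ H V] {W : Type*} [AddCommGroup W] [Module ℂ W]
    (F : M →ₗ[ℂ] W →ₗ[ℂ] P) (A B : V →ₗ[ℂ] W) (m : M) (f : V) :
    cotwist (H := H) (F.compl₂ (A + B)) m f =
      cotwist (H := H) (F.compl₂ A) m f + cotwist (H := H) (F.compl₂ B) m f := by
  obtain ⟨s, hs⟩ := exists_coact_eq_sum (H := H) m
  simp [cotwist_eq_sum _ hs, Finset.sum_add_distrib]

theorem mem_cyclicCochains_iff {n : ℕ} (φ : M ⊗[ℂ] CN C n →ₗ[ℂ] ℂ) :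
    φ ∈ cyclicCochains C M n ↔ φ ∈ hopfCochains C M n ∧ signedCyclic C M n φ = φ := by
  refine and_congr_right fun _ => ?_
  change (LinearMap.id - signedCyclic C M n : Module.End ℂ _) φ = 0 ↔ _
  rw [LinearMap.sub_apply, sub_eq_zero, LinearMap.id_apply, eq_comm]

-- Rotation moves a final `∂ρ(f)`, possibly preceded by `ξ`, to the front. This factor has degree
-- one and the rest degree `n`, so the trace produces the sign `(-1)ⁿ`, which cancels the one in the
-- signed cyclic operator; the set of insertion places is preserved.
include hinv in
theorem insProd_cyclic :
    traceCochain T (fun X => insProd ρ ξ n X X) ∈ cyclicCochains C M n := by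
  rw [mem_cyclicCochains_iff]
  refine ⟨traceCochain_mem T _ fun X h x => insProd_smul ρ hinv h x, ?_⟩
  set ψ := traceCochain T (fun X => insProd ρ ξ n X X) with hψ
  rw [signedCyclic, LinearMap.smul_apply]
  have hA : ∀ (X Y : C.Ob) (h : H) (f : C.Hom X Y),
      (S.comp (zero_add 1) (ξ Y) ∘ₗ dRho ρ Y X) (h • f) =
        h • (S.comp (zero_add 1) (ξ Y) ∘ₗ dRho ρ Y X) f := fun X Y h f => by
    rw [LinearMap.comp_apply, dRho_smul, ← S.smul_comp_of_invariant_left _ (fun h => hinv h Y)]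
    rfl
  cases n with
  | zero =>
    refine cochain_ext fun m X x => ?_
    induction x using chains_zero_induction with
    | single f =>
      rw [LinearMap.smul_apply, LinearMap.lcomp_apply, cyclicOp_loop_single]
      -- With a single factor nothing stands to its left, so `ξ` is moved to the right of `∂ρ(f)` by
      -- its invariance before rotating.
      have key : (T.trₗ (obj X)).compl₂ (insProd ρ ξ 0 X X ∘ₗ (single C X X).toLinearMap) =
          (T.trₗ (obj X)).compl₂ ((S.comp (add_zero 1)).flip (ξ X) ∘ₗ dRho ρ X X) :=
        LinearMap.ext₂ fun m f => (T.trₗ_comp_invariant m (fun h => hinv h X) _).symm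
      rw [hψ, curry_traceCochain]
      rw [key, T.cotwist_trₗ (add_zero 1) (zero_add 1) m _ (dRho_smul ρ), traceCochain_loop,
        insProd_single]
      simp
  | succ k =>
    refine cochain_ext_snoc fun m X Y x f => ?_
    rw [LinearMap.smul_apply, LinearMap.lcomp_apply, cyclicOp_loop_snoc]
    have key : insProd ρ ξ (k + 1) Y Y ∘ₗ (pre C k Y X Y).flip x =
        (S.comp (Nat.add_comm 1 (k + 1))).flip (diffProd ρ k X Y x) ∘ₗ
          (S.comp (zero_add 1) (ξ Y) ∘ₗ dRho ρ Y X) +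
        (S.comp (Nat.add_comm 1 (k + 1))).flip (insProd ρ ξ k X Y x) ∘ₗ dRho ρ Y X := by
      refine LinearMap.ext fun f => ?_
      rw [LinearMap.comp_apply, LinearMap.flip_apply, insProd_pre,
        ← S.assoc (zero_add 1) _ (Nat.add_comm 1 (k + 1))]
      rfl
    have h₁ := T.cotwist_trₗ (Nat.add_comm 1 (k + 1)) rfl m _ (hA X Y) (diffProd ρ k X Y x) f
    have h₂ := T.cotwist_trₗ (Nat.add_comm 1 (k + 1)) rfl m _ (dRho_smul ρ) (insProd ρ ξ k X Y x) f
    rw [hψ, curry_traceCochain, key, cotwist_compl₂_add, h₁, h₂, traceCochain_loop, insProd_snoc,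
      map_add, smul_eq_mul, one_mul, ← mul_add, ← mul_assoc, ← mul_pow, neg_one_mul,
      neg_neg, one_pow, one_mul, add_comm]
    rfl

variable (hξ : ∀ {X Y : C.Ob} (f : C.Hom X Y), S.comp (zero_add 0) (ξ Y) (rhoMap ρ Y X f) = 0)
  {δ : ∀ X Z : C.Ob, C.Hom Z X →ₗ[ℂ] S.Hom 0 (obj Z) (obj X)}
  (hδ : ∀ {X Y : C.Ob} (f : C.Hom X Y), S.comp (zero_add 0) (rhoMap ρ Y X f) (ξ X) = - δ Y X f)

-- The inner faces contribute `derivProd` plus terms in which an end factor is not differentiated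
-- (`insProd_innerFaces`). Rotated back through the trace, the last coface splits into three terms
-- that cancel these; moving the invariant `ξ` around the trace matches the term with `rightProd`.
include hinv hξ hδ in
theorem hochschild_insProd :
    hochschild C M n (traceCochain T fun X => insProd ρ ξ n X X) =
      traceCochain T fun X => derivProd ρ δ (n + 1) X X := by
  have hA : ∀ (X Y : C.Ob) (h : H) (f : C.Hom X Y),
      (S.comp (zero_add 1) (ξ Y) ∘ₗ dRho ρ Y X) (h • f) =
        h • (S.comp (zero_add 1) (ξ Y) ∘ₗ dRho ρ Y X) f := fun X Y h f => by
    rw [LinearMap.comp_apply, dRho_smul, ← S.smul_comp_of_invariant_left _ (fun h => hinv h Y)]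
    rfl
  refine cochain_ext_snoc fun m X Y x f => ?_
  rw [hochschild_apply]
  have key : insProd ρ ξ n Y Y ∘ₗ (headComp C n Y X Y).flip x =
      (S.comp (Nat.add_comm 1 n)).flip (charProd ρ n X Y x) ∘ₗ
        (S.comp (zero_add 1) (ξ Y) ∘ₗ dRho ρ Y X) +
      (S.comp (Nat.add_comm 1 n)).flip (charInsProd ρ ξ n X Y x) ∘ₗ dRho ρ Y X +
      (S.comp (zero_add (n + 1))).flip (insProd ρ ξ n X Y x -
        S.comp (zero_add (n + 1)) (ξ X) (diffProd ρ n X Y x)) ∘ₗ rhoMap ρ Y X := by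
    refine LinearMap.ext fun f => ?_
    rw [LinearMap.comp_apply, LinearMap.flip_apply, insProd_headComp ρ hξ,
      ← S.assoc (zero_add 1) _ (Nat.add_comm 1 n)]
    rfl
  have h₁ := T.cotwist_trₗ (Nat.add_comm 1 n) rfl m _ (hA X Y) (charProd ρ n X Y x) f
  have h₂ := T.cotwist_trₗ (Nat.add_comm 1 n) rfl m _ (dRho_smul ρ) (charInsProd ρ ξ n X Y x) f
  have h₃ := T.cotwist_trₗ (zero_add (n + 1)) (add_zero _) m _ (rhoMap_smul ρ)
    (insProd ρ ξ n X Y x - S.comp (zero_add (n + 1)) (ξ X) (diffProd ρ n X Y x)) f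
  have h₄ := T.trₗ_comp_invariant m (fun h => hinv h X)
    (S.comp (add_zero (n + 1)) (diffProd ρ n X Y x) (rhoMap ρ Y X f))
  have h₅ := congrArg (T.trₗ (obj X) m) (charInsProd_snoc ρ ξ x f)
  have e : S.comp (add_zero (n + 1)) (insProd ρ ξ n X Y x -
      S.comp (zero_add (n + 1)) (ξ X) (diffProd ρ n X Y x)) (rhoMap ρ Y X f) =
      S.comp (add_zero (n + 1)) (insProd ρ ξ n X Y x) (rhoMap ρ Y X f) -
        S.comp (zero_add (n + 1)) (ξ X)
          (S.comp (add_zero (n + 1)) (diffProd ρ n X Y x) (rhoMap ρ Y X f)) := by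
    rw [map_sub, LinearMap.sub_apply, S.assoc (zero_add (n + 1)) (add_zero (n + 1))
      (add_zero (n + 1)) (zero_add (n + 1))]
  rw [(congrArg (T.trₗ (obj X) m) e).trans (map_sub _ _ _), ← h₄] at h₃
  rw [map_add] at h₅
  rw [curry_traceCochain, key, cotwist_compl₂_add, cotwist_compl₂_add, h₁, h₂, h₃, traceCochain_loop, traceCochain_loop,
    insProd_innerFaces ρ hξ hδ, map_add, map_add, map_smul, map_sub, h₅, rightInsProd_snoc,
    rightProd_snoc]
  simp only [one_mul, zero_mul, pow_zero, pow_succ, smul_eq_mul, LinearMap.comp_apply]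
  have h₆ : ((-1 : ℂ) ^ n) * (-1 : ℂ) ^ n = 1 := by rw [← mul_pow]; simp
  linear_combination (-(T.trₗ (obj X)) m
    (((S.comp rfl) (charProd ρ n X Y x)) (S.comp (zero_add 1) (ξ Y) (dRho ρ Y X f))) -
    (T.trₗ (obj X)) m (S.comp rfl (charInsProd ρ ξ n X Y x) (dRho ρ Y X f))) * h₆

end TraceCochains

end

end HopfCyclic

namespace HopfCyclic

noncomputable section

open Coalgebra (Repr)

/-! ### Polynomial paths in complex vector spaces -/

section PolyPath

/-- `PolyPath F F'` says that `F` is a polynomial path in a complex vector space, with derivative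
the path `F'`. -/
inductive PolyPath {V : Type*} [AddCommGroup V] [Module ℂ V] : (ℝ → V) → (ℝ → V) → Prop
  -- For `k = 0` the exponent `k - 1` is truncated to `0`, but the factor `k` makes the derivative
  -- zero as required.
  | monomial (k : ℕ) (v : V) :
      PolyPath (fun t => (t : ℂ) ^ k • v) (fun t => ((k : ℂ) * (t : ℂ) ^ (k - 1)) • v)
  | add {F F' G G' : ℝ → V} : PolyPath F F' → PolyPath G G' →
      PolyPath (fun t => F t + G t) (fun t => F' t + G' t)

namespace PolyPath

variable {U V W : Type*} [AddCommGroup U] [Module ℂ U] [AddCommGroup V] [Module ℂ V]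
  [AddCommGroup W] [Module ℂ W]

theorem const (v : V) : PolyPath (fun _ => v) (fun _ => 0) := by
  simpa using monomial 0 v

theorem linear (v w : V) : PolyPath (fun t => v + (t : ℂ) • w) (fun _ => w) := by
  simpa using (const v).add (monomial 1 w)

theorem map (L : V →ₗ[ℂ] W) {F F' : ℝ → V} (h : PolyPath F F') :
    PolyPath (fun t => L (F t)) (fun t => L (F' t)) := by
  induction h with
  | monomial k v => simpa using monomial k (L v)
  | add _ _ h₁ h₂ => simpa using h₁.add h₂

theorem map₂ (B : U →ₗ[ℂ] V →ₗ[ℂ] W) {F F' : ℝ → U} {G G' : ℝ → V} (h : PolyPath F F')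
    (h' : PolyPath G G') :
    PolyPath (fun t => B (F t) (G t)) (fun t => B (F' t) (G t) + B (F t) (G' t)) := by
  induction h with
  | monomial k u =>
    induction h' with
    | monomial l v =>
      convert monomial (k + l) (B u v) using 2 with t t
      · simp only [map_smul, LinearMap.smul_apply, smul_smul, pow_add]
        rw [mul_comm]
      · simp only [map_smul, LinearMap.smul_apply, smul_smul, ← add_smul]
        congr 1
        rcases k with _ | k <;> rcases l with _ | l <;>
          (simp [pow_succ, pow_add, add_mul, ← add_assoc]; try ring)
    | add _ _ h₁ h₂ =>
      convert h₁.add h₂ using 2 with t t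
      · simp
      · simp only [map_add]; abel
  | add _ _ h₁ h₂ =>
    convert h₁.add h₂ using 2 with t t
    · simp
    · simp only [map_add, LinearMap.add_apply]; abel

/-- Analysis enters only here, for scalar paths. Morphism spaces carry no topology, so paths in them
are differentiated formally and become genuine functions after the trace is applied. -/
theorem hasDerivAt {F F' : ℝ → ℂ} (h : PolyPath F F') (t : ℝ) : HasDerivAt F (F' t) t := by
  induction h with
  | monomial k v =>
    simpa [smul_eq_mul] using ((hasDerivAt_pow k (t : ℂ)).comp_ofReal).mul_const v
  | add _ _ h₁ h₂ => exact h₁.add h₂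

theorem continuous {F F' : ℝ → ℂ} (h : PolyPath F F') : Continuous F :=
  continuous_iff_continuousAt.2 fun t => (h.hasDerivAt t).continuousAt

theorem continuous_deriv {F F' : ℝ → ℂ} (h : PolyPath F F') : Continuous F' := by
  induction h with
  | monomial k v => fun_prop
  | add _ _ h₁ h₂ => exact h₁.add h₂

end PolyPath

/-- The integral over `[0, 1]` of a path of linear functionals. -/
def integralFunctional {V : Type*} [AddCommGroup V] [Module ℂ V] (ψ : ℝ → V →ₗ[ℂ] ℂ)
    (hψ : ∀ z, Continuous fun t => ψ t z) : V →ₗ[ℂ] ℂ where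
  toFun z := ∫ t in (0 : ℝ)..1, ψ t z
  map_add' x y := by
    simp only [map_add]
    exact intervalIntegral.integral_add ((hψ x).intervalIntegrable _ _)
      ((hψ y).intervalIntegrable _ _)
  map_smul' c x := by
    simp only [map_smul, smul_eq_mul, RingHom.id_apply]
    exact intervalIntegral.integral_const_mul _ _

end PolyPath

/-! ### The homotopy formula -/

section Homotopy

/-- `b` is precomposition with a linear map of chains, so its values on a cochain defined by an
integral can be computed under the integral sign. -/
theorem exists_hochschild_eq_comp {H : Type v} [Ring H] [HopfAlgebra ℂ H] [BijectiveAntipode H]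
    {C : HSemicat.{u} H} {M : Type w} [AddCommGroup M] [Module ℂ M] [Module Hᵐᵒᵖ M]
    [IsScalarTower ℂ Hᵐᵒᵖ M] [SAYDModule H M] (n : ℕ) :
    ∃ L : M ⊗[ℂ] CN C (n + 1) →ₗ[ℂ] M ⊗[ℂ] CN C n,
      ∀ ψ : M ⊗[ℂ] CN C n →ₗ[ℂ] ℂ, hochschild C M n ψ = ψ ∘ₗ L := by
  have h : ∀ i : Fin (n + 2), ∃ L : M ⊗[ℂ] CN C (n + 1) →ₗ[ℂ] M ⊗[ℂ] CN C n,
      ∀ ψ : M ⊗[ℂ] CN C n →ₗ[ℂ] ℂ, coface C M n i ψ = ψ ∘ₗ L := by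
    refine Fin.lastCases ⟨(cnFace C n 0).lTensor M ∘ₗ cyclicOp C M (n + 1), fun ψ => ?_⟩
      fun j => ⟨(cnFace C n j).lTensor M, fun ψ => ?_⟩
    · rw [coface, Fin.lastCases_last]; rfl
    · rw [coface, Fin.lastCases_castSucc]; rfl
  choose L hL using h
  refine ⟨∑ i : Fin (n + 2), (-1 : ℂ) ^ (i : ℕ) • L i, fun ψ => ?_⟩
  refine LinearMap.ext fun z => ?_
  simp [hochschild, hL, LinearMap.sum_apply]

variable {H : Type v} [Ring H] [HopfAlgebra ℂ H] {C : HSemicat.{u} H} {S : DGHSemicat.{u} H}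
  {obj : C.Ob → S.Ob} {γ : ℝ → HSemifunctor C S.degZero obj}
  {δ : ∀ X Z : C.Ob, C.Hom Z X →ₗ[ℂ] S.Hom 0 (obj Z) (obj X)}
  (hγ : ∀ (t : ℝ) {X Z : C.Ob} (f : C.Hom Z X),
    rhoMap (γ t) X Z f = rhoMap (γ 0) X Z f + (t : ℂ) • δ X Z f)

include hγ

theorem polyPath_rhoMap {X Z : C.Ob} (f : C.Hom Z X) :
    PolyPath (fun t => rhoMap (γ t) X Z f) (fun _ => δ X Z f) := by
  simpa only [← hγ] using PolyPath.linear (rhoMap (γ 0) X Z f) (δ X Z f)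

theorem polyPath_dRho {X Z : C.Ob} (f : C.Hom Z X) :
    PolyPath (fun t => dRho (γ t) X Z f) (fun _ => S.d (zero_add 1) (δ X Z f)) :=
  (polyPath_rhoMap hγ f).map (S.d (zero_add 1))

/-- Differentiating a product of factors `∂ρ(fʲ)` replaces one of them by `∂δ(fʲ)`. All other
factors are closed, so the outcome is exact; the signs in `derivProd` come from moving `∂` past the
factors in front of `δ(fʲ)`. -/
theorem polyPath_diffProd : ∀ {n : ℕ} {X Z : C.Ob} (x : chains C n X Z),
    PolyPath (fun t => diffProd (γ t) n X Z x)
      (fun t => S.d rfl (derivProd (γ t) δ n X Z x))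
  | 0, X, Z, x => polyPath_dRho hγ x
  | n + 1, X, Z, x => by
    induction x using chains_succ_induction with
    | zero => simpa using PolyPath.const 0
    | add a b ha hb => simpa using ha.add hb
    | pre Y f x =>
      have h := (polyPath_dRho hγ f).map₂ (S.comp (Nat.add_comm 1 (n + 1)))
        (polyPath_diffProd x)
      simp only [diffProd_pre, derivProd_pre]
      convert h using 2 with t
      rw [map_sub, dRho, LinearMap.comp_apply, S.d_comp_d _ rfl, S.d_comp_degZero rfl, d_diffProd,
        map_zero]
      abel

theorem polyPath_charProd {n : ℕ} {X Y Z : C.Ob} (f : C.Hom Y X) (x : chains C n Y Z) :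
    PolyPath (fun t => charProd (γ t) (n + 1) X Z (pre C n X Y Z f x))
      (fun t => S.comp (zero_add (n + 1)) (δ X Y f) (diffProd (γ t) n Y Z x) +
        S.comp (zero_add (n + 1)) (rhoMap (γ t) X Y f)
          (S.d rfl (derivProd (γ t) δ n Y Z x))) := by
  simpa only [charProd_pre] using
    (polyPath_rhoMap hγ f).map₂ (S.comp (zero_add (n + 1))) (polyPath_diffProd hγ x)

theorem exists_polyPath_insProd (ξ : ∀ X : C.Ob, S.Hom 0 (obj X) (obj X)) :
    ∀ {n : ℕ} {X Z : C.Ob} (x : chains C n X Z),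
      ∃ F', PolyPath (fun t => insProd (γ t) ξ n X Z x) F'
  | 0, X, Z, x => ⟨_, (polyPath_diffProd hγ (n := 0) x).map (S.comp (zero_add 1) (ξ X))⟩
  | n + 1, X, Z, x => by
    have h := polyPath_diffProd hγ x
    induction x using chains_succ_induction with
    | zero => simpa using ⟨_, PolyPath.const 0⟩
    | add a b ha hb =>
      obtain ⟨F', hF⟩ := ha (polyPath_diffProd hγ a)
      obtain ⟨G', hG⟩ := hb (polyPath_diffProd hγ b)
      exact ⟨_, by simpa using hF.add hG⟩
    | pre Y f x =>
      obtain ⟨F', hF⟩ := exists_polyPath_insProd ξ x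
      simp only [insProd_pre, ← diffProd_pre]
      exact ⟨_, (h.map (S.comp (zero_add (n + 2)) (ξ X))).add
        ((polyPath_dRho hγ f).map₂ (S.comp (Nat.add_comm 1 (n + 1))) hF)⟩

variable [BijectiveAntipode H] {M : Type w} [AddCommGroup M] [Module ℂ M] [Module Hᵐᵒᵖ M]
  [IsScalarTower ℂ Hᵐᵒᵖ M] [SAYDModule H M] {n : ℕ} (T : ClosedGradedTrace S M (n + 1))

/-- The velocity of `charProd` is `δ(f⁰) ∂ρ(f¹) ⋯` plus `ρ(f⁰)` times an exact term. Since the trace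
is closed, `∂` may be moved onto `ρ(f⁰)` with a minus sign, which yields the remaining terms of
`derivProd`. -/
theorem polyPath_trace (m : M) {X : C.Ob} (x : chains C (n + 1) X X) :
    PolyPath (fun t => T.trₗ (obj X) m (charProd (γ t) (n + 1) X X x))
      (fun t => T.trₗ (obj X) m (derivProd (γ t) δ (n + 1) X X x)) := by
  induction x using chains_succ_induction with
  | zero => simpa using PolyPath.const (0 : ℂ)
  | add a b ha hb => simpa using ha.add hb
  | pre Y f x =>
    convert (polyPath_charProd hγ f x).map (T.trₗ (obj X) m) using 2 with t
    have h := T.tr_d (obj X) m rfl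
      (S.comp (zero_add n) (rhoMap (γ t) X Y f) (derivProd (γ t) δ n Y X x))
    change T.trₗ (obj X) m _ = 0 at h
    rw [S.d_comp_degZero rfl, map_add] at h
    rw [derivProd_pre, map_sub, map_add, sub_eq_add_neg]
    congr 1
    exact neg_eq_of_add_eq_zero_right h

/-- The primitive is `∫₀¹ ψ_t dt`, where `ψ_t` inserts `ξ` into products of differentials along
`γ_t`. Invariance and cyclicity are linear conditions, hence survive integration. Applying `b` gives
the integral of the derivative of the character, which the fundamental theorem of calculus
evaluates. -/
theorem character_sub_mem {ξ : ∀ X : C.Ob, S.Hom 0 (obj X) (obj X)}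
    (hinv : ∀ (h : H) (X : C.Ob), h • ξ X = (Coalgebra.counit h : ℂ) • ξ X)
    (hξ : ∀ (t : ℝ) {X Y : C.Ob} (f : C.Hom X Y),
      S.comp (zero_add 0) (ξ Y) (rhoMap (γ t) Y X f) = 0)
    (hδ : ∀ (t : ℝ) {X Y : C.Ob} (f : C.Hom X Y),
      S.comp (zero_add 0) (rhoMap (γ t) Y X f) (ξ X) = - δ Y X f) :
    (traceCochain T (fun X => charProd (γ 1) (n + 1) X X) -
      traceCochain T (fun X => charProd (γ 0) (n + 1) X X)) ∈ coboundaries C M (n + 1) := by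
  let ψ : ℝ → M ⊗[ℂ] CN C n →ₗ[ℂ] ℂ := fun t => traceCochain T fun X => insProd (γ t) ξ n X X
  have hc : ∀ z, Continuous fun t => ψ t z := by
    intro z
    induction z using TensorProduct.induction_on with
    | zero => simpa using continuous_const
    | add a b ha hb => simp only [map_add]; exact ha.add hb
    | tmul m x =>
      induction x using CN_induction with
      | zero => simpa using continuous_const
      | add a b ha hb => simp only [map_add, TensorProduct.tmul_add]; exact ha.add hb
      | loop X x =>
        obtain ⟨F', hF⟩ := exists_polyPath_insProd hγ ξ x
        simpa only [ψ, traceCochain_loop] using (hF.map (T.trₗ (obj X) m)).continuous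
  have hcyc : ∀ t, ψ t ∈ cyclicCochains C M n := fun t => insProd_cyclic (γ t) hinv T
  refine ⟨integralFunctional ψ hc, ?_, ?_⟩
  · change _ ∈ cyclicCochains C M n
    rw [mem_cyclicCochains_iff]
    refine ⟨fun h z => ?_, LinearMap.ext fun z => ?_⟩
    · have : ∀ t, ψ t (rightAct C M n h z) = Coalgebra.counit h * ψ t z :=
        fun t => (hcyc t).1 h z
      change ∫ t in (0 : ℝ)..1, ψ t (rightAct C M n h z) = _
      simp only [this]
      exact intervalIntegral.integral_const_mul _ _
    · have : ∀ t, (-1 : ℂ) ^ n * ψ t (cyclicOp C M n z) = ψ t z := fun t =>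
        LinearMap.congr_fun ((mem_cyclicCochains_iff _).1 (hcyc t)).2 z
      change (-1 : ℂ) ^ n * ∫ t in (0 : ℝ)..1, ψ t (cyclicOp C M n z) = _
      rw [← intervalIntegral.integral_const_mul]
      simp only [this]
      rfl
  · obtain ⟨L, hL⟩ := exists_hochschild_eq_comp (C := C) (M := M) n
    refine cochain_ext fun m X x => ?_
    rw [hL, LinearMap.sub_apply, traceCochain_loop, traceCochain_loop]
    have : ∀ t, ψ t (L (m ⊗ₜ loop C (n + 1) X x)) =
        T.trₗ (obj X) m (derivProd (γ t) δ (n + 1) X X x) := fun t => by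
      rw [← LinearMap.comp_apply, ← hL, hochschild_insProd (γ t) hinv T (hξ t) (hδ t),
        traceCochain_loop]
    change ∫ t in (0 : ℝ)..1, ψ t (L (m ⊗ₜ loop C (n + 1) X x)) = _
    simp only [this]
    have hp := polyPath_trace hγ T m x
    exact intervalIntegral.integral_eq_sub_of_hasDerivAt (fun t _ => hp.hasDerivAt t)
      (hp.continuous_deriv.intervalIntegrable _ _)

end Homotopy

end

end HopfCyclic

namespace HopfCyclic

noncomputable section

open Coalgebra (Repr)

/-! ### Traces given by bilinear maps -/

section OfBilinear

variable {H : Type v} [Ring H] [HopfAlgebra ℂ H] [BijectiveAntipode H] {S : DGHSemicat.{u} H}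
  {M : Type w} [AddCommGroup M] [Module ℂ M] [Module Hᵐᵒᵖ M]
  [IsScalarTower ℂ Hᵐᵒᵖ M] [SAYDModule H M] {N : ℕ}

/-- A closed graded trace given by bilinear maps. -/
def ClosedGradedTrace.ofBilinear (F : ∀ X, M →ₗ[ℂ] S.Hom N X X →ₗ[ℂ] ℂ)
    (smul : ∀ (X) (h : H) (m : M) (f : S.Hom N X X), ∑ i ∈ (Repr.arbitrary ℂ h).index,
      F X (ract H M ((Repr.arbitrary ℂ h).left i) m)
        (HopfAlgebra.antipode ℂ ((Repr.arbitrary ℂ h).right i) • f) = Coalgebra.counit h * F X m f)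
    (d : ∀ (X) (m : M) {p : ℕ} (hp : p + 1 = N) (f' : S.Hom p X X), F X m (S.d hp f') = 0)
    (comp : ∀ {X Y} {i j : ℕ} (hij : i + j = N) (hji : j + i = N) (m : M) (g : S.Hom i X Y)
      (g' : S.Hom j Y X), F X m (S.comp hji g' g) =
        (-1 : ℂ) ^ (i * j) * cotwist (H := H) ((F Y).compl₂ ((S.comp hij).flip g')) m g) :
    ClosedGradedTrace S M N where
  tr X := TensorProduct.lift (F X)
  tr_smul X h m f := by
    rw [sweedler_eq_sum _ (Repr.arbitrary ℂ h), TensorProduct.lift.tmul, ← smul]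
    rfl
  tr_d X m _ hp f' := d X m hp f'
  tr_comp hij hji m g g' := comp hij hji m g g'

end OfBilinear

/-! ### Matrices over a DGH-semicategory -/

section MatrixSemicat

variable {H : Type v} [Ring H] [HopfAlgebra ℂ H]

/-- The DGH-semicategory of `r × r` matrices over `S`. -/
abbrev DGHSemicat.matrix (S : DGHSemicat.{u} H) (r : ℕ) : DGHSemicat.{u} H where
  Ob := S.Ob
  Hom n X Y := Fin r → Fin r → S.Hom n X Y
  comp {p q n} h {X Y Z} := LinearMap.mk₂ ℂ (fun A B a b => ∑ k, S.comp h (A a k) (B k b))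
    (fun _ _ _ => by ext; simp [Finset.sum_add_distrib])
    (fun _ _ _ => by ext; simp [Finset.smul_sum])
    (fun _ _ _ => by ext; simp [Finset.sum_add_distrib])
    (fun _ _ _ => by ext; simp [Finset.smul_sum])
  assoc {p q s t u n} hpq hqr hs ht {W X Y Z} A B D := by
    ext a b
    simp only [LinearMap.mk₂_apply, map_sum, LinearMap.sum_apply, S.assoc hpq hqr hs ht]
    exact Finset.sum_comm
  smul_comp {p q n} hn {X Y Z} h A B := by
    rw [sweedler_eq_sum _ (Repr.arbitrary ℂ h)]
    ext a b
    simp only [Pi.smul_apply, LinearMap.mk₂_apply, Finset.smul_sum, Finset.sum_apply,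
      S.smul_comp_sum hn (Repr.arbitrary ℂ h)]
    exact Finset.sum_comm
  d {n n'} h {X Y} :=
    { toFun := fun A a b => S.d h (A a b)
      map_add' := fun _ _ => by ext; simp
      map_smul' := fun _ _ => by ext; simp }
  d_d {n n' n''} h h' {X Y} A := by ext a b; exact S.d_d h h' (A a b)
  d_smul {n n'} hn {X Y} h A := by ext a b; exact S.d_smul hn h (A a b)
  leibniz {p q n p' q' n'} hn hp' hq' hn' h₁ h₂ {X Y Z} A B := by
    ext a b
    simp only [LinearMap.mk₂_apply, LinearMap.coe_mk, AddHom.coe_mk, map_sum, Pi.add_apply,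
      Pi.smul_apply, Finset.smul_sum, S.leibniz hn hp' hq' hn' h₁ h₂, Finset.sum_add_distrib]

variable {S : DGHSemicat.{u} H} {r : ℕ}

/-- The matrix entries, as linear maps. -/
def DGHSemicat.matrixEntry (S : DGHSemicat.{u} H) {r : ℕ} (n : ℕ) (X Y : S.Ob) (a b : Fin r) :
    (S.matrix r).Hom n X Y →ₗ[ℂ] S.Hom n X Y where
  toFun A := A a b
  map_add' _ _ := rfl
  map_smul' _ _ := rfl

theorem DGHSemicat.matrixEntry_smul {n : ℕ} {X Y : S.Ob} (a b : Fin r) (h : H)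
    (A : (S.matrix r).Hom n X Y) :
    S.matrixEntry n X Y a b (h • A) = h • S.matrixEntry n X Y a b A := rfl

theorem DGHSemicat.matrixEntry_comp {p q n : ℕ} (h : p + q = n) {X Y Z : S.Ob} (a b : Fin r)
    (A : (S.matrix r).Hom p Y Z) (B : (S.matrix r).Hom q X Y) :
    S.matrixEntry n X Z a b ((S.matrix r).comp h A B) =
      ∑ k, S.comp h (S.matrixEntry p Y Z a k A) (S.matrixEntry q X Y k b B) := rfl

theorem DGHSemicat.matrix_ext {n : ℕ} {X Y : S.Ob} {A B : (S.matrix r).Hom n X Y}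
    (h : ∀ a b, S.matrixEntry n X Y a b A = S.matrixEntry n X Y a b B) : A = B :=
  funext fun a => funext fun b => h a b

/-- The matrix with the given entries. -/
def DGHSemicat.matrixOf (S : DGHSemicat.{u} H) {r n : ℕ} {X Y : S.Ob}
    (A : Fin r → Fin r → S.Hom n X Y) : (S.matrix r).Hom n X Y := A

/-- The matrix with the given entries, as a linear map. -/
def DGHSemicat.matrixOfₗ (S : DGHSemicat.{u} H) {r n : ℕ} {X Y : S.Ob} {V : Type*} [AddCommGroup V]
    [Module ℂ V] (A : Fin r → Fin r → V →ₗ[ℂ] S.Hom n X Y) : V →ₗ[ℂ] (S.matrix r).Hom n X Y where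
  toFun f := S.matrixOf fun a b => A a b f
  map_add' f g := DGHSemicat.matrix_ext fun a b => map_add (A a b) f g
  map_smul' t f := DGHSemicat.matrix_ext fun a b => map_smul (A a b) t f

theorem DGHSemicat.matrixEntry_matrixOfₗ {n : ℕ} {X Y : S.Ob} {V : Type*} [AddCommGroup V]
    [Module ℂ V] (A : Fin r → Fin r → V →ₗ[ℂ] S.Hom n X Y) (a b : Fin r) (f : V) :
    S.matrixEntry n X Y a b (S.matrixOfₗ A f) = A a b f := rfl

section Trace

variable [BijectiveAntipode H] {M : Type w} [AddCommGroup M] [Module ℂ M] [Module Hᵐᵒᵖ M]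
  [IsScalarTower ℂ Hᵐᵒᵖ M] [SAYDModule H M] {N : ℕ}

/-- The sum of the traces of the diagonal entries, as a bilinear map. -/
def ClosedGradedTrace.matrixTr (T : ClosedGradedTrace S M N) (r : ℕ) (X : S.Ob) :
    M →ₗ[ℂ] (S.matrix r).Hom N X X →ₗ[ℂ] ℂ :=
  ∑ a : Fin r, (T.trₗ X).compl₂ (S.matrixEntry N X X a a)

theorem ClosedGradedTrace.matrixTr_apply (T : ClosedGradedTrace S M N) {X : S.Ob} (m : M)
    (A : (S.matrix r).Hom N X X) :
    T.matrixTr r X m A = ∑ a, T.trₗ X m (S.matrixEntry N X X a a A) := by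
  simp [ClosedGradedTrace.matrixTr]

theorem ClosedGradedTrace.trₗ_smul (T : ClosedGradedTrace S M N) {h : H} {ι : Type*}
    (R : Repr ℂ h ι) (X : S.Ob) (m : M) (f : S.Hom N X X) :
    ∑ i ∈ R.index, T.trₗ X (ract H M (R.left i) m) (HopfAlgebra.antipode ℂ (R.right i) • f) =
      Coalgebra.counit h * T.trₗ X m f := by
  have := T.tr_smul X h m f
  rwa [sweedler_eq_sum _ R] at this

/-- The sum of the traces of the diagonal entries. -/
def ClosedGradedTrace.matrix (T : ClosedGradedTrace S M N) (r : ℕ) :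
    ClosedGradedTrace (S.matrix r) M N :=
  .ofBilinear (T.matrixTr r)
    (fun (X : S.Ob) h m A => by
      simp only [T.matrixTr_apply]
      rw [Finset.sum_comm, Finset.mul_sum]
      exact Finset.sum_congr rfl fun a _ => T.trₗ_smul _ X m _)
    (fun (X : S.Ob) m p hp A => by
      simp only [T.matrixTr_apply]
      exact Finset.sum_eq_zero fun a _ => T.tr_d X m hp _)
    (fun {X Y : S.Ob} {i j} hij hji m A A' => by
      obtain ⟨s, hs⟩ := exists_coact_eq_sum (H := H) m
      rw [cotwist_eq_sum _ hs]
      have h₁ : ∀ a, T.trₗ X m (S.matrixEntry N X X a a ((S.matrix r).comp hji A' A)) =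
          ∑ k, (-1 : ℂ) ^ (i * j) * ∑ x ∈ s, T.trₗ Y x.2 (S.comp hij
            (antipodeInv H x.1 • S.matrixEntry i X Y k a A) (S.matrixEntry j Y X a k A')) :=
        fun a => by
          refine (congrArg _ (S.matrixEntry_comp hji a a A' A)).trans ((map_sum _ _ _).trans ?_)
          refine Finset.sum_congr rfl fun k _ => ?_
          rw [T.trₗ_comp hij hji, cotwist_eq_sum _ hs]; rfl
      have h₂ : ∀ (x : H × M) k, T.trₗ Y x.2 (S.matrixEntry N Y Y k k
          ((S.matrix r).comp hij (antipodeInv H x.1 • A) A')) = ∑ a, T.trₗ Y x.2 (S.comp hij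
            (antipodeInv H x.1 • S.matrixEntry i X Y k a A) (S.matrixEntry j Y X a k A')) :=
        fun x k => (congrArg _ (S.matrixEntry_comp hij k k _ A')).trans (map_sum _ _ _)
      refine (T.matrixTr_apply m _).trans ((Finset.sum_congr rfl fun a _ => h₁ a).trans ?_)
      refine Eq.trans ?_ (congrArg _ (Finset.sum_congr rfl fun x _ =>
        ((T.matrixTr_apply x.2 _).trans (Finset.sum_congr rfl fun k _ => h₂ x k)).symm))
      simp only [← Finset.mul_sum]
      rw [Finset.sum_comm]
      refine congrArg _ ((Finset.sum_congr rfl fun k _ => Finset.sum_comm).trans ?_)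
      exact Finset.sum_comm)

theorem ClosedGradedTrace.matrix_trₗ (T : ClosedGradedTrace S M N) {X : S.Ob} (m : M)
    (A : (S.matrix r).Hom N X X) :
    (T.matrix r).trₗ X m A = ∑ a, T.trₗ X m (S.matrixEntry N X X a a A) :=
  T.matrixTr_apply m A

end Trace

variable {C : HSemicat.{u} H} {obj : C.Ob → S.Ob}

/-- An entry of a matrix-valued semifunctor. -/
def matrixRho (γ : HSemifunctor C (S.matrix r).degZero obj) (a b : Fin r) (X Z : C.Ob) :
    C.Hom Z X →ₗ[ℂ] S.Hom 0 (obj Z) (obj X) :=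
  S.matrixEntry 0 (obj Z) (obj X) a b ∘ₗ rhoMap γ X Z

/-- The semifunctor with the given matrix entries. -/
def matrixSemifunctor (A : ∀ (_ _ : Fin r) (X Z : C.Ob), C.Hom Z X →ₗ[ℂ] S.Hom 0 (obj Z) (obj X))
    (smul : ∀ a b X Z (h : H) (f : C.Hom Z X), A a b X Z (h • f) = h • A a b X Z f)
    (comp : ∀ a b (X Y Z : C.Ob) (g : C.Hom Y X) (f : C.Hom Z Y), A a b X Z (C.comp g f) =
      ∑ k, S.comp (zero_add 0) (A a k X Y g) (A k b Y Z f)) :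
    HSemifunctor C (S.matrix r).degZero obj where
  map {X Y} := (S.matrixOfₗ fun a b => A a b Y X :
    C.Hom X Y →ₗ[ℂ] (S.matrix r).Hom 0 (obj X) (obj Y))
  map_smul {X Y} h f := DGHSemicat.matrix_ext (S := S) (X := obj X) (Y := obj Y) fun a b =>
    smul a b Y X h f
  map_comp {X Y Z} g f := DGHSemicat.matrix_ext (S := S) (X := obj X) (Y := obj Z) fun a b =>
    comp a b Z Y X g f

/-- Matrices supported in column `p` are closed under multiplication, and their `(p, p)` entries
multiply like scalars. The matrix trace therefore sees only `α`, although the other entries of that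
column need not vanish. -/
theorem diffProd_column {γ : HSemifunctor C (S.matrix r).degZero obj}
    {α : HSemifunctor C S.degZero obj} {p : Fin r}
    (h₀ : ∀ (X Z : C.Ob) (a b : Fin r), b ≠ p → matrixRho γ a b X Z = 0)
    (h₁ : ∀ (X Z : C.Ob), matrixRho γ p p X Z = rhoMap α X Z) :
    ∀ {n : ℕ} {X Z : C.Ob} (x : chains C n X Z),
      (∀ a b : Fin r, b ≠ p →
        S.matrixEntry (n + 1) (obj Z) (obj X) a b (diffProd γ n X Z x) = 0) ∧
      S.matrixEntry (n + 1) (obj Z) (obj X) p p (diffProd γ n X Z x) = diffProd α n X Z x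
  | 0, X, Z, x => by
    induction x using chains_zero_induction with
    | single f =>
      refine ⟨fun a b hb => ?_, ?_⟩
      · exact (congrArg (S.d (zero_add 1)) (LinearMap.congr_fun (h₀ X Z a b hb) f)).trans
          (map_zero _)
      · exact congrArg (S.d (zero_add 1)) (LinearMap.congr_fun (h₁ X Z) f)
  | n + 1, X, Z, x => by
    induction x using chains_succ_induction with
    | zero => simp
    | add x y hx hy =>
      refine ⟨fun a b hb => ?_, ?_⟩
      · rw [map_add, map_add, hx.1 a b hb, hy.1 a b hb, add_zero]
      · rw [map_add, map_add, map_add, hx.2, hy.2]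
    | pre Y f x =>
      have ih := diffProd_column h₀ h₁ x
      have key : ∀ a b, S.matrixEntry (n + 2) (obj Z) (obj X) a b
          (diffProd γ (n + 1) X Z (pre C n X Y Z f x)) =
          ∑ k, S.comp (Nat.add_comm 1 (n + 1)) (S.d (zero_add 1) (matrixRho γ a k X Y f))
            (S.matrixEntry (n + 1) (obj Z) (obj Y) k b (diffProd γ n Y Z x)) := fun a b => by
        rw [diffProd_pre, DGHSemicat.matrixEntry_comp]; rfl
      refine ⟨fun a b hb => ?_, ?_⟩
      · rw [key]
        exact Finset.sum_eq_zero fun k _ => by rw [ih.1 k b hb, map_zero]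
      · rw [key, Finset.sum_eq_single p, ih.2, h₁, diffProd_pre]
        · rfl
        · intro k _ hk
          rw [h₀ X Y p k hk, LinearMap.zero_apply, map_zero, map_zero, LinearMap.zero_apply]
        · simp

theorem charProd_column {γ : HSemifunctor C (S.matrix r).degZero obj}
    {α : HSemifunctor C S.degZero obj} {p : Fin r}
    (h₀ : ∀ (X Z : C.Ob) (a b : Fin r), b ≠ p → matrixRho γ a b X Z = 0)
    (h₁ : ∀ (X Z : C.Ob), matrixRho γ p p X Z = rhoMap α X Z) :
    ∀ {n : ℕ} {X Z : C.Ob} (x : chains C n X Z),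
      (∀ a b : Fin r, b ≠ p → S.matrixEntry n (obj Z) (obj X) a b (charProd γ n X Z x) = 0) ∧
      S.matrixEntry n (obj Z) (obj X) p p (charProd γ n X Z x) = charProd α n X Z x
  | 0, X, Z, x => ⟨fun a b hb => LinearMap.congr_fun (h₀ X Z a b hb) x,
      LinearMap.congr_fun (h₁ X Z) x⟩
  | n + 1, X, Z, x => by
    induction x using chains_succ_induction with
    | zero => simp
    | add x y hx hy =>
      refine ⟨fun a b hb => ?_, ?_⟩
      · rw [map_add, map_add, hx.1 a b hb, hy.1 a b hb, add_zero]
      · rw [map_add, map_add, map_add, hx.2, hy.2]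
    | pre Y f x =>
      have ih := diffProd_column h₀ h₁ x
      have key : ∀ a b, S.matrixEntry (n + 1) (obj Z) (obj X) a b
          (charProd γ (n + 1) X Z (pre C n X Y Z f x)) =
          ∑ k, S.comp (zero_add (n + 1)) (matrixRho γ a k X Y f)
            (S.matrixEntry (n + 1) (obj Z) (obj Y) k b (diffProd γ n Y Z x)) := fun a b => by
        rw [charProd_pre, DGHSemicat.matrixEntry_comp]; rfl
      refine ⟨fun a b hb => ?_, ?_⟩
      · rw [key]
        exact Finset.sum_eq_zero fun k _ => by rw [ih.1 k b hb, map_zero]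
      · rw [key, Finset.sum_eq_single p, ih.2, h₁, charProd_pre]
        · intro k _ hk
          rw [h₀ X Y p k hk, LinearMap.zero_apply, map_zero, LinearMap.zero_apply]
        · simp

theorem diffProd_diagonal {γ : HSemifunctor C (S.matrix r).degZero obj}
    {α : Fin r → HSemifunctor C S.degZero obj}
    (h₀ : ∀ (X Z : C.Ob) (a b : Fin r), a ≠ b → matrixRho γ a b X Z = 0)
    (h₁ : ∀ (X Z : C.Ob) (a : Fin r), matrixRho γ a a X Z = rhoMap (α a) X Z) :
    ∀ {n : ℕ} {X Z : C.Ob} (x : chains C n X Z) (a : Fin r),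
      S.matrixEntry (n + 1) (obj Z) (obj X) a a (diffProd γ n X Z x) = diffProd (α a) n X Z x
  | 0, X, Z, x => fun a => congrArg (S.d (zero_add 1)) (LinearMap.congr_fun (h₁ X Z a) x)
  | n + 1, X, Z, x => fun a => by
    induction x using chains_succ_induction with
    | zero => simp
    | add x y hx hy => rw [map_add, map_add, map_add, hx, hy]
    | pre Y f x =>
      have ih := diffProd_diagonal h₀ h₁ x
      rw [diffProd_pre, DGHSemicat.matrixEntry_comp, Finset.sum_eq_single a, ih, diffProd_pre]
      · exact congrArg (fun z => S.comp (Nat.add_comm 1 (n + 1)) (S.d (zero_add 1) z) _)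
          (LinearMap.congr_fun (h₁ X Y a) f)
      · intro k _ hk
        have : S.matrixEntry 1 (obj Y) (obj X) a k (dRho γ X Y f) = 0 :=
          (congrArg (S.d (zero_add 1)) (LinearMap.congr_fun (h₀ X Y a k hk.symm) f)).trans
            (map_zero _)
        rw [this, map_zero, LinearMap.zero_apply]
      · simp

theorem charProd_diagonal {γ : HSemifunctor C (S.matrix r).degZero obj}
    {α : Fin r → HSemifunctor C S.degZero obj}
    (h₀ : ∀ (X Z : C.Ob) (a b : Fin r), a ≠ b → matrixRho γ a b X Z = 0)
    (h₁ : ∀ (X Z : C.Ob) (a : Fin r), matrixRho γ a a X Z = rhoMap (α a) X Z) :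
    ∀ {n : ℕ} {X Z : C.Ob} (x : chains C n X Z) (a : Fin r),
      S.matrixEntry n (obj Z) (obj X) a a (charProd γ n X Z x) = charProd (α a) n X Z x
  | 0, X, Z, x => fun a => LinearMap.congr_fun (h₁ X Z a) x
  | n + 1, X, Z, x => fun a => by
    induction x using chains_succ_induction with
    | zero => simp
    | add x y hx hy => rw [map_add, map_add, map_add, hx, hy]
    | pre Y f x =>
      rw [charProd_pre, DGHSemicat.matrixEntry_comp, Finset.sum_eq_single a,
        diffProd_diagonal h₀ h₁, charProd_pre, ← h₁]
      · rfl
      · intro k _ hk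
        have : S.matrixEntry 0 (obj Y) (obj X) a k (rhoMap γ X Y f) = 0 :=
          LinearMap.congr_fun (h₀ X Y a k hk.symm) f
        rw [this, map_zero, LinearMap.zero_apply]
      · simp

variable [BijectiveAntipode H] {M : Type w} [AddCommGroup M] [Module ℂ M] [Module Hᵐᵒᵖ M]
  [IsScalarTower ℂ Hᵐᵒᵖ M] [SAYDModule H M] {N : ℕ}

theorem traceCochain_column (T : ClosedGradedTrace S M N)
    {γ : HSemifunctor C (S.matrix r).degZero obj}
    {α : HSemifunctor C S.degZero obj} {p : Fin r}
    (h₀ : ∀ (X Z : C.Ob) (a b : Fin r), b ≠ p → matrixRho γ a b X Z = 0)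
    (h₁ : ∀ (X Z : C.Ob), matrixRho γ p p X Z = rhoMap α X Z) :
    traceCochain (T.matrix r) (fun X => charProd γ N X X) =
      traceCochain T fun X => charProd α N X X := by
  refine cochain_ext fun m X x => ?_
  have h := charProd_column h₀ h₁ x
  rw [traceCochain_loop, traceCochain_loop, T.matrix_trₗ, Finset.sum_eq_single p, h.2]
  · intro a _ ha
    rw [h.1 a a ha, map_zero]
  · simp

theorem traceCochain_diagonal (T : ClosedGradedTrace S M N)
    {γ : HSemifunctor C (S.matrix r).degZero obj} {α : Fin r → HSemifunctor C S.degZero obj}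
    (h₀ : ∀ (X Z : C.Ob) (a b : Fin r), a ≠ b → matrixRho γ a b X Z = 0)
    (h₁ : ∀ (X Z : C.Ob) (a : Fin r), matrixRho γ a a X Z = rhoMap (α a) X Z) :
    traceCochain (T.matrix r) (fun X => charProd γ N X X) =
      ∑ a, traceCochain T fun X => charProd (α a) N X X := by
  refine cochain_ext fun m X x => ?_
  rw [traceCochain_loop, T.matrix_trₗ, LinearMap.sum_apply]
  refine Finset.sum_congr rfl fun a _ => ?_
  rw [traceCochain_loop, charProd_diagonal h₀ h₁]

end MatrixSemicat

end

end HopfCyclic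

namespace HopfCyclic

noncomputable section

open Coalgebra (Repr)

/-! ### Characters of conjugate semifunctors -/

section Conjugation

variable {H : Type v} [Ring H] [HopfAlgebra ℂ H] {C : HSemicat.{u} H} {S : DGHSemicat.{u} H}
  {obj : C.Ob → S.Ob} (α : HSemifunctor C S.degZero obj)
  (w v : ∀ X : C.Ob, Fin 2 → S.Hom 0 (obj X) (obj X))

/-- The map `f ↦ w_a α(f) v_b`. -/
def sandwich (a b : Fin 2) (X Z : C.Ob) : C.Hom Z X →ₗ[ℂ] S.Hom 0 (obj Z) (obj X) :=
  S.comp (zero_add 0) (w X a) ∘ₗ (S.comp (zero_add 0)).flip (v Z b) ∘ₗ rhoMap α X Z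

theorem sandwich_apply (a b : Fin 2) {X Z : C.Ob} (f : C.Hom Z X) :
    sandwich α w v a b X Z f =
      S.comp (zero_add 0) (w X a) (S.comp (zero_add 0) (rhoMap α X Z f) (v Z b)) := rfl

variable {w v} (hw : ∀ (h : H) X a, h • w X a = (Coalgebra.counit h : ℂ) • w X a)
  (hv : ∀ (h : H) X a, h • v X a = (Coalgebra.counit h : ℂ) • v X a)
  (hl : ∀ {X Z : C.Ob} (f : C.Hom Z X) a, S.comp (zero_add 0) (v X a)
    (S.comp (zero_add 0) (w X a) (rhoMap α X Z f)) = rhoMap α X Z f)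
  (hr : ∀ {X Z : C.Ob} (f : C.Hom Z X) a, S.comp (zero_add 0)
    (S.comp (zero_add 0) (rhoMap α X Z f) (v Z a)) (w Z a) = rhoMap α X Z f)

include hw hv in
theorem sandwich_smul (a b : Fin 2) {X Z : C.Ob} (h : H) (f : C.Hom Z X) :
    sandwich α w v a b X Z (h • f) = h • sandwich α w v a b X Z f := by
  rw [sandwich_apply, sandwich_apply, S.smul_comp_of_invariant_left _ (fun h => hw h X a),
    S.smul_comp_of_invariant_right _ (fun h => hv h Z b), rhoMap_smul]

include hl in
theorem comp_sandwich (b k : Fin 2) {X Z : C.Ob} {W : S.Ob} (g : S.Hom 0 (obj X) W)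
    (f : C.Hom Z X) :
    S.comp (zero_add 0) (S.comp (zero_add 0) g (v X k)) (sandwich α w v k b X Z f) =
      S.comp (zero_add 0) g (S.comp (zero_add 0) (rhoMap α X Z f) (v Z b)) := by
  rw [sandwich_apply, S.assoc (zero_add 0) (zero_add 0) _ (zero_add 0)]
  congr 1
  rw [← S.assoc (zero_add 0) (zero_add 0) (zero_add 0) (zero_add 0) (w X k),
    ← S.assoc (zero_add 0) (zero_add 0) (zero_add 0) (zero_add 0), hl]

-- The middle factor `v_k w_k` acts as an identity, so the product does not depend on `k`. For this
-- reason weights `c_k` of sum one give a multiplicative matrix in `sandwichMatrix`.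
include hl in
theorem sandwich_comp (a b k : Fin 2) {X Y Z : C.Ob} (g : C.Hom Y X) (f : C.Hom Z Y) :
    S.comp (zero_add 0) (sandwich α w v a k X Y g) (sandwich α w v k b Y Z f) =
      sandwich α w v a b X Z (C.comp g f) := by
  rw [sandwich_apply α w v a k, ← S.assoc (zero_add 0) (zero_add 0) (zero_add 0) (zero_add 0),
    comp_sandwich α hl, sandwich_apply, rhoMap_comp,
    S.assoc (zero_add 0) (zero_add 0) (zero_add 0) (zero_add 0),
    S.assoc (zero_add 0) (zero_add 0) (zero_add 0) (zero_add 0)]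

/-- The semifunctor `f ↦ (c_b w_a α(f) v_b)_{a,b}` for `c₀ + c₁ = 1`. -/
def sandwichMatrix (c : Fin 2 → ℂ) (hc : c 0 + c 1 = 1) :
    HSemifunctor C (S.matrix 2).degZero obj :=
  matrixSemifunctor (fun a b X Z => c b • sandwich α w v a b X Z)
    (fun a b X Z h f => by
      rw [LinearMap.smul_apply, LinearMap.smul_apply, sandwich_smul α hw hv, smul_comm])
    (fun a b X Y Z g f => by
      simp only [map_smul, LinearMap.smul_apply, sandwich_comp α hl]
      rw [Fin.sum_univ_two, ← smul_add, ← add_smul, hc, one_smul])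

theorem matrixRho_sandwichMatrix (c : Fin 2 → ℂ) (hc : c 0 + c 1 = 1) (a b : Fin 2) (X Z : C.Ob) :
    matrixRho (sandwichMatrix α hw hv hl c hc) a b X Z = c b • sandwich α w v a b X Z := rfl

variable [BijectiveAntipode H] {M : Type w} [AddCommGroup M] [Module ℂ M] [Module Hᵐᵒᵖ M]
  [IsScalarTower ℂ Hᵐᵒᵖ M] [SAYDModule H M] {n : ℕ} (T : ClosedGradedTrace S M n)

-- The homotopy formula applied to the affine path of `sandwichMatrix`, which joins a semifunctor
-- supported in column `0` to one supported in column `1`. The path is polynomial, so no rotation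
-- matrices are needed. The elements `v_a w_a` are identities only next to morphisms `α(f)`: in
-- positive degrees nothing is assumed.
include hw hv hl hr in
theorem character_sub_mem_of_sandwich (β : Fin 2 → HSemifunctor C S.degZero obj)
    (hβ : ∀ a X Z, rhoMap (β a) X Z = sandwich α w v a a X Z) :
    traceCochain T (fun X => charProd (β 1) n X X) -
      traceCochain T (fun X => charProd (β 0) n X X) ∈ coboundaries C M n := by
  cases n with
  | zero =>
    -- In degree zero a coboundary is zero, so the two characters must be equal. The trace property
    -- moves `w_a` to the right end, where `v_a w_a` is absorbed by `α(f)`.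
    have key : ∀ a, traceCochain T (fun X => charProd (β a) 0 X X) =
        traceCochain T fun X => charProd α 0 X X := fun a => by
      refine cochain_ext fun m X x => ?_
      rw [traceCochain_loop, traceCochain_loop]
      induction x using chains_zero_induction with
      | single f =>
        rw [charProd_single, charProd_single, hβ, sandwich_apply,
          ← T.trₗ_comp_invariant m (fun h => hw h X a), hr]
    rw [key, key, sub_self]
    exact Submodule.zero_mem _
  | succ n =>
    let c : ℝ → Fin 2 → ℂ := fun t => ![1 - t, t]
    have hc : ∀ t, c t 0 + c t 1 = 1 := fun t => by simp [c]
    -- The weights `c t` have constant derivative `-s`.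
    let s : Fin 2 → ℂ := ![1, -1]
    have hs : s 0 + s 1 = 0 := by simp [s]
    let γ : ℝ → HSemifunctor C (S.matrix 2).degZero obj := fun t =>
      sandwichMatrix α hw hv hl (c t) (hc t)
    let δ : ∀ X Z : C.Ob, C.Hom Z X →ₗ[ℂ] (S.matrix 2).Hom 0 (obj Z) (obj X) := fun X Z =>
      S.matrixOfₗ fun a b => (-s b) • sandwich α w v a b X Z
    -- Left multiplication of `γ_t` by `ξ` sums the weights `s` and gives zero. Right multiplication
    -- sums the weights `c` and gives `s_b w_a α v_b`, which is `-δ`.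
    let ξ : ∀ X : C.Ob, (S.matrix 2).Hom 0 (obj X) (obj X) := fun X =>
      S.matrixOf fun a b => s b • S.comp (zero_add 0) (w X a) (v X b)
    have hγ : ∀ (t : ℝ) (X Z : C.Ob) (f : C.Hom Z X),
        rhoMap (γ t) X Z f = rhoMap (γ 0) X Z f + (t : ℂ) • δ X Z f := fun t X Z f =>
      DGHSemicat.matrix_ext (S := S) fun a b => by
        change c t b • sandwich α w v a b X Z f =
          c 0 b • sandwich α w v a b X Z f + (t : ℂ) • (-s b) • sandwich α w v a b X Z f
        rw [smul_smul, ← add_smul]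
        congr 1
        fin_cases b <;> simp [c, s, sub_eq_add_neg]
    have h := character_sub_mem (M := M) (n := n) hγ (T.matrix 2) (ξ := ξ)
      (fun h X => DGHSemicat.matrix_ext (S := S) fun a b => by
        change h • s b • S.comp (zero_add 0) (w X a) (v X b) =
          (Coalgebra.counit h : ℂ) • s b • S.comp (zero_add 0) (w X a) (v X b)
        rw [smul_comm, S.smul_comp_of_invariant_left _ (fun h => hw h X a), hv, map_smul,
          smul_comm])
      (fun t X Y f => DGHSemicat.matrix_ext (S := S) fun a b => by
        change ∑ k, S.comp (zero_add 0) (s k • S.comp (zero_add 0) (w Y a) (v Y k))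
          (c t b • sandwich α w v k b Y X f) = 0
        simp only [map_smul, LinearMap.smul_apply, comp_sandwich α hl]
        rw [Fin.sum_univ_two, ← smul_add, ← add_smul, hs, zero_smul, smul_zero])
      (fun t X Y f => DGHSemicat.matrix_ext (S := S) fun a b => by
        change ∑ k, S.comp (zero_add 0) (c t k • sandwich α w v a k Y X f)
          (s b • S.comp (zero_add 0) (w X k) (v X b)) = - ((-s b) • sandwich α w v a b Y X f)
        have : ∀ k, S.comp (zero_add 0) (sandwich α w v a k Y X f)
            (S.comp (zero_add 0) (w X k) (v X b)) = sandwich α w v a b Y X f := fun k => by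
          rw [sandwich_apply, sandwich_apply, S.assoc (zero_add 0) (zero_add 0) _ (zero_add 0)]
          congr 1
          rw [← S.assoc (zero_add 0) (zero_add 0) (zero_add 0) (zero_add 0), hr]
        simp only [map_smul, LinearMap.smul_apply, this]
        rw [Fin.sum_univ_two, ← smul_add, ← add_smul, hc, one_smul, neg_smul, neg_neg])
    rw [traceCochain_column T (p := 1) (α := β 1) (γ := γ 1),
      traceCochain_column T (p := 0) (α := β 0) (γ := γ 0)] at h
    · exact h
    · intro X Z a b hb
      rw [matrixRho_sandwichMatrix]
      fin_cases b <;> simp_all [c]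
    · intro X Z
      rw [matrixRho_sandwichMatrix, hβ]
      simp [c]
    · intro X Z a b hb
      rw [matrixRho_sandwichMatrix]
      fin_cases b <;> simp_all [c]
    · intro X Z
      rw [matrixRho_sandwichMatrix, hβ]
      simp [c]

end Conjugation

end

end HopfCyclic

namespace HopfCyclic

noncomputable section

open Coalgebra (Repr)

/-! ### Characters of vanishing cycles are coboundaries -/

section Vanishing

variable {H : Type v} [Ring H] [HopfAlgebra ℂ H]

theorem HSemicat.smul_comp_of_invariant_left (C : HSemicat.{u} H) {X Y Z : C.Ob} {g : C.Hom Y Z}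
    (hg : ∀ h : H, h • g = (Coalgebra.counit h : ℂ) • g) (h : H) (f : C.Hom X Y) :
    h • C.comp g f = C.comp g (h • f) := by
  rw [C.smul_comp_sum (Repr.arbitrary ℂ h)]
  simp only [hg, map_smul, LinearMap.smul_apply]
  exact sum_counit_left (C.comp g ∘ₗ (lact H (C.Hom X Y)).flip f) _

/-- Since `η` is invariant, `η (h η⁻¹) = h (η η⁻¹) = ε(h) id`; multiply by `η⁻¹` on the left. -/
theorem HCat.InvariantAut.smul_inv {E : HCat.{u} H} (η : E.InvariantAut) (h : H) (X : E.Ob) :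
    h • η.inv X = (Coalgebra.counit h : ℂ) • η.inv X := by
  rw [← E.ids.id_comp (h • η.inv X), ← η.inv_hom, E.assoc,
    ← E.smul_comp_of_invariant_left (fun h => η.smul_hom h X), η.hom_inv, E.ids.smul_id, map_smul,
    E.ids.comp_id]

variable {S : DGHSemicat.{u} H}

/-- The matrix in degree zero corresponding to a tensor. -/
def DGHSemicat.tensorToMatrix (S : DGHSemicat.{u} H) (r : ℕ) (X Y : S.Ob) :
    S.Hom 0 X Y ⊗[ℂ] Matrix (Fin r) (Fin r) ℂ →ₗ[ℂ] (S.matrix r).Hom 0 X Y :=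
  S.matrixOfₗ fun a b => (TensorProduct.rid ℂ (S.Hom 0 X Y)).toLinearMap ∘ₗ
    (Matrix.entryLinearMap ℂ ℂ a b).lTensor (S.Hom 0 X Y)

theorem DGHSemicat.matrixEntry_tensorToMatrix {r : ℕ} {X Y : S.Ob} (a b : Fin r) (f : S.Hom 0 X Y)
    (B : Matrix (Fin r) (Fin r) ℂ) :
    S.matrixEntry 0 X Y a b (S.tensorToMatrix r X Y (f ⊗ₜ B)) = B a b • f := by
  rw [DGHSemicat.tensorToMatrix, DGHSemicat.matrixEntry_matrixOfₗ]
  simp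

theorem DGHSemicat.tensorToMatrix_comp {r : ℕ} {X Y Z : S.Ob}
    (z : S.Hom 0 Y Z ⊗[ℂ] Matrix (Fin r) (Fin r) ℂ)
    (z' : S.Hom 0 X Y ⊗[ℂ] Matrix (Fin r) (Fin r) ℂ) :
    S.tensorToMatrix r X Z (TensorProduct.map₂ (S.comp (zero_add 0)) (LinearMap.mul ℂ _) z z') =
      (S.matrix r).comp (zero_add 0) (S.tensorToMatrix r Y Z z) (S.tensorToMatrix r X Y z') := by
  induction z using TensorProduct.induction_on with
  | zero => simp only [map_zero, LinearMap.zero_apply]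
  | add a b ha hb => simp only [map_add, LinearMap.add_apply, ha, hb]
  | tmul g B =>
    induction z' using TensorProduct.induction_on with
    | zero => simp only [map_zero]
    | add a b ha hb => simp only [map_add, ha, hb]
    | tmul f B' =>
      refine DGHSemicat.matrix_ext fun a b => ?_
      rw [DGHSemicat.matrixEntry_comp, TensorProduct.map₂_apply_tmul,
        TensorProduct.map_tmul, DGHSemicat.matrixEntry_tensorToMatrix, LinearMap.mul_apply', Matrix.mul_apply,
        Finset.sum_smul]
      refine Finset.sum_congr rfl fun k _ => ?_
      rw [DGHSemicat.matrixEntry_tensorToMatrix, DGHSemicat.matrixEntry_tensorToMatrix, map_smul,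
        map_smul, LinearMap.smul_apply, smul_smul, mul_comm]

theorem DGHSemicat.tensorToMatrix_smul {r : ℕ} {X Y : S.Ob} (h : H)
    (z : S.Hom 0 X Y ⊗[ℂ] Matrix (Fin r) (Fin r) ℂ) :
    S.tensorToMatrix r X Y (h • z) = h • S.tensorToMatrix r X Y z := by
  induction z using TensorProduct.induction_on with
  | zero => simp only [map_zero, smul_zero]
  | add a b ha hb => simp only [map_add, smul_add, ha, hb]
  | tmul g B =>
    refine DGHSemicat.matrix_ext fun a b => ?_
    rw [TensorProduct.smul_tmul', DGHSemicat.matrixEntry_smul,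
      DGHSemicat.matrixEntry_tensorToMatrix, DGHSemicat.matrixEntry_tensorToMatrix, smul_comm]

variable {C : HSemicat.{u} H} {obj : C.Ob → S.Ob}

/-- The semifunctor with the given diagonal entries. -/
def diagonalSemifunctor {r : ℕ} (β : Fin r → HSemifunctor C S.degZero obj) :
    HSemifunctor C (S.matrix r).degZero obj :=
  matrixSemifunctor (fun a b X Z => if a = b then rhoMap (β a) X Z else 0)
    (fun a b X Z h f => by
      split_ifs
      · exact rhoMap_smul _ h f
      · simp)
    (fun a b X Y Z g f => by
      rw [Finset.sum_eq_single a]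
      · rw [if_pos rfl]
        split_ifs with h
        · subst h; exact rhoMap_comp (β a) g f
        · simp
      · intro k _ hk
        rw [if_neg (Ne.symm hk), LinearMap.zero_apply, map_zero, LinearMap.zero_apply]
      · simp)

theorem matrixRho_diagonalSemifunctor {r : ℕ} (β : Fin r → HSemifunctor C S.degZero obj)
    (a b : Fin r) (X Z : C.Ob) : matrixRho (diagonalSemifunctor β) a b X Z =
      if a = b then rhoMap (β a) X Z else 0 := rfl

/-- The zero semifunctor. -/
def zeroSemifunctor (C E : HSemicat.{u} H) (obj : C.Ob → E.Ob) : HSemifunctor C E obj where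
  map := 0
  map_smul _ _ := by simp
  map_comp _ _ := by simp

/-- The composite with a semifunctor fixing the objects. -/
def HSemifunctor.compFix {E : HSemicat.{u} H} {obj : C.Ob → E.Ob}
    (υ : HSemifunctor E E fun X => X) (ρ : HSemifunctor C E obj) : HSemifunctor C E obj where
  map := υ.map ∘ₗ ρ.map
  map_smul h f := by
    rw [LinearMap.comp_apply, ρ.map_smul, υ.map_smul]; rfl
  map_comp g f := by
    rw [LinearMap.comp_apply, ρ.map_comp, υ.map_comp]; rfl

variable [BijectiveAntipode H] {M : Type w} [AddCommGroup M] [Module ℂ M] [Module Hᵐᵒᵖ M]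
  [IsScalarTower ℂ Hᵐᵒᵖ M] [SAYDModule H M] {n : ℕ}

/-- Conjugation by `η` takes `ρ ⊕ υρ` to `0 ⊕ υρ`, and the character of a direct sum is the sum of
the characters. The two contributions of `υρ` cancel, leaving that of `ρ`. -/
theorem Cycle.IsVanishing.character_mem {D : HCat.{u} H} {Γ : Cycle D M n} (hΓ : Γ.IsVanishing) :
    Γ.character ∈ coboundaries D.toHSemicat M n := by
  obtain ⟨I, υ, η, hη⟩ := hΓ
  let S := Γ.S
  let E : HCat.{u} H := HCat.mk Γ.S.degZero I
  let E₂ := E.tensorMatrix 2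
  let υρ : HSemifunctor D.toHSemicat S.degZero Γ.ρobj :=
    HSemifunctor.compFix (E := S.degZero) υ Γ.ρ
  let α := diagonalSemifunctor ![Γ.ρ, υρ]
  let β := diagonalSemifunctor ![zeroSemifunctor D.toHSemicat S.degZero Γ.ρobj, υρ]
  let Mat : ∀ X Y : S.Ob, S.Hom 0 X Y ⊗[ℂ] Matrix (Fin 2) (Fin 2) ℂ →ₗ[ℂ]
    (S.matrix 2).Hom 0 X Y := fun X Y => S.tensorToMatrix 2 X Y
  have hMat : ∀ {X Y Z : S.Ob} (z : E₂.Hom Y Z) (z' : E₂.Hom X Y),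
      (S.matrix 2).comp (zero_add 0) (Mat Y Z z) (Mat X Y z') = Mat X Z (E₂.comp z z') :=
    fun z z' => (S.tensorToMatrix_comp z z').symm
  let one : ∀ X : S.Ob, E₂.Hom X X := fun X => E₂.ids.id X
  let a₁ : ∀ {X Y : S.Ob}, S.Hom 0 X Y → S.Hom 0 X Y ⊗[ℂ] Matrix (Fin 2) (Fin 2) ℂ := fun f =>
    f ⊗ₜ Matrix.single 0 0 1
  let a₂ : ∀ {X Y : S.Ob}, S.Hom 0 X Y → S.Hom 0 X Y ⊗[ℂ] Matrix (Fin 2) (Fin 2) ℂ := fun f =>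
    f ⊗ₜ Matrix.single 1 1 1
  have hα : ∀ {X Z : D.Ob} (f : D.Hom Z X), rhoMap α X Z f =
      Mat _ _ (a₁ (rhoMap Γ.ρ X Z f) + a₂ (rhoMap υρ X Z f)) := fun {X Z} f => by
    refine DGHSemicat.matrix_ext fun a b => ?_
    rw [map_add, map_add, DGHSemicat.matrixEntry_tensorToMatrix,
      DGHSemicat.matrixEntry_tensorToMatrix]
    refine (LinearMap.congr_fun (matrixRho_diagonalSemifunctor ![Γ.ρ, υρ] a b X Z) f).trans ?_
    fin_cases a <;> fin_cases b <;> simp [Matrix.single]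
  have hβ : ∀ {X Z : D.Ob} (f : D.Hom Z X), rhoMap β X Z f =
      Mat _ _ (a₂ (rhoMap υρ X Z f)) := fun {X Z} f => by
    refine DGHSemicat.matrix_ext fun a b => ?_
    rw [DGHSemicat.matrixEntry_tensorToMatrix]
    refine (LinearMap.congr_fun (matrixRho_diagonalSemifunctor ![_, υρ] a b X Z) f).trans ?_
    fin_cases a <;> fin_cases b <;> simp [Matrix.single, rhoMap, zeroSemifunctor]
    rfl
  -- Index `0` is conjugation by the identity, with result `α`, and index `1` is conjugation by `η`,
  -- with result `β`. The entries are themselves 2 × 2 matrices over `S`, so the homotopy takes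
  -- place in matrices of matrices.
  let w : ∀ X : D.Ob, Fin 2 → (S.matrix 2).Hom 0 (Γ.ρobj X) (Γ.ρobj X) := fun X =>
    ![Mat _ _ (one _), Mat _ _ (η.hom (Γ.ρobj X))]
  let v : ∀ X : D.Ob, Fin 2 → (S.matrix 2).Hom 0 (Γ.ρobj X) (Γ.ρobj X) := fun X =>
    ![Mat _ _ (one _), Mat _ _ (η.inv (Γ.ρobj X))]
  have hid : ∀ {X Y : S.Ob} (z : E₂.Hom X Y), E₂.comp (one Y) z = z := fun z => E₂.ids.id_comp z
  have hid' : ∀ {X Y : S.Ob} (z : E₂.Hom X Y), E₂.comp z (one X) = z := fun z => E₂.ids.comp_id z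
  have hinv : ∀ {X Y : S.Ob} (z : E₂.Hom X Y), E₂.comp (η.inv Y) (E₂.comp (η.hom Y) z) = z :=
    fun {X Y} z => (E₂.assoc (η.inv Y) (η.hom Y) z).symm.trans
      ((congrArg (fun y => E₂.comp y z) (η.inv_hom Y)).trans (hid z))
  have hinv' : ∀ {X Y : S.Ob} (z : E₂.Hom X Y), E₂.comp (E₂.comp z (η.inv X)) (η.hom X) = z :=
    fun {X Y} z => (E₂.assoc z (η.inv X) (η.hom X)).trans
      ((congrArg (fun y => E₂.comp z y) (η.inv_hom X)).trans (hid' z))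
  have hconj : ∀ {X Y : S.Ob} (f : S.Hom 0 X Y), E₂.comp (η.hom Y)
      (E₂.comp (a₁ f + a₂ (υ.map f)) (η.inv X)) = a₂ (υ.map f) := fun {X Y} f =>
    (E₂.assoc (η.hom Y) _ (η.inv X)).symm.trans (hη X Y f)
  have hsmul : ∀ {X : S.Ob} (h : H) (z : S.Hom 0 X X ⊗[ℂ] Matrix (Fin 2) (Fin 2) ℂ), h • z = (Coalgebra.counit h : ℂ) • z →
      h • Mat X X z = (Coalgebra.counit h : ℂ) • Mat X X z := fun {X} h z hz =>
    (DGHSemicat.tensorToMatrix_smul h z).symm.trans ((congrArg (Mat X X) hz).trans (map_smul _ _ _))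
  let z : ∀ {X Z : D.Ob} (_ : D.Hom Z X), E₂.Hom (Γ.ρobj Z) (Γ.ρobj X) := fun {X Z} f =>
    a₁ (rhoMap Γ.ρ X Z f) + a₂ (rhoMap υρ X Z f)
  have key := character_sub_mem_of_sandwich (M := M) (n := n) (S := S.matrix 2) (w := w) (v := v) α
    (fun h X a => by
      fin_cases a
      · exact hsmul h _ (E₂.ids.smul_id h _)
      · exact hsmul h _ (η.smul_hom h _))
    (fun h X a => by
      fin_cases a
      · exact hsmul h _ (E₂.ids.smul_id h _)
      · exact hsmul h _ (η.smul_inv h _))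
    (fun {X Z} f a => by
      rw [hα]
      change (S.matrix 2).comp _ _ ((S.matrix 2).comp _ _ (Mat _ _ (z f))) = Mat _ _ (z f)
      fin_cases a
      · change (S.matrix 2).comp _ (Mat _ _ _) ((S.matrix 2).comp _ (Mat _ _ _) _) = _
        rw [hMat, hMat, hid, hid]
      · change (S.matrix 2).comp _ (Mat _ _ _) ((S.matrix 2).comp _ (Mat _ _ _) _) = _
        rw [hMat, hMat, hinv])
    (fun {X Z} f a => by
      rw [hα]
      change (S.matrix 2).comp _ ((S.matrix 2).comp _ (Mat _ _ (z f)) _) _ = Mat _ _ (z f)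
      fin_cases a
      · change (S.matrix 2).comp _ ((S.matrix 2).comp _ _ (Mat _ _ _)) (Mat _ _ _) = _
        rw [hMat, hMat, hid', hid']
      · change (S.matrix 2).comp _ ((S.matrix 2).comp _ _ (Mat _ _ _)) (Mat _ _ _) = _
        rw [hMat, hMat, hinv'])
    (Γ.trace.matrix 2) ![α, β]
    (fun a X Z => LinearMap.ext fun f => by
      rw [sandwich_apply, hα]
      fin_cases a
      · change rhoMap α X Z f = (S.matrix 2).comp _ (Mat _ _ _)
          ((S.matrix 2).comp _ (Mat _ _ (z f)) (Mat _ _ _))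
        rw [hMat, hMat, hid, hid', hα]
      · change rhoMap β X Z f = (S.matrix 2).comp _ (Mat _ _ _)
          ((S.matrix 2).comp _ (Mat _ _ (z f)) (Mat _ _ _))
        rw [hMat, hMat, hβ]
        exact congrArg _ (hconj (rhoMap Γ.ρ X Z f)).symm)
  have h₁ : traceCochain (Γ.trace.matrix 2) (fun X => charProd α n X X) =
      traceCochain Γ.trace (fun X => charProd Γ.ρ n X X) +
        traceCochain Γ.trace (fun X => charProd υρ n X X) := by
    rw [traceCochain_diagonal Γ.trace (α := ![Γ.ρ, υρ]), Fin.sum_univ_two]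
    · rfl
    · intro X Z a b hab
      rw [matrixRho_diagonalSemifunctor, if_neg hab]
    · intro X Z a
      rw [matrixRho_diagonalSemifunctor, if_pos rfl]
  have h₂ : traceCochain (Γ.trace.matrix 2) (fun X => charProd β n X X) =
      traceCochain Γ.trace (fun X => charProd υρ n X X) := by
    refine traceCochain_column Γ.trace (p := 1) (fun X Z a b hb => ?_) fun X Z => ?_
    swap
    · rw [matrixRho_diagonalSemifunctor, if_pos rfl]; rfl
    rw [matrixRho_diagonalSemifunctor]
    split_ifs with hab
    · obtain rfl : b = 0 := by
        fin_cases b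
        · rfl
        · exact absurd rfl hb
      subst hab
      rfl
    · rfl
  have h₃ : traceCochain (Γ.trace.matrix 2) (fun X => charProd β n X X) -
    traceCochain (Γ.trace.matrix 2) (fun X => charProd α n X X) ∈ coboundaries D.toHSemicat M n := key
  rw [h₁, h₂, ← Submodule.neg_mem_iff, neg_sub, add_sub_cancel_right] at h₃
  exact h₃

end Vanishing

end

end HopfCyclic

namespace HopfCyclic

noncomputable section

open Coalgebra (Repr)

/-! ### Tensor products of an `H`-category with an algebra -/

section TensorAlgebra

variable {H : Type v} [Ring H] [HopfAlgebra ℂ H] (E : HCat.{u} H) (R : Type) [Ring R] [Algebra ℂ R]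

/-- The `H`-category `E ⊗ R` for a `ℂ`-algebra `R`. -/
abbrev HCat.tensorAlgebra : HCat.{u} H where
  Ob := E.Ob
  Hom X Y := E.Hom X Y ⊗[ℂ] R
  comp := TensorProduct.map₂ E.comp (LinearMap.mul ℂ R)
  assoc k g f := by
    induction k using TensorProduct.induction_on with
    | zero => simp
    | add a b ha hb => simp only [map_add, LinearMap.add_apply, ha, hb]
    | tmul k A =>
      induction g using TensorProduct.induction_on with
      | zero => simp
      | add a b ha hb => simp only [map_add, LinearMap.add_apply, ha, hb]
      | tmul g B =>
        induction f using TensorProduct.induction_on with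
        | zero => simp
        | add a b ha hb => simp only [map_add, ha, hb]
        | tmul f D => simp [E.assoc, mul_assoc]
  smul_comp h g f := by
    rw [sweedler_eq_sum _ (Coalgebra.Repr.arbitrary ℂ h)]
    induction g using TensorProduct.induction_on with
    | zero => simp
    | add a b ha hb =>
      simp only [map_add, LinearMap.add_apply, smul_add, ha, hb, LinearMap.compl₁₂_apply,
        Finset.sum_add_distrib]
    | tmul g A =>
      induction f using TensorProduct.induction_on with
      | zero => simp
      | add a b ha hb =>
        simp only [map_add, LinearMap.add_apply, smul_add, ha, hb, LinearMap.compl₁₂_apply,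
          Finset.sum_add_distrib]
      | tmul f B =>
        simp only [TensorProduct.map₂_apply_tmul, TensorProduct.map_tmul, LinearMap.mul_apply',
          TensorProduct.smul_tmul', E.smul_comp,
          sweedler_eq_sum _ (Coalgebra.Repr.arbitrary ℂ h), LinearMap.compl₁₂_apply,
          LinearMap.flip_apply, lact_apply, TensorProduct.sum_tmul]
  ids :=
    { id := fun X => E.ids.id X ⊗ₜ 1
      id_comp := fun f => by
        induction f using TensorProduct.induction_on with
        | zero => simp
        | add a b ha hb => simp only [map_add, ha, hb]
        | tmul f D => simp [E.ids.id_comp]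
      comp_id := fun f => by
        induction f using TensorProduct.induction_on with
        | zero => simp
        | add a b ha hb => simp only [map_add, LinearMap.add_apply, ha, hb]
        | tmul f D => simp [E.ids.comp_id]
      smul_id := fun h X => congrArg (· ⊗ₜ[ℂ] (1 : R)) (E.ids.smul_id h X) }

variable {E R}

/-- The morphisms of `E ⊗ R ⊗ M₂(ℂ)` given by a morphism of `E` and a matrix over `R`. -/
def matrixTmul {X Y : E.Ob} (f : E.Hom X Y) (A : Matrix (Fin 2) (Fin 2) R) :
    (E.Hom X Y ⊗[ℂ] R) ⊗[ℂ] Matrix (Fin 2) (Fin 2) ℂ :=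
  ∑ i, ∑ j, (f ⊗ₜ A i j) ⊗ₜ Matrix.single i j 1

theorem matrixTmul_comp {X Y Z : E.Ob} (g : E.Hom Y Z) (f : E.Hom X Y)
    (A B : Matrix (Fin 2) (Fin 2) R) :
    ((E.tensorAlgebra R).tensorMatrix 2).comp (matrixTmul g A) (matrixTmul f B) =
      matrixTmul (E.comp g f) (A * B) := by
  change TensorProduct.map₂ (TensorProduct.map₂ E.comp (LinearMap.mul ℂ R))
    (LinearMap.mul ℂ (Matrix (Fin 2) (Fin 2) ℂ)) _ _ = _
  simp only [matrixTmul, Fin.sum_univ_two, map_add, LinearMap.add_apply,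
    TensorProduct.map₂_apply_tmul, TensorProduct.map_tmul, LinearMap.mul_apply', Matrix.mul_apply,
    TensorProduct.tmul_add, TensorProduct.add_tmul]
  simp only [Matrix.single_mul_single_same, mul_one, ne_eq, zero_ne_one, one_ne_zero,
    not_false_eq_true, Matrix.single_mul_single_of_ne, TensorProduct.tmul_zero, add_zero, zero_add]
  abel

theorem matrixTmul_diagonal {X Y : E.Ob} (f : E.Hom X Y) (a b : R) :
    matrixTmul f (Matrix.diagonal ![a, b]) = (f ⊗ₜ[ℂ] a) ⊗ₜ[ℂ] Matrix.single (0 : Fin 2) 0 (1 : ℂ) +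
      (f ⊗ₜ[ℂ] b) ⊗ₜ[ℂ] Matrix.single (1 : Fin 2) 1 (1 : ℂ) := by
  simp [matrixTmul]

theorem matrixTmul_one {X Y : E.Ob} (f : E.Hom X Y) :
    matrixTmul f (1 : Matrix (Fin 2) (Fin 2) R) = (f ⊗ₜ[ℂ] (1 : R)) ⊗ₜ[ℂ] 1 := by
  have h : (1 : Matrix (Fin 2) (Fin 2) R) = Matrix.diagonal ![1, 1] := by
    rw [← Matrix.diagonal_one]; congr 1; ext i; fin_cases i <;> rfl
  have h' : (1 : Matrix (Fin 2) (Fin 2) ℂ) = Matrix.single 0 0 1 + Matrix.single 1 1 1 := by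
    ext i j; fin_cases i <;> fin_cases j <;> simp
  rw [h, matrixTmul_diagonal, h', TensorProduct.tmul_add]

theorem matrixTmul_smul {X Y : E.Ob} (h : H) (f : E.Hom X Y) (A : Matrix (Fin 2) (Fin 2) R) :
    matrixTmul (h • f) A = h • matrixTmul f A := by
  simp only [matrixTmul, Finset.smul_sum, TensorProduct.smul_tmul']

theorem matrixTmul_smul_left {X Y : E.Ob} (t : ℂ) (f : E.Hom X Y)
    (A : Matrix (Fin 2) (Fin 2) R) : matrixTmul (t • f) A = t • matrixTmul f A := by
  simp only [matrixTmul, Finset.smul_sum, TensorProduct.smul_tmul']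

/-- Reduces the vanishing condition for `E ⊗ R` to one about `R` alone: tensoring `A` with the
identities of `E` gives an automorphism on which `H` acts by the counit. The map `υ` need not
preserve the unit. -/
theorem satisfiesVanishing_tensorAlgebra (υ : R →ₗ[ℂ] R) (hυ : ∀ r s, υ (r * s) = υ r * υ s)
    (A B : Matrix (Fin 2) (Fin 2) R) (hAB : A * B = 1) (hBA : B * A = 1)
    (h : ∀ r, A * Matrix.diagonal ![r, υ r] = Matrix.diagonal ![0, υ r] * A) :
    (E.tensorAlgebra R).SatisfiesVanishing := by
  let υE : HSemifunctor (E.tensorAlgebra R).toHSemicat (E.tensorAlgebra R).toHSemicat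
      (fun X => X) :=
    { map := fun {X Y} => υ.lTensor (E.Hom X Y)
      map_smul := fun {X Y} h f => by
        induction f using TensorProduct.induction_on with
        | zero => simp
        | add a b ha hb => simp only [map_add, smul_add, ha, hb]
        | tmul f r => rfl
      map_comp := fun {X Y Z} g f => by
        change υ.lTensor _ (TensorProduct.map₂ E.comp (LinearMap.mul ℂ R) g f) =
          TensorProduct.map₂ E.comp (LinearMap.mul ℂ R) (υ.lTensor _ g) (υ.lTensor _ f)
        induction g using TensorProduct.induction_on with
        | zero => simp
        | add a b ha hb => simp only [map_add, LinearMap.add_apply, ha, hb]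
        | tmul g r =>
          induction f using TensorProduct.induction_on with
          | zero => simp
          | add a b ha hb => simp only [map_add, ha, hb]
          | tmul f s => simp [hυ] }
  let η : ((E.tensorAlgebra R).tensorMatrix 2).InvariantAut :=
    { hom := fun (X : E.Ob) => matrixTmul (E.ids.id X) A
      inv := fun (X : E.Ob) => matrixTmul (E.ids.id X) B
      hom_inv := fun (X : E.Ob) => by
        rw [matrixTmul_comp, hAB, E.ids.id_comp, matrixTmul_one]; rfl
      inv_hom := fun (X : E.Ob) => by
        rw [matrixTmul_comp, hBA, E.ids.id_comp, matrixTmul_one]; rfl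
      smul_hom := fun h (X : E.Ob) => by
        refine (matrixTmul_smul h (E.ids.id X) A).symm.trans ?_
        rw [E.ids.smul_id, matrixTmul_smul_left]
        rfl }
  refine ⟨υE, η, fun (X Y : E.Ob) f => ?_⟩
  let c : ∀ {X Y Z : E.Ob}, (E.Hom Y Z ⊗[ℂ] R) ⊗[ℂ] Matrix (Fin 2) (Fin 2) ℂ →ₗ[ℂ]
      (E.Hom X Y ⊗[ℂ] R) ⊗[ℂ] Matrix (Fin 2) (Fin 2) ℂ →ₗ[ℂ]
      (E.Hom X Z ⊗[ℂ] R) ⊗[ℂ] Matrix (Fin 2) (Fin 2) ℂ :=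
    ((E.tensorAlgebra R).tensorMatrix 2).comp
  have hc : ∀ {X Y Z : E.Ob} (g : E.Hom Y Z) (f : E.Hom X Y) (A B : Matrix (Fin 2) (Fin 2) R),
    c (matrixTmul g A) (matrixTmul f B) = matrixTmul (E.comp g f) (A * B) := matrixTmul_comp
  let i : Fin 2 → E.Hom X Y ⊗[ℂ] R →ₗ[ℂ] (E.Hom X Y ⊗[ℂ] R) ⊗[ℂ] Matrix (Fin 2) (Fin 2) ℂ :=
    fun k => (TensorProduct.mk ℂ _ _).flip (Matrix.single k k 1)
  refine LinearMap.congr_fun (f := c.flip (matrixTmul (E.ids.id X) B) ∘ₗ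
    c (matrixTmul (E.ids.id Y) A) ∘ₗ (i 0 + i 1 ∘ₗ υ.lTensor _)) (g := i 1 ∘ₗ υ.lTensor _)
    (TensorProduct.ext' fun f r => ?_) f
  simp only [i, LinearMap.comp_apply, LinearMap.flip_apply, LinearMap.add_apply,
    LinearMap.lTensor_tmul, TensorProduct.mk_apply]
  rw [← matrixTmul_diagonal, hc, hc, h, mul_assoc, hAB, mul_one, E.ids.id_comp, E.ids.comp_id,
    matrixTmul_diagonal, TensorProduct.tmul_zero, TensorProduct.zero_tmul, zero_add]

end TensorAlgebra

/-! ### Endomorphisms of a space isomorphic to a product of its copies -/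

section InfiniteSums

variable {V : Type} [AddCommGroup V] [Module ℂ V] (Φ : V ≃ₗ[ℂ] (ℤ → V))

/-- The endomorphism acting by `r` on the copies of `V` with nonnegative index. -/
def infiniteSum : Module.End ℂ V →ₗ[ℂ] Module.End ℂ V where
  toFun r := Φ.symm.toLinearMap ∘ₗ
    LinearMap.pi (fun n => if 0 ≤ n then r ∘ₗ LinearMap.proj n else 0) ∘ₗ Φ.toLinearMap
  map_add' r s := by
    refine LinearMap.ext fun x => Φ.injective (funext fun n => ?_)
    by_cases hn : 0 ≤ n <;> simp [hn]
  map_smul' t r := by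
    refine LinearMap.ext fun x => Φ.injective (funext fun n => ?_)
    by_cases hn : 0 ≤ n <;> simp [hn]

theorem infiniteSum_apply (r : Module.End ℂ V) (x : V) (n : ℤ) :
    Φ (infiniteSum Φ r x) n = if 0 ≤ n then r (Φ x n) else 0 := by
  by_cases hn : 0 ≤ n <;> simp [infiniteSum, hn]

theorem infiniteSum_mul (r s : Module.End ℂ V) :
    infiniteSum Φ (r * s) = infiniteSum Φ r * infiniteSum Φ s := by
  refine LinearMap.ext fun x => Φ.injective (funext fun n => ?_)
  by_cases hn : 0 ≤ n <;> simp [infiniteSum_apply, hn]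

/-- The component of index `n`. -/
def component (n : ℤ) : Module.End ℂ V := LinearMap.proj n ∘ₗ Φ.toLinearMap

/-- The inclusion of the copy of index `n`. -/
def inclusion (n : ℤ) : Module.End ℂ V := Φ.symm.toLinearMap ∘ₗ LinearMap.single ℂ (fun _ => V) n

/-- Translate all the copies by `k`, omitting the copy which would reach the index `m`. -/
def shiftOmitting (k m : ℤ) : Module.End ℂ V :=
  Φ.symm.toLinearMap ∘ₗ
    LinearMap.pi (fun n => if n = m then 0 else LinearMap.proj (n - k)) ∘ₗ Φ.toLinearMap

theorem component_apply (n : ℤ) (x : V) : component Φ n x = Φ x n := rfl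

theorem inclusion_apply (n k : ℤ) (x : V) :
    Φ (inclusion Φ n x) k = if k = n then x else 0 := by
  simp [inclusion, Pi.single_apply]

theorem shiftOmitting_apply (k m n : ℤ) (x : V) :
    Φ (shiftOmitting Φ k m x) n = if n = m then 0 else Φ x (n - k) := by
  by_cases hn : n = m <;> simp [shiftOmitting, hn]

-- An infinite swindle: adding one copy of `r` to infinitely many copies of `r` changes nothing up
-- to conjugation. The copies of negative index, where `infiniteSum` acts by zero, make the shift
-- invertible and supply the zero summand on the other side.
include Φ in
theorem satisfiesVanishing_end {H : Type v} [Ring H] [HopfAlgebra ℂ H] (E : HCat.{u} H) :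
    (E.tensorAlgebra (Module.End ℂ V)).SatisfiesVanishing := by
  refine satisfiesVanishing_tensorAlgebra (infiniteSum Φ) (infiniteSum_mul Φ)
    -- On `V ⊕ V^ℤ` this matrix puts the separate copy at index `0`, shifts the other copies up by
    -- one, and takes out the copy of index `-1`, which would otherwise collide at index `0`. The
    -- next matrix reverses these moves.
    !![0, component Φ (-1); inclusion Φ 0, shiftOmitting Φ 1 0]
    !![0, component Φ 0; inclusion Φ (-1), shiftOmitting Φ (-1) (-1)] ?_ ?_ fun r => ?_
  · refine Matrix.ext fun i j => LinearMap.ext fun x => ?_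
    fin_cases i <;> fin_cases j <;> simp [Matrix.mul_apply, Fin.sum_univ_two]
    · simp [component_apply, inclusion_apply, shiftOmitting_apply, infiniteSum_apply]
    · simp [component_apply, inclusion_apply, shiftOmitting_apply, infiniteSum_apply]
    · refine Φ.injective (funext fun n => ?_)
      simp only [component_apply, inclusion_apply, shiftOmitting_apply, infiniteSum_apply, map_add,
        map_zero, Pi.add_apply, Pi.zero_apply]
      grind
    · refine Φ.injective (funext fun n => ?_)
      simp only [component_apply, inclusion_apply, shiftOmitting_apply, infiniteSum_apply, map_add,
        map_zero, Pi.add_apply, Pi.zero_apply]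
      grind
  · refine Matrix.ext fun i j => LinearMap.ext fun x => ?_
    fin_cases i <;> fin_cases j <;> simp [Matrix.mul_apply, Fin.sum_univ_two]
    · simp [component_apply, inclusion_apply, shiftOmitting_apply, infiniteSum_apply]
    · simp [component_apply, inclusion_apply, shiftOmitting_apply, infiniteSum_apply]
    · refine Φ.injective (funext fun n => ?_)
      simp only [component_apply, inclusion_apply, shiftOmitting_apply, infiniteSum_apply, map_add,
        map_zero, Pi.add_apply, Pi.zero_apply]
      grind
    · refine Φ.injective (funext fun n => ?_)
      simp only [component_apply, inclusion_apply, shiftOmitting_apply, infiniteSum_apply, map_add,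
        map_zero, Pi.add_apply, Pi.zero_apply]
      grind
  · refine Matrix.ext fun i j => LinearMap.ext fun x => ?_
    fin_cases i <;> fin_cases j <;> simp [Matrix.mul_apply, Fin.sum_univ_two]
    · simp [component_apply, inclusion_apply, shiftOmitting_apply, infiniteSum_apply]
    · refine Φ.injective (funext fun n => ?_)
      simp only [component_apply, inclusion_apply, shiftOmitting_apply, infiniteSum_apply, map_add,
        map_zero, Pi.add_apply, Pi.zero_apply]
      grind
    · refine Φ.injective (funext fun n => ?_)
      simp only [component_apply, inclusion_apply, shiftOmitting_apply, infiniteSum_apply, map_add,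
        map_zero, Pi.add_apply, Pi.zero_apply]
      grind

end InfiniteSums

end

end HopfCyclic

namespace HopfCyclic

noncomputable section

open Coalgebra (Repr)

/-! ### Multiplication of chains -/

section Multiplication

variable {H : Type v} [Ring H] [HopfAlgebra ℂ H] (C : HSemicat.{u} H)

/-- The multiplication of chains,
`(f⁰ ⊗ … ⊗ fᵖ) (g⁰ ⊗ … ⊗ gᑫ) = f⁰ ⊗ … ⊗ fᵖg⁰ ⊗ … ⊗ gᑫ`. -/
def chainMul : ∀ (p q n : ℕ) (_ : p + q = n) (X Y Z : C.Ob),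
    chains C p X Y →ₗ[ℂ] chains C q Y Z →ₗ[ℂ] chains C n X Z
  | 0, q, n, h, X, Y, Z => (show q = n by omega) ▸ headComp C q X Y Z
  | p + 1, q, 0, h, _, _, _ => absurd h (by omega)
  | p + 1, q, n + 1, h, X, Y, Z => consLift C fun W => TensorProduct.lift
      (LinearMap.mk₂ ℂ (fun f x => pre C n X W Z f ∘ₗ chainMul p q n (by omega) W Y Z x)
        (fun _ _ _ => by ext; simp) (fun _ _ _ => by ext; simp)
        (fun _ _ _ => by ext; simp) (fun _ _ _ => by ext; simp))

variable {C}

theorem chainMul_single {q : ℕ} (h : 0 + q = q) {X Y Z : C.Ob} (f : C.Hom Y X)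
    (y : chains C q Y Z) :
    chainMul C 0 q q h X Y Z (single C X Y f) y = headComp C q X Y Z f y := rfl

theorem chainMul_pre {p q n : ℕ} (h : p + 1 + q = n + 1) (h' : p + q = n) {W X Y Z : C.Ob}
    (f : C.Hom W X) (x : chains C p W Y) (y : chains C q Y Z) :
    chainMul C (p + 1) q (n + 1) h X Y Z (pre C p X W Y f x) y =
      pre C n X W Z f (chainMul C p q n h' W Y Z x y) := by
  rw [chainMul, consLift_pre]; rfl

theorem headComp_headComp : ∀ {n : ℕ} {V W X Z : C.Ob} (k : C.Hom W V) (g : C.Hom X W)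
    (x : chains C n X Z),
    headComp C n V W Z k (headComp C n W X Z g x) = headComp C n V X Z (C.comp k g) x
  | 0, V, W, X, Z, k, g, x => (C.assoc k g x).symm
  | n + 1, V, W, X, Z, k, g, x => by
    induction x using chains_succ_induction with
    | zero => simp
    | add x y hx hy => simp only [map_add, hx, hy]
    | pre Y f x => rw [headComp_pre, headComp_pre, headComp_pre, C.assoc]

theorem headComp_snoc : ∀ {n : ℕ} {W X Y Z : C.Ob} (g : C.Hom X W) (x : chains C n X Y)
    (f : C.Hom Z Y), headComp C (n + 1) W X Z g (snoc C n X Y Z x f) =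
      snoc C n W Y Z (headComp C n W X Y g x) f
  | 0, W, X, Y, Z, g, x, f => headComp_pre (n := 0) g x f
  | n + 1, W, X, Y, Z, g, x, f => by
    induction x using chains_succ_induction with
    | zero => simp
    | add x y hx hy => simp only [map_add, LinearMap.add_apply, hx, hy]
    | pre V a x => rw [snoc_pre, headComp_pre, headComp_pre, snoc_pre]

theorem headComp_chainMul : ∀ {p q n : ℕ} (h : p + q = n) {W X Y Z : C.Ob} (k : C.Hom X W)
    (x : chains C p X Y) (y : chains C q Y Z),
    headComp C n W X Z k (chainMul C p q n h X Y Z x y) =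
      chainMul C p q n h W Y Z (headComp C p W X Y k x) y
  | 0, q, n, h, W, X, Y, Z, k, x, y => by
    obtain rfl : q = n := by omega
    exact headComp_headComp k x y
  | p + 1, q, 0, h, _, _, _, _, _, _, _ => absurd h (by omega)
  | p + 1, q, n + 1, h, W, X, Y, Z, k, x, y => by
    induction x using chains_succ_induction with
    | zero => simp
    | add x y hx hy => simp only [map_add, LinearMap.add_apply, hx, hy]
    | pre V a x =>
      rw [chainMul_pre h (by omega), headComp_pre, headComp_pre, chainMul_pre h (by omega)]

theorem chainMul_assoc : ∀ {p q r s t n : ℕ} (hpq : p + q = s) (hqr : q + r = t) (hs : s + r = n)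
    (ht : p + t = n) {W X Y Z : C.Ob} (k : chains C p Z Y) (g : chains C q Y X)
    (f : chains C r X W),
    chainMul C s r n hs Z X W (chainMul C p q s hpq Z Y X k g) f =
      chainMul C p t n ht Z Y W k (chainMul C q r t hqr Y X W g f)
  | 0, q, r, s, t, n, hpq, hqr, hs, ht, W, X, Y, Z, k, g, f => by
    obtain rfl : q = s := by omega
    obtain rfl : t = n := by omega
    exact (headComp_chainMul hs k g f).symm
  | p + 1, q, r, 0, t, n, hpq, _, _, _, _, _, _, _, _, _, _ => absurd hpq (by omega)
  | p + 1, q, r, s + 1, t, 0, _, _, hs, _, _, _, _, _, _, _, _ => absurd hs (by omega)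
  | p + 1, q, r, s + 1, t, n + 1, hpq, hqr, hs, ht, W, X, Y, Z, k, g, f => by
    induction k using chains_succ_induction with
    | zero => simp
    | add x y hx hy => simp only [map_add, LinearMap.add_apply, hx, hy]
    | pre V a x =>
      rw [chainMul_pre hpq (by omega), chainMul_pre hs (by omega), chainMul_pre ht (by omega),
        chainMul_assoc (by omega) hqr (by omega) (by omega) x g f]

theorem chainMul_snoc_single : ∀ {n : ℕ} (h : n + 1 + 0 = n + 1) {X Y W Z : C.Ob}
    (x : chains C n X Y) (a : C.Hom W Y) (f : C.Hom Z W),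
    chainMul C (n + 1) 0 (n + 1) h X W Z (snoc C n X Y W x a) (single C W Z f) =
      snoc C n X Y Z x (C.comp a f)
  | 0, h, X, Y, W, Z, x, a, f => chainMul_pre (n := 0) h rfl _ _ _
  | n + 1, h, X, Y, W, Z, x, a, f => by
    induction x using chains_succ_induction with
    | zero => simp
    | add x y hx hy => simp only [map_add, LinearMap.add_apply, hx, hy]
    | pre V b x => rw [snoc_pre, chainMul_pre h rfl, chainMul_snoc_single, snoc_pre]

theorem chainMul_pre_single : ∀ {n : ℕ} (h₀ : n + 0 = n) (h : n + 1 = n + 1) {X Y W Z : C.Ob}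
    (x : chains C n X Y) (a : C.Hom W Y) (f : C.Hom Z W),
    chainMul C n 1 (n + 1) h X Y Z x (pre C 0 Y W Z a (single C W Z f)) =
      snoc C n X W Z (chainMul C n 0 n h₀ X Y W x (single C Y W a)) f
  | 0, h₀, h, X, Y, W, Z, x, a, f => headComp_pre (n := 0) x a (single C W Z f)
  | n + 1, h₀, h, X, Y, W, Z, x, a, f => by
    induction x using chains_succ_induction with
    | zero => simp
    | add x y hx hy => simp only [map_add, LinearMap.add_apply, hx, hy]
    | pre V b x =>
      rw [chainMul_pre h rfl, chainMul_pre h₀ rfl, chainMul_pre_single rfl, snoc_pre]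

/-! #### The diagonal action -/

/-- The comultiplication of a product. -/
def reprMul {h k : H} {ι κ : Type*} (R : Repr ℂ h ι) (R' : Repr ℂ k κ) : Repr ℂ (h * k) (ι × κ) where
  index := R.index ×ˢ R'.index
  left i := R.left i.1 * R'.left i.2
  right i := R.right i.1 * R'.right i.2
  eq := by
    rw [Bialgebra.comul_mul, ← R.eq, ← R'.eq, Finset.sum_mul_sum, Finset.sum_product]
    simp [Algebra.TensorProduct.tmul_mul_tmul]

variable (H) in
/-- The comultiplication of the unit. -/
def reprOne : Repr ℂ (1 : H) Unit where
  index := Finset.univ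
  left _ := 1
  right _ := 1
  eq := by simp [Bialgebra.comul_one, Algebra.TensorProduct.one_def]

theorem diagAct_one : ∀ {n : ℕ} {X Z : C.Ob} (x : chains C n X Z), diagAct C n X Z 1 x = x
  | 0, X, Z, x => @one_smul H (C.Hom Z X) _ _ x
  | n + 1, X, Z, x => by
    induction x using chains_succ_induction with
    | zero => simp
    | add x y hx hy => simp only [map_add, hx, hy]
    | pre Y f x =>
      rw [diagAct_pre (reprOne H)]
      simp [reprOne, diagAct_one]

theorem diagAct_mul : ∀ {n : ℕ} {X Z : C.Ob} (h k : H) (x : chains C n X Z),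
    diagAct C n X Z (h * k) x = diagAct C n X Z h (diagAct C n X Z k x)
  | 0, X, Z, h, k, x => @mul_smul H (C.Hom Z X) _ _ h k x
  | n + 1, X, Z, h, k, x => by
    induction x using chains_succ_induction with
    | zero => simp
    | add x y hx hy => simp only [map_add, hx, hy]
    | pre Y f x =>
      rw [diagAct_pre (Repr.arbitrary ℂ k), map_sum,
        diagAct_pre (reprMul (Repr.arbitrary ℂ h) (Repr.arbitrary ℂ k))]
      simp only [diagAct_pre (Repr.arbitrary ℂ h), reprMul, mul_smul, diagAct_mul]
      rw [Finset.sum_product, Finset.sum_comm]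

theorem diagAct_headComp : ∀ {n : ℕ} {W X Z : C.Ob} {h : H} {ι : Type*} (R : Repr ℂ h ι)
    (g : C.Hom X W) (x : chains C n X Z), diagAct C n W Z h (headComp C n W X Z g x) =
      ∑ i ∈ R.index, headComp C n W X Z (R.left i • g) (diagAct C n X Z (R.right i) x)
  | 0, W, X, Z, h, ι, R, g, x => C.smul_comp_sum R g x
  | n + 1, W, X, Z, h, ι, R, g, x => by
    induction x using chains_succ_induction with
    | zero => simp
    | add x y hx hy => simp only [map_add, hx, hy, Finset.sum_add_distrib]
    | pre Y f x =>
      rw [headComp_pre, diagAct_pre R]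
      have := sum_coassoc
        ((C.comp.compl₁₂ ((lact H (C.Hom X W)).flip g) ((lact H (C.Hom Y X)).flip f)).compr₂
          ((pre C n W Y Z).compl₂ ((diagAct C n Y Z).flip x))) R
        (fun i => Repr.arbitrary ℂ (R.left i)) (fun i => Repr.arbitrary ℂ (R.right i))
      refine Eq.trans (Finset.sum_congr rfl fun i _ => ?_) (this.trans
        (Finset.sum_congr rfl fun i _ => ?_))
      · rw [C.smul_comp_sum (Repr.arbitrary ℂ (R.left i)), map_sum, LinearMap.sum_apply]; rfl
      · rw [diagAct_pre (Repr.arbitrary ℂ (R.right i)), map_sum]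
        exact Finset.sum_congr rfl fun j _ => (headComp_pre _ _ _).symm

theorem diagAct_chainMul : ∀ {p q n : ℕ} (hn : p + q = n) {X Y Z : C.Ob} {h : H} {ι : Type v}
    (R : Repr ℂ h ι) (x : chains C p X Y) (y : chains C q Y Z),
    diagAct C n X Z h (chainMul C p q n hn X Y Z x y) = ∑ i ∈ R.index,
      chainMul C p q n hn X Y Z (diagAct C p X Y (R.left i) x) (diagAct C q Y Z (R.right i) y)
  | 0, q, n, hn, X, Y, Z, h, ι, R, x, y => by
    obtain rfl : q = n := by omega
    exact diagAct_headComp R x y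
  | p + 1, q, 0, h, _, _, _, _, _, _, _, _ => absurd h (by omega)
  | p + 1, q, n + 1, hn, X, Y, Z, h, ι, R, x, y => by
    induction x using chains_succ_induction with
    | zero => simp
    | add x y hx hy => simp only [map_add, LinearMap.add_apply, hx, hy, Finset.sum_add_distrib]
    | pre W f x =>
      have hn' : p + q = n := by omega
      rw [chainMul_pre hn hn', diagAct_pre R]
      let G : H →ₗ[ℂ] H →ₗ[ℂ] chains C n W Z := (chainMul C p q n hn' W Y Z).compl₁₂
        ((diagAct C p W Y).flip x) ((diagAct C q Y Z).flip y)
      let F : H →ₗ[ℂ] H →ₗ[ℂ] H →ₗ[ℂ] chains C (n + 1) X Z :=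
        { toFun := fun a => G.compr₂ (pre C n X W Z (a • f))
          map_add' := fun a b => by ext; simp [add_smul]
          map_smul' := fun t a => by ext; simp [smul_assoc] }
      have := sum_coassoc F R
        (fun i => Repr.arbitrary ℂ (R.left i)) (fun i => Repr.arbitrary ℂ (R.right i))
      refine Eq.trans (Finset.sum_congr rfl fun i _ => ?_) (this.symm.trans
        (Finset.sum_congr rfl fun i _ => ?_))
      · rw [diagAct_chainMul hn' (Repr.arbitrary ℂ (R.right i)), map_sum]; rfl
      · rw [diagAct_pre (Repr.arbitrary ℂ (R.left i)), map_sum, LinearMap.sum_apply]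
        exact Finset.sum_congr rfl fun j _ => (chainMul_pre hn hn' _ _ _).symm

theorem diagAct_snoc : ∀ {n : ℕ} {X Y Z : C.Ob} {h : H} {ι : Type v}
    (R : Repr ℂ h ι) (x : chains C n X Y) (f : C.Hom Z Y),
    diagAct C (n + 1) X Z h (snoc C n X Y Z x f) =
      ∑ i ∈ R.index, snoc C n X Y Z (diagAct C n X Y (R.left i) x) (R.right i • f)
  | 0, X, Y, Z, h, ι, R, x, f => diagAct_pre (n := 0) R x (single C Y Z f)
  | n + 1, X, Y, Z, h, ι, R, x, f => by
    induction x using chains_succ_induction with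
    | zero => simp
    | add x y hx hy => simp only [map_add, LinearMap.add_apply, hx, hy, Finset.sum_add_distrib]
    | pre W g x =>
      rw [snoc_pre, diagAct_pre R]
      let G : H →ₗ[ℂ] H →ₗ[ℂ] chains C (n + 1) W Z := (snoc C n W Y Z).compl₁₂
        ((diagAct C n W Y).flip x) ((lact H (C.Hom Z Y)).flip f)
      let F : H →ₗ[ℂ] H →ₗ[ℂ] H →ₗ[ℂ] chains C (n + 2) X Z :=
        { toFun := fun a => G.compr₂ (pre C (n + 1) X W Z (a • g))
          map_add' := fun a b => by ext; simp [add_smul]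
          map_smul' := fun t a => by ext; simp [smul_assoc] }
      have := sum_coassoc F R
        (fun i => Repr.arbitrary ℂ (R.left i)) (fun i => Repr.arbitrary ℂ (R.right i))
      refine Eq.trans (Finset.sum_congr rfl fun i _ => ?_) (this.symm.trans
        (Finset.sum_congr rfl fun i _ => ?_))
      · rw [diagAct_snoc (Repr.arbitrary ℂ (R.right i)), map_sum]; rfl
      · rw [diagAct_pre (Repr.arbitrary ℂ (R.left i)), map_sum, LinearMap.sum_apply]
        exact Finset.sum_congr rfl fun j _ => (snoc_pre _ _ _).symm

/-- The `H`-module of chains. -/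
instance chainsModule (n : ℕ) (X Z : C.Ob) : Module H (chains C n X Z) where
  smul h x := diagAct C n X Z h x
  one_smul := diagAct_one
  mul_smul := diagAct_mul
  smul_zero h := map_zero _
  smul_add h := map_add _
  add_smul h k x := by
    change diagAct C n X Z (h + k) x = _
    rw [map_add]; rfl
  zero_smul x := by
    change diagAct C n X Z 0 x = _
    rw [map_zero]; rfl

theorem chains_smul_def {n : ℕ} {X Z : C.Ob} (h : H) (x : chains C n X Z) :
    h • x = diagAct C n X Z h x := rfl

instance (n : ℕ) (X Z : C.Ob) : IsScalarTower ℂ H (chains C n X Z) where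
  smul_assoc c h x := by
    rw [chains_smul_def, map_smul]; rfl

end Multiplication

end

end HopfCyclic

namespace HopfCyclic

noncomputable section

open Coalgebra (Repr)

/-! ### The universal DGH-semicategory of an `H`-category -/

section Universal

variable {H : Type v} [Ring H] [HopfAlgebra ℂ H] {C : HSemicat.{u} H} (I : C.Identities)

/-- The differential of chains which inserts identities,
`f⁰ ⊗ … ⊗ fⁿ ↦ ∑ (-1)ⁱ f⁰ ⊗ … ⊗ fⁱ⁻¹ ⊗ id ⊗ fⁱ ⊗ … ⊗ fⁿ`. -/
def chainDiff : ∀ (n : ℕ) (X Z : C.Ob), chains C n X Z →ₗ[ℂ] chains C (n + 1) X Z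
  | 0, X, Z => pre C 0 X X Z (I.id X) -
      ((pre C 0 X Z Z).flip (single C Z Z (I.id Z))) ∘ₗ (single C X Z).symm.toLinearMap
  | n + 1, X, Z => pre C (n + 1) X X Z (I.id X) - consLift C fun Y => TensorProduct.lift
      ((pre C (n + 1) X Y Z).compl₂ (chainDiff n Y Z))

variable {I}

theorem chainDiff_single {X Z : C.Ob} (f : C.Hom Z X) :
    chainDiff I 0 X Z (single C X Z f) =
      pre C 0 X X Z (I.id X) (single C X Z f) - pre C 0 X Z Z f (single C Z Z (I.id Z)) := rfl

theorem chainDiff_pre {n : ℕ} {X Y Z : C.Ob} (f : C.Hom Y X) (x : chains C n Y Z) :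
    chainDiff I (n + 1) X Z (pre C n X Y Z f x) =
      pre C (n + 1) X X Z (I.id X) (pre C n X Y Z f x) -
        pre C (n + 1) X Y Z f (chainDiff I n Y Z x) := by
  rw [chainDiff, LinearMap.sub_apply, consLift_pre]; rfl

theorem chainDiff_chainDiff : ∀ {n : ℕ} {X Z : C.Ob} (x : chains C n X Z),
    chainDiff I (n + 1) X Z (chainDiff I n X Z x) = 0
  | 0, X, Z, x => by
    induction x using chains_zero_induction with
    | single f =>
      rw [chainDiff_single, map_sub, chainDiff_pre, chainDiff_pre, chainDiff_single,
        chainDiff_single, map_sub, map_sub]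
      abel
  | n + 1, X, Z, x => by
    induction x using chains_succ_induction with
    | zero => simp
    | add x y hx hy => rw [map_add, map_add, hx, hy, add_zero]
    | pre Y f x =>
      rw [chainDiff_pre, map_sub, chainDiff_pre, chainDiff_pre, chainDiff_pre, map_sub,
        chainDiff_chainDiff x, map_zero]
      abel

theorem diagAct_pre_id {n : ℕ} {X Z : C.Ob} (h : H) (x : chains C n X Z) :
    diagAct C (n + 1) X Z h (pre C n X X Z (I.id X) x) =
      pre C n X X Z (I.id X) (diagAct C n X Z h x) := by
  rw [diagAct_pre (Repr.arbitrary ℂ h)]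
  simp only [I.smul_id, map_smul, LinearMap.smul_apply]
  exact sum_counit_left (pre C n X X Z (I.id X) ∘ₗ (diagAct C n X Z).flip x) _

theorem diagAct_chainDiff : ∀ {n : ℕ} {X Z : C.Ob} (h : H) (x : chains C n X Z),
    diagAct C (n + 1) X Z h (chainDiff I n X Z x) = chainDiff I n X Z (diagAct C n X Z h x)
  | 0, X, Z, h, x => by
    induction x using chains_zero_induction with
    | single f =>
      rw [chainDiff_single, map_sub, diagAct_pre_id, diagAct_single, chainDiff_single,
        diagAct_pre (Repr.arbitrary ℂ h)]
      congr 1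
      simp only [diagAct_single, I.smul_id, map_smul]
      exact sum_counit_right ((pre C 0 X Z Z).flip (single C Z Z (I.id Z)) ∘ₗ
        (lact H (C.Hom Z X)).flip f) _
  | n + 1, X, Z, h, x => by
    induction x using chains_succ_induction with
    | zero => simp
    | add x y hx hy => simp only [map_add, hx, hy]
    | pre Y f x =>
      rw [chainDiff_pre, map_sub, diagAct_pre_id, diagAct_pre (Repr.arbitrary ℂ h),
        diagAct_pre (Repr.arbitrary ℂ h), map_sum, map_sum, ← Finset.sum_sub_distrib]
      simp only [chainDiff_pre, diagAct_chainDiff]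

theorem headComp_id : ∀ {n : ℕ} {X Z : C.Ob} (x : chains C n X Z),
    headComp C n X X Z (I.id X) x = x
  | 0, X, Z, x => I.id_comp (Y := X) x
  | n + 1, X, Z, x => by
    induction x using chains_succ_induction with
    | zero => simp
    | add x y hx hy => simp only [map_add, hx, hy]
    | pre Y f x => rw [headComp_pre, I.id_comp]

theorem chainMul_single_id : ∀ {n : ℕ} (h : n + 0 = n) {X Y : C.Ob} (x : chains C n X Y),
    chainMul C n 0 n h X Y Y x (single C Y Y (I.id Y)) = x
  | 0, h, X, Y, x => I.comp_id (X := Y) x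
  | n + 1, h, X, Y, x => by
    induction x using chains_succ_induction with
    | zero => simp
    | add x y hx hy => simp only [map_add, LinearMap.add_apply, hx, hy]
    | pre W f x => rw [chainMul_pre h rfl, chainMul_single_id]

theorem chainDiff_headComp : ∀ {n : ℕ} {W X Z : C.Ob} (g : C.Hom X W) (x : chains C n X Z),
    chainDiff I n W Z (headComp C n W X Z g x) =
      pre C n W W Z (I.id W) (headComp C n W X Z g x) - pre C n W X Z g x +
        headComp C (n + 1) W X Z g (chainDiff I n X Z x)
  | 0, W, X, Z, g, x => by
    induction x using chains_zero_induction with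
    | single f =>
      rw [headComp_single, chainDiff_single, chainDiff_single, map_sub, headComp_pre, headComp_pre,
        I.comp_id]
      abel
  | n + 1, W, X, Z, g, x => by
    induction x using chains_succ_induction with
    | zero => simp
    | add x y hx hy => simp only [map_add, hx, hy]; abel
    | pre Y f x =>
      rw [headComp_pre, chainDiff_pre, chainDiff_pre, map_sub, headComp_pre, headComp_pre,
        I.comp_id]
      abel

/-- The only terms not of the required form sit at the junction. Appending an identity to `x` and
prepending one to `y` both produce `x ⊗ y`, with signs `(-1)ᵖ⁺¹` and `(-1)ᵖ`, and cancel. -/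
theorem chainDiff_chainMul : ∀ {p q n : ℕ} (hn : p + q = n) (h₁ : p + 1 + q = n + 1)
    (h₂ : p + (q + 1) = n + 1) {X Y Z : C.Ob} (x : chains C p X Y) (y : chains C q Y Z),
    chainDiff I n X Z (chainMul C p q n hn X Y Z x y) =
      chainMul C (p + 1) q (n + 1) h₁ X Y Z (chainDiff I p X Y x) y +
        (-1 : ℂ) ^ p • chainMul C p (q + 1) (n + 1) h₂ X Y Z x (chainDiff I q Y Z y)
  | 0, q, n, hn, h₁, h₂, X, Y, Z, x, y => by
    obtain rfl : q = n := by omega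
    induction x using chains_zero_induction with
    | single g =>
      rw [chainMul_single, chainDiff_headComp, chainDiff_single, map_sub, LinearMap.sub_apply,
        chainMul_pre h₁ (zero_add q), chainMul_pre h₁ (zero_add q), chainMul_single,
        chainMul_single, headComp_id, pow_zero, one_smul]
      rfl
  | p + 1, q, 0, hn, _, _, _, _, _, _, _ => absurd hn (by omega)
  | p + 1, q, n + 1, hn, h₁, h₂, X, Y, Z, x, y => by
    induction x using chains_succ_induction with
    | zero => simp
    | add x x' hx hy => simp only [map_add, LinearMap.add_apply, hx, hy, smul_add]; abel
    | pre W f x =>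
      have hn' : p + q = n := by omega
      rw [chainMul_pre hn hn', chainDiff_pre, chainDiff_chainMul hn' (by omega) (by omega),
        chainDiff_pre, map_sub, LinearMap.sub_apply, chainMul_pre h₁ hn, chainMul_pre hn hn',
        chainMul_pre h₁ (by omega), chainMul_pre h₂ (by omega), map_add, map_smul, pow_succ]
      module

theorem chainDiff_snoc : ∀ {n : ℕ} {X Y Z : C.Ob} (x : chains C n X Y) (f : C.Hom Z Y),
    chainDiff I (n + 1) X Z (snoc C n X Y Z x f) =
      snoc C (n + 1) X Y Z (chainDiff I n X Y x) f +
        (-1 : ℂ) ^ n • snoc C (n + 1) X Z Z (snoc C n X Y Z x f) (I.id Z)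
  | 0, X, Y, Z, x, f => by
    induction x using chains_zero_induction with
    | single g =>
      rw [snoc_single, chainDiff_pre, chainDiff_single, chainDiff_single, map_sub, map_sub,
        LinearMap.sub_apply, snoc_pre, snoc_single, snoc_pre, snoc_single, snoc_pre, snoc_single,
        pow_zero, one_smul]
      abel
  | n + 1, X, Y, Z, x, f => by
    induction x using chains_succ_induction with
    | zero => simp
    | add x y hx hy => simp only [map_add, LinearMap.add_apply, hx, hy, smul_add]; abel
    | pre W g x =>
      rw [snoc_pre, chainDiff_pre, chainDiff_pre, chainDiff_snoc, map_sub, LinearMap.sub_apply,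
        snoc_pre, snoc_pre, snoc_pre, snoc_pre, map_add, map_smul, pow_succ]
      module


theorem chainMul_chainDiff_single {q : ℕ} (h : 1 + q = q + 1) {X Y Z : C.Ob} (f : C.Hom Y X)
    (y : chains C q Y Z) :
    chainMul C 1 q (q + 1) h X Y Z (chainDiff I 0 X Y (single C X Y f)) y =
      pre C q X X Z (I.id X) (headComp C q X Y Z f y) - pre C q X Y Z f y := by
  rw [chainDiff_single, map_sub, LinearMap.sub_apply,
    chainMul_pre (p := 0) h (zero_add q), chainMul_pre (p := 0) h (zero_add q), chainMul_single,
    chainMul_single, headComp_id]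

theorem chainMul_chainDiff_single_right {n : ℕ} (h : n + 0 = n) {X Y Z : C.Ob}
    (x : chains C n X Y) (f : C.Hom Z Y) :
    chainMul C n 1 (n + 1) rfl X Y Z x (chainDiff I 0 Y Z (single C Y Z f)) =
      snoc C n X Y Z x f -
        snoc C n X Z Z (chainMul C n 0 n h X Y Z x (single C Y Z f)) (I.id Z) := by
  rw [chainDiff_single, map_sub, chainMul_pre_single h, chainMul_pre_single h,
    chainMul_single_id]

variable (I) in
/-- The universal DGH-semicategory of an `H`-category: the morphisms of degree `n` are the chains
`f⁰ ⊗ … ⊗ fⁿ`. -/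
abbrev universalDGH : DGHSemicat.{u} H where
  Ob := C.Ob
  Hom n X Y := chains C n Y X
  comp {p q n} hn {X Y Z} := chainMul C p q n hn Z Y X
  assoc {p q r s t n} hpq hqr hs ht {W X Y Z} k g f := chainMul_assoc hpq hqr hs ht k g f
  smul_comp {p q n} hn {X Y Z} h x y := by
    rw [sweedler_eq_sum _ (Repr.arbitrary ℂ h)]
    exact diagAct_chainMul hn (Repr.arbitrary ℂ h) x y
  d {n n'} hn {X Y} := hn ▸ chainDiff I n Y X
  d_d {n n' n''} h h' {X Y} x := by
    subst h h'
    exact chainDiff_chainDiff x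
  d_smul {n n'} hn {X Y} h x := by
    subst hn
    exact (diagAct_chainDiff h x).symm
  leibniz {p q n p' q' n'} hn hp' hq' hn' h₁ h₂ {X Y Z} x y := by
    subst hp' hq' hn'
    exact chainDiff_chainMul hn h₁ h₂ x y

end Universal

end

end HopfCyclic

namespace HopfCyclic

noncomputable section

open Coalgebra (Repr)

/-! ### Projection of chains over `D ⊗ R` to chains over `D`, and a section of it -/

section

variable {H : Type v} [Ring H] [HopfAlgebra ℂ H]

/-- Pushing an undifferentiated final factor to the left through the differentials by the Leibniz
rule produces the alternating inner faces. This is how they enter the character in `charChain_snoc`.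
-/
theorem charProd_comp_rhoMap {C : HSemicat.{u} H} {S : DGHSemicat.{u} H} {obj : C.Ob → S.Ob}
    (ρ : HSemifunctor C S.degZero obj) : ∀ {n : ℕ} {X Y Z : C.Ob} (x : chains C n X Y)
    (f : C.Hom Z Y), S.comp (add_zero n) (charProd ρ n X Y x) (rhoMap ρ Y Z f) =
      (-1 : ℂ) ^ n • charProd ρ n X Z (innerFaces n X Z (snoc C n X Y Z x f))
  | 0, X, Y, Z, x, f => by
    induction x using chains_zero_induction with
    | single g =>
      rw [snoc_single, innerFaces_single, charProd_single, charProd_single, rhoMap_comp, pow_zero,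
        one_smul]
  | n + 1, X, Y, Z, x, f => by
    induction x using chains_succ_induction with
    | zero => simp
    | add a b ha hb => simp only [map_add, LinearMap.add_apply, ha, hb, smul_add]
    | pre W g x =>
      rw [snoc_pre, innerFaces_pre, charProd_pre, map_sub, charProd_headComp, charProd_pre,
        diffProd_innerFaces, rightProd_snoc, map_add, map_smul,
        S.assoc _ (add_zero (n + 1)) _ (zero_add (n + 1)), sub_add_cancel_left, smul_neg, smul_smul,
        ← neg_smul, pow_succ, mul_assoc, neg_one_mul, mul_neg, neg_neg, ← mul_pow]
      simp

variable (D : HCat.{u} H) {R : Type} [Ring R] [Algebra ℂ R] (χ : R →ₗ[ℂ] ℂ)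

/-- The map `f ⊗ r ↦ χ(r) f`. -/
def projHom (X Z : D.Ob) : (D.tensorAlgebra R).Hom Z X →ₗ[ℂ] D.Hom Z X :=
  (TensorProduct.rid ℂ (D.Hom Z X)).toLinearMap ∘ₗ χ.lTensor (D.Hom Z X)

variable {D}

theorem projHom_tmul {X Z : D.Ob} (f : D.Hom Z X) (r : R) :
    projHom D χ X Z (f ⊗ₜ[ℂ] r) = χ r • f := by
  simp [projHom]

theorem projHom_smul {X Z : D.Ob} (h : H) (f : (D.tensorAlgebra R).Hom Z X) :
    projHom D χ X Z (h • f) = h • projHom D χ X Z f := by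
  induction f using TensorProduct.induction_on with
  | zero => simp
  | add a b ha hb => simp only [smul_add, map_add, ha, hb]
  | tmul f r =>
    rw [projHom_tmul, smul_comm, ← projHom_tmul]; rfl

variable (D) in
/-- The map `(f⁰ ⊗ r⁰) ⊗ … ⊗ (fⁿ ⊗ rⁿ) ↦ χ(r⁰) ⋯ χ(rⁿ) f⁰ ⊗ … ⊗ fⁿ`. -/
def projChain : ∀ (n : ℕ) (X Z : D.Ob),
    chains (D.tensorAlgebra R).toHSemicat n X Z →ₗ[ℂ] chains D.toHSemicat n X Z
  | 0, X, Z => projHom D χ X Z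
  | n + 1, X, Z => consLift (D.tensorAlgebra R).toHSemicat fun (Y : D.Ob) => TensorProduct.lift
      ((pre D.toHSemicat n X Y Z).compl₁₂ (projHom D χ X Y) (projChain n Y Z))

theorem projChain_single {X Z : D.Ob} (f : (D.tensorAlgebra R).Hom Z X) :
    projChain D χ 0 X Z (single (D.tensorAlgebra R).toHSemicat X Z f) =
      single D.toHSemicat X Z (projHom D χ X Z f) := rfl

theorem projChain_pre {n : ℕ} {X Y Z : D.Ob} (f : (D.tensorAlgebra R).Hom Y X)
    (x : chains (D.tensorAlgebra R).toHSemicat n Y Z) :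
    projChain D χ (n + 1) X Z (pre (D.tensorAlgebra R).toHSemicat n X Y Z f x) =
      pre D.toHSemicat n X Y Z (projHom D χ X Y f) (projChain D χ n Y Z x) := by
  rw [projChain, consLift_pre]; rfl

theorem projChain_snoc : ∀ {n : ℕ} {X Y Z : D.Ob}
    (x : chains (D.tensorAlgebra R).toHSemicat n X Y) (f : (D.tensorAlgebra R).Hom Z Y),
    projChain D χ (n + 1) X Z (snoc (D.tensorAlgebra R).toHSemicat n X Y Z x f) =
      snoc D.toHSemicat n X Y Z (projChain D χ n X Y x) (projHom D χ Y Z f)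
  | 0, X, Y, Z, x, f => projChain_pre χ (n := 0) x (single (D.tensorAlgebra R).toHSemicat Y Z f)
  | n + 1, X, Y, Z, x, f => by
    induction x using chains_succ_induction with
    | zero => simp
    | add x y hx hy => simp only [map_add, LinearMap.add_apply, hx, hy]
    | pre W g x => rw [snoc_pre, projChain_pre, projChain_pre, projChain_snoc, snoc_pre]

theorem projChain_diagAct : ∀ {n : ℕ} {X Z : D.Ob} (h : H)
    (x : chains (D.tensorAlgebra R).toHSemicat n X Z),
    projChain D χ n X Z (diagAct (D.tensorAlgebra R).toHSemicat n X Z h x) =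
      diagAct D.toHSemicat n X Z h (projChain D χ n X Z x)
  | 0, X, Z, h, x => projHom_smul χ h x
  | n + 1, X, Z, h, x => by
    induction x using chains_succ_induction with
    | zero => simp
    | add x y hx hy => simp only [map_add, hx, hy]
    | pre Y f x =>
      rw [diagAct_pre (Repr.arbitrary ℂ h), projChain_pre, diagAct_pre (Repr.arbitrary ℂ h),
        map_sum]
      refine Finset.sum_congr rfl fun i _ => ?_
      rw [projChain_pre, projChain_diagAct]
      exact congrArg (fun a => pre D.toHSemicat n X Y Z a _) (projHom_smul χ _ f)

variable {χ} (hχ : χ 1 = 0)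

include hχ in
theorem projHom_id (X : D.Ob) : projHom D χ X X ((D.tensorAlgebra R).ids.id X) = 0 := by
  refine (projHom_tmul χ (D.ids.id X) 1).trans ?_
  rw [hχ, zero_smul]

-- Each term of the differential has an identity among its factors, and `χ(1) = 0`.
include hχ in
theorem projChain_chainDiff : ∀ {n : ℕ} {X Z : D.Ob}
    (x : chains (D.tensorAlgebra R).toHSemicat n X Z),
    projChain D χ (n + 1) X Z (chainDiff (D.tensorAlgebra R).ids n X Z x) = 0
  | 0, X, Z, x => by
    induction x using chains_zero_induction with
    | single f =>
      rw [chainDiff_single, map_sub, projChain_pre, projChain_pre, projChain_single,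
        projChain_single, projHom_id hχ, projHom_id hχ]
      simp
  | n + 1, X, Z, x => by
    induction x using chains_succ_induction with
    | zero => simp
    | add x y hx hy => rw [map_add, map_add, hx, hy, add_zero]
    | pre Y f x =>
      rw [chainDiff_pre, map_sub, projChain_pre, projChain_pre, projChain_pre, projHom_id hχ,
        projChain_chainDiff x]
      simp

-- Multiplication by `g` absorbs only an identity in first position, so `g ⊗ x` is the one term of
-- `g ∂x` that survives `χ(1) = 0`. This is the reason why pulled-back cochains are normalized.
include hχ in
theorem projChain_headComp_chainDiff {n : ℕ} {W X Z : D.Ob} (g : (D.tensorAlgebra R).Hom X W)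
    (x : chains (D.tensorAlgebra R).toHSemicat n X Z) :
    projChain D χ (n + 1) W Z (headComp (D.tensorAlgebra R).toHSemicat (n + 1) W X Z g
      (chainDiff (D.tensorAlgebra R).ids n X Z x)) =
    pre D.toHSemicat n W X Z (projHom D χ W X g) (projChain D χ n X Z x) := by
  cases n with
  | zero =>
    induction x using chains_zero_induction with
    | single f =>
      rw [chainDiff_single, map_sub, map_sub, headComp_pre, headComp_pre, projChain_pre,
        projChain_pre, projChain_single, projChain_single, projHom_id hχ,
        (D.tensorAlgebra R).ids.comp_id]
      simp
  | succ n =>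
    induction x using chains_succ_induction with
    | zero => simp
    | add x y hx hy => simp only [map_add, hx, hy]
    | pre Y f x =>
      rw [chainDiff_pre, map_sub, map_sub, headComp_pre, headComp_pre, projChain_pre,
        projChain_pre, projChain_pre, projChain_chainDiff hχ, (D.tensorAlgebra R).ids.comp_id]
      simp

/-! #### The semifunctor given by an idempotent -/

variable {p : R} (hp : p * p = p) (hpχ : χ p = 1)

variable (D) (p) in
/-- The map `f ↦ f ⊗ p`. -/
def tmulHom (X Z : D.Ob) : D.Hom Z X →ₗ[ℂ] (D.tensorAlgebra R).Hom Z X :=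
  (TensorProduct.mk ℂ (D.Hom Z X) R).flip p

variable (D) in
/-- The semifunctor `f ↦ f ⊗ p` for an idempotent `p`. -/
def idempotentSemifunctor :
    HSemifunctor D.toHSemicat (universalDGH (D.tensorAlgebra R).ids).degZero (fun X => X) where
  map {X Y} := tmulHom D p Y X
  map_smul h f := rfl
  map_comp {X Y Z} g f := by
    change D.comp g f ⊗ₜ[ℂ] p = (D.tensorAlgebra R).comp (g ⊗ₜ p) (f ⊗ₜ p)
    simp [hp]

include hpχ in
theorem projHom_tmulHom {X Z : D.Ob} (f : D.Hom Z X) :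
    projHom D χ X Z (tmulHom D p X Z f) = f := by
  refine (projHom_tmul χ f p).trans ?_
  rw [hpχ, one_smul]

variable (D) in
/-- The chain `∂(f⁰ ⊗ p) ⋯ ∂(fⁿ ⊗ p)`. -/
def diffChain (n : ℕ) (X Z : D.Ob) :
    chains D.toHSemicat n X Z →ₗ[ℂ] chains (D.tensorAlgebra R).toHSemicat (n + 1) X Z :=
  diffProd (idempotentSemifunctor D hp) n X Z

variable (D) in
/-- The chain `(f⁰ ⊗ p) ∂(f¹ ⊗ p) ⋯ ∂(fⁿ ⊗ p)`. -/
def charChain (n : ℕ) (X Z : D.Ob) :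
    chains D.toHSemicat n X Z →ₗ[ℂ] chains (D.tensorAlgebra R).toHSemicat n X Z :=
  charProd (idempotentSemifunctor D hp) n X Z

theorem diffChain_single {X Z : D.Ob} (f : D.Hom Z X) :
    diffChain D hp 0 X Z (single D.toHSemicat X Z f) = chainDiff (D.tensorAlgebra R).ids 0 X Z
      (single (D.tensorAlgebra R).toHSemicat X Z (tmulHom D p X Z f)) := rfl

theorem diffChain_pre {n : ℕ} {X Y Z : D.Ob} (f : D.Hom Y X) (x : chains D.toHSemicat n Y Z) :
    diffChain D hp (n + 1) X Z (pre D.toHSemicat n X Y Z f x) =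
      pre (D.tensorAlgebra R).toHSemicat (n + 1) X X Z ((D.tensorAlgebra R).ids.id X)
        (headComp (D.tensorAlgebra R).toHSemicat (n + 1) X Y Z (tmulHom D p X Y f)
          (diffChain D hp n Y Z x)) -
      pre (D.tensorAlgebra R).toHSemicat (n + 1) X Y Z (tmulHom D p X Y f)
        (diffChain D hp n Y Z x) :=
  (diffProd_pre (idempotentSemifunctor D hp) f x).trans
    (chainMul_chainDiff_single (Nat.add_comm 1 (n + 1)) (tmulHom D p X Y f) (diffChain D hp n Y Z x))

theorem charChain_single {X Z : D.Ob} (f : D.Hom Z X) :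
    charChain D hp 0 X Z (single D.toHSemicat X Z f) =
      single (D.tensorAlgebra R).toHSemicat X Z (tmulHom D p X Z f) := rfl

theorem charChain_pre {n : ℕ} {X Y Z : D.Ob} (f : D.Hom Y X) (x : chains D.toHSemicat n Y Z) :
    charChain D hp (n + 1) X Z (pre D.toHSemicat n X Y Z f x) =
      headComp (D.tensorAlgebra R).toHSemicat (n + 1) X Y Z (tmulHom D p X Y f)
        (diffChain D hp n Y Z x) :=
  charProd_pre (idempotentSemifunctor D hp) f x

theorem charChain_headComp {n : ℕ} {W X Z : D.Ob} (g : D.Hom X W)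
    (x : chains D.toHSemicat n X Z) :
    charChain D hp n W Z (headComp D.toHSemicat n W X Z g x) =
      headComp (D.tensorAlgebra R).toHSemicat n W X Z (tmulHom D p W X g)
        (charChain D hp n X Z x) :=
  charProd_headComp (idempotentSemifunctor D hp) g x

/-- The last factor is `∂(f ⊗ p) = id ⊗ (f ⊗ p) - (f ⊗ p) ⊗ id`. The first term appends `f ⊗ p`; the
second multiplies by it, which `charProd_comp_rhoMap` converts into inner faces, and appends an
identity. -/
theorem charChain_snoc {n : ℕ} {X Y Z : D.Ob} (x : chains D.toHSemicat n X Y) (f : D.Hom Z Y) :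
    charChain D hp (n + 1) X Z (snoc D.toHSemicat n X Y Z x f) =
      snoc (D.tensorAlgebra R).toHSemicat n X Y Z (charChain D hp n X Y x) (tmulHom D p Y Z f) -
      snoc (D.tensorAlgebra R).toHSemicat n X Z Z
        ((-1 : ℂ) ^ n • charChain D hp n X Z (innerFaces n X Z (snoc D.toHSemicat n X Y Z x f)))
        ((D.tensorAlgebra R).ids.id Z) := by
  have h := charProd_comp_rhoMap (idempotentSemifunctor D hp) x f
  refine (charProd_snoc (idempotentSemifunctor D hp) x f).trans
    ((chainMul_chainDiff_single_right (add_zero n) (charChain D hp n X Y x)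
      (tmulHom D p Y Z f)).trans ?_)
  exact congrArg (fun y => snoc (D.tensorAlgebra R).toHSemicat n X Y Z (charChain D hp n X Y x)
    (tmulHom D p Y Z f) - snoc (D.tensorAlgebra R).toHSemicat n X Z Z y
      ((D.tensorAlgebra R).ids.id Z)) h

-- Write `∂(f ⊗ p) y = id ⊗ (f ⊗ p) y - (f ⊗ p) ⊗ y`, where `y` is the remaining product of
-- differentials. The projection of `y` itself vanishes, by the same statement with `g` an identity,
-- so only the first term, whose leading identity is absorbed by `g`, contributes.
include hχ hpχ in
theorem projChain_headComp_diffChain : ∀ {n : ℕ} {W X Z : D.Ob} (g : (D.tensorAlgebra R).Hom X W)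
    (x : chains D.toHSemicat n X Z),
    projChain D χ (n + 1) W Z (headComp (D.tensorAlgebra R).toHSemicat (n + 1) W X Z g
      (diffChain D hp n X Z x)) =
    pre D.toHSemicat n W X Z (projHom D χ W X g) x
  | 0, W, X, Z, g, x => by
    induction x using chains_zero_induction with
    | single f =>
      rw [diffChain_single, projChain_headComp_chainDiff hχ, projChain_single, projHom_tmulHom hpχ]
  | n + 1, W, X, Z, g, x => by
    induction x using chains_succ_induction with
    | zero => simp
    | add x y hx hy => simp only [map_add, hx, hy]
    | pre Y f x =>
      have h := projChain_headComp_diffChain ((D.tensorAlgebra R).ids.id Y) x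
      rw [headComp_id, projHom_id hχ, map_zero, LinearMap.zero_apply] at h
      rw [diffChain_pre, map_sub, map_sub, headComp_pre, headComp_pre, projChain_pre, projChain_pre,
        projChain_headComp_diffChain, h, map_zero, sub_zero, (D.tensorAlgebra R).ids.comp_id,
        projHom_tmulHom hpχ]

include hχ hpχ in
theorem projChain_charChain : ∀ {n : ℕ} {X Z : D.Ob} (x : chains D.toHSemicat n X Z),
    projChain D χ n X Z (charChain D hp n X Z x) = x
  | 0, X, Z, x => by
    induction x using chains_zero_induction with
    | single f => rw [charChain_single, projChain_single, projHom_tmulHom hpχ]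
  | n + 1, X, Z, x => by
    induction x using chains_succ_induction with
    | zero => simp
    | add x y hx hy => simp only [map_add, hx, hy]
    | pre Y f x =>
      rw [charChain_pre, projChain_headComp_diffChain hχ hp hpχ, projHom_tmulHom hpχ]

end

end

end HopfCyclic

namespace HopfCyclic

noncomputable section

open Coalgebra (Repr)

/-! ### Invariance of the last coface, from the anti-Yetter–Drinfeld condition -/

section

variable {H : Type v} [Ring H] [HopfAlgebra ℂ H]
  {M : Type w} [AddCommGroup M] [Module ℂ M] [Module Hᵐᵒᵖ M] [IsScalarTower ℂ Hᵐᵒᵖ M]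

/-- `F(m h₁, S(h₂) x) = ε(h) F(m, x)` if and only if `F(m h, x) = F(m, h x)`. -/
theorem sum_ract_antipode_iff {V : Type*} [AddCommGroup V] [Module ℂ V] [Module H V]
    [IsScalarTower ℂ H V] (F : M →ₗ[ℂ] V →ₗ[ℂ] ℂ) :
    (∀ (h : H) (m : M) (x : V), ∑ i ∈ (Repr.arbitrary ℂ h).index,
      F (ract H M ((Repr.arbitrary ℂ h).left i) m)
        (HopfAlgebra.antipode ℂ ((Repr.arbitrary ℂ h).right i) • x) =
          Coalgebra.counit h * F m x) ↔
    ∀ (h : H) (m : M) (x : V), F (ract H M h m) x = F m (h • x) := by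
  constructor
  · intro hF h m x
    set R := Repr.arbitrary ℂ h
    let L : H →ₗ[ℂ] H →ₗ[ℂ] V :=
      (lact H V).compl₁₂ (HopfAlgebra.antipode ℂ) ((lact H V).flip x)
    let G : H →ₗ[ℂ] H →ₗ[ℂ] H →ₗ[ℂ] ℂ :=
      { toFun := fun a => L.compr₂ (F (ract H M a m))
        map_add' := fun a b => by ext; simp
        map_smul' := fun t a => by ext; simp }
    have := sum_coassoc G R
      (fun i => Repr.arbitrary ℂ (R.left i)) (fun i => Repr.arbitrary ℂ (R.right i))
    refine Eq.trans ?_ (this.symm.trans ?_)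
    · refine (sum_counit_right (F.flip x ∘ₗ (ract H M).flip m) R).symm.trans ?_
      refine Finset.sum_congr rfl fun i _ => ?_
      change _ = ∑ j ∈ _, F (ract H M (R.left i) m)
        (HopfAlgebra.antipode ℂ (_ : H) • (_ : H) • x)
      simp only [smul_smul]
      rw [← map_sum, ← Finset.sum_smul, HopfAlgebra.sum_antipode_mul_eq_smul,
        smul_assoc, one_smul, map_smul]
      rfl
    · refine Eq.trans ?_ (sum_counit_left (F m ∘ₗ (lact H V).flip x) R)
      exact Finset.sum_congr rfl fun i _ => hF (R.left i) m (R.right i • x)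
  · intro hF h m x
    simp only [hF, smul_smul]
    rw [← map_sum, ← Finset.sum_smul, HopfAlgebra.sum_mul_antipode_eq_smul,
      smul_assoc, one_smul, map_smul, smul_eq_mul]

theorem aydTwist_tmul (x y z a : H) (m : M) :
    aydTwist H M (x ⊗ₜ (y ⊗ₜ z)) (a ⊗ₜ m) =
      (HopfAlgebra.antipode ℂ z * a * x) ⊗ₜ[ℂ] ract H M y m := by
  simp [aydTwist, mul_assoc]

theorem coact_ract [BijectiveAntipode H] [SAYDModule H M] {h : H} {ι : Type*} {κ : ι → Type*}
    (R : Repr ℂ h ι) (B : ∀ i, Repr ℂ (R.right i) (κ i)) {m : M} {τ : Type*} {s : Finset τ}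
    {a : τ → H} {m' : τ → M}
    (hm : (SAYDModule.coact m : H ⊗[ℂ] M) = ∑ t ∈ s, a t ⊗ₜ m' t) :
    (SAYDModule.coact (ract H M h m) : H ⊗[ℂ] M) = ∑ t ∈ s, ∑ i ∈ R.index, ∑ j ∈ (B i).index,
      (HopfAlgebra.antipode ℂ ((B i).right j) * a t * R.left i) ⊗ₜ[ℂ]
        ract H M ((B i).left j) (m' t) := by
  rw [SAYDModule.coact_smul, hm, ← R.eq, map_sum]
  refine Finset.sum_congr rfl fun t _ => ?_
  rw [map_sum, map_sum, LinearMap.sum_apply]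
  refine Finset.sum_congr rfl fun i _ => ?_
  rw [LinearMap.lTensor_tmul, ← (B i).eq, TensorProduct.tmul_sum, map_sum, LinearMap.sum_apply]
  exact Finset.sum_congr rfl fun j _ => aydTwist_tmul _ _ _ _ _

variable {C : HSemicat.{u} H}

/-- `h₂((S⁻¹(h₁) g) x) = (h₂ S⁻¹(h₁) g)(h₃ x)`, where `h₂ S⁻¹(h₁)` collapses to the counit. -/
theorem sum_diagAct_headComp [BijectiveAntipode H] {h : H} {ι : Type*} (R : Repr ℂ h ι) {n : ℕ}
    {W X Z : C.Ob} (g : C.Hom X W) (x : chains C n X Z) :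
    ∑ i ∈ R.index, diagAct C n W Z (R.right i)
      (headComp C n W X Z (antipodeInv H (R.left i) • g) x) =
    headComp C n W X Z g (diagAct C n X Z h x) := by
  let L : H →ₗ[ℂ] H →ₗ[ℂ] chains C n W Z :=
    (headComp C n W X Z).compl₁₂ ((lact H (C.Hom X W)).flip g) ((diagAct C n X Z).flip x)
  let G : H →ₗ[ℂ] H →ₗ[ℂ] H →ₗ[ℂ] chains C n W Z :=
    { toFun := fun a => L ∘ₗ LinearMap.mulRight ℂ (antipodeInv H a)
      map_add' := fun a b => by ext; simp [mul_add]
      map_smul' := fun t a => by ext; simp }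
  have := sum_coassoc G R
    (fun i => Repr.arbitrary ℂ (R.left i)) (fun i => Repr.arbitrary ℂ (R.right i))
  refine Eq.trans ?_ (this.symm.trans ?_)
  · refine Finset.sum_congr rfl fun i _ => ?_
    rw [diagAct_headComp (Repr.arbitrary ℂ (R.right i))]
    refine Finset.sum_congr rfl fun j _ => ?_
    rw [smul_smul]; rfl
  · refine Eq.trans ?_ (sum_counit_left (headComp C n W X Z g ∘ₗ (diagAct C n X Z).flip x) R)
    refine Finset.sum_congr rfl fun i _ => ?_
    have h₁ : ∑ j ∈ (Repr.arbitrary ℂ (R.left i)).index, L ((Repr.arbitrary ℂ (R.left i)).right j *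
        antipodeInv H ((Repr.arbitrary ℂ (R.left i)).left j)) (R.right i) =
          (Coalgebra.counit (R.left i) : ℂ) • L 1 (R.right i) := by
      rw [← LinearMap.sum_apply, ← map_sum, sum_right_mul_antipodeInv_left, map_smul,
        LinearMap.smul_apply]
    refine h₁.trans (congrArg _ ?_)
    change headComp C n W X Z ((1 : H) • g) _ = headComp C n W X Z g _
    rw [one_smul]

/-- The previous cancellation in the shape given by the coaction of `m h`: `S⁻¹(S(h₃) a h₁) =
S⁻¹(h₁) S⁻¹(a) h₃`, with `h₂` acting diagonally from outside. -/
theorem sum_diagAct_headComp' [BijectiveAntipode H] {h : H} {ι : Type*} {κ : ι → Type*}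
    (R : Repr ℂ h ι) (B : ∀ i, Repr ℂ (R.right i) (κ i)) {n : ℕ}
    {W X Z : C.Ob} (a : H) (f : C.Hom X W) (x : chains C n X Z) :
    ∑ i ∈ R.index, ∑ j ∈ (B i).index, diagAct C n W Z ((B i).left j) (headComp C n W X Z
      (antipodeInv H (HopfAlgebra.antipode ℂ ((B i).right j) * a * R.left i) • f) x) =
    ∑ i ∈ R.index, headComp C n W X Z (antipodeInv H a • R.right i • f)
      (diagAct C n X Z (R.left i) x) := by
  let G : H →ₗ[ℂ] H →ₗ[ℂ] H →ₗ[ℂ] chains C n W Z :=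
    { toFun := fun b => (diagAct C n W Z).compl₂ ((headComp C n W X Z).flip x ∘ₗ
        lact H (C.Hom X W) (antipodeInv H b) ∘ₗ lact H (C.Hom X W) (antipodeInv H a) ∘ₗ
          (lact H (C.Hom X W)).flip f)
      map_add' := fun a b => by ext; simp
      map_smul' := fun t a => by ext; simp }
  refine Eq.trans (Finset.sum_congr rfl fun i _ => Finset.sum_congr rfl fun j _ => ?_)
    ((sum_coassoc G R (fun i => Repr.arbitrary ℂ (R.left i)) B).symm.trans
      (Finset.sum_congr rfl fun i _ =>
        sum_diagAct_headComp (Repr.arbitrary ℂ (R.left i)) (antipodeInv H a • R.right i • f) x))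
  rw [antipodeInv_mul, antipodeInv_mul, antipodeInv_antipode, mul_smul, mul_smul]
  rfl

end

/-! ### The closed graded trace of a cyclic cochain -/

section CyclicTrace

variable {H : Type v} [Ring H] [HopfAlgebra ℂ H] [BijectiveAntipode H]
  {M : Type w} [AddCommGroup M] [Module ℂ M] [Module Hᵐᵒᵖ M] [IsScalarTower ℂ Hᵐᵒᵖ M]
  [SAYDModule H M] {C : HSemicat.{u} H} {k : ℕ} (ψ : M ⊗[ℂ] CN C k →ₗ[ℂ] ℂ)

theorem hopfCochains_apply (hψ : ψ ∈ hopfCochains C M k) (h : H) (m : M) {X : C.Ob}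
    (x : chains C k X X) :
    ψ (ract H M h m ⊗ₜ loop C k X x) = ψ (m ⊗ₜ loop C k X (diagAct C k X X h x)) := by
  refine (sum_ract_antipode_iff ((TensorProduct.curry ψ).compl₂ (loop C k X))).1 ?_ h m x
  intro h m x
  have := (mem_hopfCochains_iff M ψ).1 hψ h m X x
  rw [rightAct_tmul M (Repr.arbitrary ℂ h), map_sum] at this
  exact this

/-- The map `(m, f⁰ ⊗ … ⊗ fᵏ⁺¹) ↦ ψ(m₍₀₎ ⊗ (S⁻¹(m₍₋₁₎) fᵏ⁺¹) f⁰ ⊗ … ⊗ fᵏ)`. -/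
def lastCoface (X : C.Ob) : M →ₗ[ℂ] chains C (k + 1) X X →ₗ[ℂ] ℂ :=
  (TensorProduct.curry (coface C M k (Fin.last (k + 1)) ψ)).compl₂ (loop C (k + 1) X)

/-- The map `(m, f) ↦ ψ(m ⊗ f f⁰ ⊗ f¹ ⊗ … ⊗ fᵏ)`. -/
def headPairing {X Y : C.Ob} (x : chains C k X Y) : M →ₗ[ℂ] C.Hom X Y →ₗ[ℂ] ℂ :=
  (TensorProduct.curry ψ).compl₂ (loop C k Y ∘ₗ (headComp C k Y X Y).flip x)

theorem headPairing_apply {X Y : C.Ob} (x : chains C k X Y) (m : M) (f : C.Hom X Y) :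
    headPairing ψ x m f = ψ (m ⊗ₜ loop C k Y (headComp C k Y X Y f x)) := rfl

theorem lastCoface_snoc (m : M) {X Y : C.Ob} (x : chains C k X Y) (f : C.Hom X Y) :
    lastCoface ψ X m (snoc C k X Y X x f) = cotwist (H := H) (headPairing ψ x) m f :=
  coface_last_apply ψ m x f

/-- By the anti-Yetter–Drinfeld condition, `m h` has coaction `S(h₃) m₍₋₁₎ h₁ ⊗ m₍₀₎ h₂`. Invariance
of `ψ` transfers `h₂` to the chain, where it cancels against `S⁻¹(h₁)` and leaves the diagonal
action on the chain and its last factor. -/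
theorem lastCoface_ract (hψ : ψ ∈ hopfCochains C M k) (h : H) (m : M) {X : C.Ob}
    (x : chains C (k + 1) X X) :
    lastCoface ψ X (ract H M h m) x = lastCoface ψ X m (diagAct C (k + 1) X X h x) := by
  refine chains_snoc_induction (p := fun x =>
    lastCoface ψ X (ract H M h m) x = lastCoface ψ X m (diagAct C (k + 1) X X h x)) (by simp)
    (fun x y hx hy => by simp only [map_add, hx, hy]) (fun Y y f => ?_) x
  obtain ⟨s, hs⟩ := exists_coact_eq_sum (H := H) m
  set R := Repr.arbitrary ℂ h
  rw [lastCoface_snoc, diagAct_snoc R, map_sum, cotwist_eq_twist,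
    coact_ract R (fun i => Repr.arbitrary ℂ (R.right i)) hs]
  simp only [map_sum, lastCoface_snoc, cotwist_eq_sum _ hs, twist_tmul, headPairing_apply]
  rw [Finset.sum_comm (s := R.index)]
  refine Finset.sum_congr rfl fun t _ => ?_
  simp only [hopfCochains_apply ψ hψ]
  simp only [← map_sum, ← TensorProduct.tmul_sum]
  rw [sum_diagAct_headComp']

end CyclicTrace

end

end HopfCyclic

namespace HopfCyclic

noncomputable section

open Coalgebra (Repr)

/-! ### Closedness and graded trace property of the last coface -/

section CyclicTrace

variable {H : Type v} [Ring H] [HopfAlgebra ℂ H] [BijectiveAntipode H]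
  {M : Type w} [AddCommGroup M] [Module ℂ M] [Module Hᵐᵒᵖ M] [IsScalarTower ℂ Hᵐᵒᵖ M]
  [SAYDModule H M] {C : HSemicat.{u} H} (I : C.Identities) {k : ℕ} {ψ : M ⊗[ℂ] CN C k →ₗ[ℂ] ℂ}

theorem lastCoface_snoc_id (m : M) {X : C.Ob} (x : chains C k X X) :
    lastCoface ψ X m (snoc C k X X X x (I.id X)) = ψ (m ⊗ₜ loop C k X x) := by
  rw [lastCoface_snoc, cotwist_of_invariant _ (fun h => I.smul_id h X), headPairing_apply,
    headComp_id]

theorem cyclicCochains_apply (hψ : ψ ∈ cyclicCochains C M k) (z : M ⊗[ℂ] CN C k) :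
    ψ (cyclicOp C M k z) = (-1 : ℂ) ^ k * ψ z := by
  have h := LinearMap.congr_fun ((mem_cyclicCochains_iff ψ).1 hψ).2 z
  rw [signedCyclic, LinearMap.smul_apply, LinearMap.smul_apply, LinearMap.lcomp_apply,
    smul_eq_mul] at h
  rw [← h, ← mul_assoc, ← mul_pow]
  simp

/-- The last coface multiplies the last factor into the leading identity, which amounts to the
rotation of `x`; cyclicity then supplies the sign. -/
theorem lastCoface_pre_id (hψ : ψ ∈ cyclicCochains C M k) (m : M) {X : C.Ob} (x : chains C k X X) :
    lastCoface ψ X m (pre C k X X X (I.id X) x) = (-1 : ℂ) ^ k * ψ (m ⊗ₜ loop C k X x) := by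
  rw [← cyclicCochains_apply hψ]
  cases k with
  | zero =>
    induction x using chains_zero_induction with
    | single f =>
      rw [← snoc_single, lastCoface_snoc, cyclicOp_loop_single]
      congr 3
      refine LinearMap.ext₂ fun m f => ?_
      rw [headPairing_apply, headComp_single, I.comp_id]
      rfl
  | succ k =>
    refine chains_snoc_induction (p := fun x => lastCoface ψ X m (pre C (k + 1) X X X (I.id X) x) =
      ψ (cyclicOp C M (k + 1) (m ⊗ₜ loop C (k + 1) X x))) (by simp)
      (fun x y hx hy => by simp only [map_add, TensorProduct.tmul_add, hx, hy])
      (fun Y x f => ?_) x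
    rw [← snoc_pre, lastCoface_snoc, cyclicOp_loop_snoc]
    congr 3
    refine LinearMap.ext₂ fun m f => ?_
    rw [headPairing_apply, headComp_pre, I.comp_id]
    rfl

/-- The cochain does not distinguish `f⁰ ∂(f¹ ⊗ … ⊗ fᵏ)` from `f⁰ ⊗ f¹ ⊗ … ⊗ fᵏ`. -/
def IsNormalized : ∀ {k : ℕ} (_ : M ⊗[ℂ] CN C k →ₗ[ℂ] ℂ), Prop
  | 0, _ => True
  | k + 1, ψ => ∀ (m : M) (X Y : C.Ob) (f : C.Hom X Y) (x : chains C k X Y),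
      ψ (m ⊗ₜ loop C (k + 1) Y (headComp C (k + 1) Y X Y f (chainDiff I k X Y x))) =
        ψ (m ⊗ₜ loop C (k + 1) Y (pre C k Y X Y f x))

variable {I}

/-- An identity appended at the end returns the value of `ψ` up to sign. By normalization the other
insertions together give `ψ` at the rotated chain. Cyclicity makes these two contributions cancel.
-/
theorem lastCoface_chainDiff (hψ : ψ ∈ cyclicCochains C M k) (hI : IsNormalized I ψ) (m : M)
    {X : C.Ob} (x : chains C k X X) : lastCoface ψ X m (chainDiff I k X X x) = 0 := by
  cases k with
  | zero =>
    induction x using chains_zero_induction with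
    | single f =>
      rw [chainDiff_single, map_sub, lastCoface_pre_id I hψ, ← snoc_single, lastCoface_snoc_id]
      simp
  | succ k =>
    refine chains_snoc_induction (p := fun x => lastCoface ψ X m (chainDiff I (k + 1) X X x) = 0)
      (by simp) (fun x y hx hy => by rw [map_add, map_add, hx, hy, add_zero]) (fun Y x f => ?_) x
    have h₁ : headPairing ψ (chainDiff I k X Y x) = (TensorProduct.curry ψ).compl₂
        (loop C (k + 1) Y ∘ₗ (pre C k Y X Y).flip x) :=
      LinearMap.ext₂ fun m f => hI m X Y f x
    rw [chainDiff_snoc, map_add, map_smul, lastCoface_snoc_id, lastCoface_snoc, h₁,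
      ← cyclicOp_loop_snoc, cyclicCochains_apply hψ, pow_succ, smul_eq_mul]
    ring

variable (I ψ) in
/-- The last coface as a functional on the endomorphisms of degree `k + 1` of the universal
DGH-semicategory. -/
def lastCofaceUniv (X : (universalDGH I).Ob) :
    M →ₗ[ℂ] (universalDGH I).Hom (k + 1) X X →ₗ[ℂ] ℂ := lastCoface ψ X

variable (I ψ) in
/-- The graded trace property with respect to a fixed morphism. -/
def IsTraceFor (i : ℕ) {X Y : (universalDGH I).Ob} (g : (universalDGH I).Hom i X Y) : Prop :=
  ∀ ⦃j : ℕ⦄ (hij : i + j = k + 1) (hji : j + i = k + 1) (m : M) (g' : (universalDGH I).Hom j Y X),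
    lastCofaceUniv I ψ X m ((universalDGH I).comp hji g' g) = (-1 : ℂ) ^ (i * j) *
      cotwist (H := H) ((lastCofaceUniv I ψ Y).compl₂ (((universalDGH I).comp hij).flip g')) m g

theorem IsTraceFor.zero {i : ℕ} {X Y : (universalDGH I).Ob} :
    IsTraceFor I ψ i (0 : (universalDGH I).Hom i X Y) := by
  intro j hij hji m g'
  simp only [map_zero, mul_zero]

theorem IsTraceFor.add {i : ℕ} {X Y : (universalDGH I).Ob} {g₁ g₂ : (universalDGH I).Hom i X Y}
    (h₁ : IsTraceFor I ψ i g₁) (h₂ : IsTraceFor I ψ i g₂) : IsTraceFor I ψ i (g₁ + g₂) := by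
  intro j hij hji m g'
  simp only [map_add, mul_add]
  rw [h₁ hij hji, h₂ hij hji]

/-- Rotate `g₂` first, then `g₁`; `cotwist_bilinear` matches the successive twists with the twist of
the product. The two exponents add up to `(i₁ + i₂) j` modulo `2`, so the trace property need only
be checked on generators. -/
theorem IsTraceFor.comp {i₁ i₂ i : ℕ} (hi : i₁ + i₂ = i) {X Y Z : (universalDGH I).Ob}
    {g₁ : (universalDGH I).Hom i₁ Y Z} {g₂ : (universalDGH I).Hom i₂ X Y}
    (h₁ : IsTraceFor I ψ i₁ g₁) (h₂ : IsTraceFor I ψ i₂ g₂) :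
    IsTraceFor I ψ i ((universalDGH I).comp hi g₁ g₂) := by
  intro j hij hji m g'
  obtain ⟨s, hs⟩ := exists_coact_eq_sum (H := H) m
  rw [← (universalDGH I).assoc (s := j + i₁) rfl hi (by omega) hji, h₂ (by omega) (by omega),
    cotwist_eq_sum _ hs, cotwist_bilinear _ ((universalDGH I).comp hi)
      (fun R g f => (universalDGH I).smul_comp_sum hi R g f) hs, Finset.mul_sum, Finset.mul_sum]
  refine Finset.sum_congr rfl fun t _ => ?_
  set g₂' := antipodeInv H t.1 • g₂
  have e₁ : (universalDGH I).comp (show i₂ + (j + i₁) = k + 1 by omega) g₂'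
      ((universalDGH I).comp rfl g' g₁) =
      (universalDGH I).comp (show (i₂ + j) + i₁ = k + 1 by omega)
        ((universalDGH I).comp rfl g₂' g') g₁ :=
    ((universalDGH I).assoc rfl rfl (by omega) (by omega) g₂' g' g₁).symm
  have e₂ : ((lastCofaceUniv I ψ Z).compl₂ (((universalDGH I).comp hij).flip g')).compl₂
      (((universalDGH I).comp hi).flip g₂') = (lastCofaceUniv I ψ Z).compl₂
        (((universalDGH I).comp (show i₁ + (i₂ + j) = k + 1 by omega)).flip
          ((universalDGH I).comp rfl g₂' g')) :=
    LinearMap.ext₂ fun m f => congrArg (lastCofaceUniv I ψ Z m)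
      ((universalDGH I).assoc hi rfl (by omega) (by omega) f g₂' g')
  rw [e₂]
  refine (congrArg (fun x => _ * lastCofaceUniv I ψ Y t.2 x) e₁).trans ?_
  rw [h₁ (by omega), ← mul_assoc, ← pow_add]
  congr 1
  rw [← hi]
  rw [show i₂ * (j + i₁) + i₁ * (i₂ + j) = (i₁ + i₂) * j + 2 * (i₁ * i₂) by ring, pow_add,
    pow_mul _ 2, neg_one_sq, one_pow, mul_one]

/-- Both sides multiply `a`, then `f`, into the head of the remaining chain after twisting, so this
is associativity together with `cotwist_bilinear`. Cyclicity of `ψ` plays no role in degree zero. -/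
theorem isTraceFor_single {X Y : C.Ob} (f : C.Hom X Y) :
    IsTraceFor I ψ 0 (X := X) (Y := Y) (single C Y X f) := by
  intro j hij hji m g'
  obtain rfl : j = k + 1 := by omega
  obtain ⟨s, hs⟩ := exists_coact_eq_sum (H := H) m
  rw [zero_mul, pow_zero, one_mul]
  refine chains_snoc_induction (p := fun g' => lastCofaceUniv I ψ X m
    ((universalDGH I).comp hji g' (single C Y X f)) = cotwist (H := H)
      ((lastCofaceUniv I ψ Y).compl₂ (((universalDGH I).comp hij).flip g')) m (single C Y X f))
    ?_ (fun x y hx hy => ?_) (fun W y a => ?_) g'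
  · rw [cotwist_eq_sum _ hs]; simp
  · rw [cotwist_eq_sum _ hs] at hx hy ⊢
    simp only [map_add, LinearMap.add_apply, LinearMap.compl₂_apply, hx, hy, LinearMap.flip_apply,
      Finset.sum_add_distrib]
  · refine (congrArg (lastCoface ψ X m) (chainMul_snoc_single hji y a f)).trans ?_
    rw [lastCoface_snoc, cotwist_bilinear _ C.comp (fun R g f => C.smul_comp_sum R g f) hs,
      cotwist_eq_sum _ hs]
    refine Finset.sum_congr rfl fun t _ => ?_
    refine Eq.trans ?_ (congrArg (lastCoface ψ Y t.2)
      (headComp_snoc (antipodeInv H t.1 • f) y a)).symm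
    rw [lastCoface_snoc]
    congr 3
    refine LinearMap.ext₂ fun m a => ?_
    rw [headPairing_apply, headComp_headComp]
    rfl

/-- Here cyclicity enters: multiplying by `id ⊗ id` on the right appends an identity and on the left
prepends one. The last coface takes these to `ψ` and `(-1)ᵏ ψ`. -/
theorem isTraceFor_id (hψ : ψ ∈ cyclicCochains C M k) (X : C.Ob) :
    IsTraceFor I ψ 1 (X := X) (Y := X) (pre C 0 X X X (I.id X) (single C X X (I.id X))) := by
  intro j hij hji m g'
  obtain rfl : j = k := by omega
  have hinv : ∀ h : H, h • pre C 0 X X X (I.id X) (single C X X (I.id X)) =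
      (Coalgebra.counit h : ℂ) • pre C 0 X X X (I.id X) (single C X X (I.id X)) := fun h => by
    rw [chains_smul_def, diagAct_pre_id, diagAct_single, I.smul_id]
    simp only [map_smul]
  rw [cotwist_of_invariant _ hinv]
  refine (congrArg (lastCoface ψ X m) (chainMul_pre_single (add_zero j) hji g' _ _)).trans ?_
  rw [chainMul_single_id, lastCoface_snoc_id, one_mul]
  refine Eq.trans ?_ (congrArg (fun x => (-1 : ℂ) ^ j * lastCoface ψ X m x)
    (chainMul_pre (n := j) hij (zero_add j) _ _ _)).symm
  rw [chainMul_single, headComp_id, lastCoface_pre_id I hψ, ← mul_assoc, ← mul_pow]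
  simp

theorem isTraceFor (hψ : ψ ∈ cyclicCochains C M k) : ∀ {i : ℕ} {X Y : C.Ob} (g : chains C i Y X),
    IsTraceFor I ψ i (X := X) (Y := Y) g
  | 0, X, Y, g => isTraceFor_single g
  | i + 1, X, Y, g => by
    refine chains_succ_induction (p := fun g => IsTraceFor I ψ (i + 1) (X := X) (Y := Y) g)
      IsTraceFor.zero (fun x y hx hy => IsTraceFor.add hx hy) (fun Z f x => ?_) g
    -- A chain `f ⊗ x` factors as `f · (id ⊗ id) · x`, so morphisms of degree zero and the elements
    -- `id ⊗ id` generate all chains.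
    have h := IsTraceFor.comp (zero_add (i + 1)) (isTraceFor_single f)
      (IsTraceFor.comp (Nat.add_comm 1 i) (isTraceFor_id hψ Z) (isTraceFor hψ x))
    have e : (universalDGH I).comp (zero_add (i + 1)) (single C Y Z f)
        ((universalDGH I).comp (Nat.add_comm 1 i)
          (pre C 0 Z Z Z (I.id Z) (single C Z Z (I.id Z))) x) = pre C i Y Z X f x := by
      refine (congrArg (headComp C (i + 1) Y Z X f)
        (chainMul_pre (Nat.add_comm 1 i) (zero_add i) _ _ _)).trans ?_
      rw [headComp_pre, I.comp_id, chainMul_single, headComp_id]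
    rw [← e]
    exact h

variable (I) in
/-- The closed graded trace on the universal DGH-semicategory given by a normalized cyclic
cochain. -/
def cyclicTrace (hψ : ψ ∈ cyclicCochains C M k) (hI : IsNormalized I ψ) :
    ClosedGradedTrace (universalDGH I) M (k + 1) :=
  -- The global sign is that of the last coface in `b`; with it the character becomes `bψ` itself.
  .ofBilinear (fun X => (-1 : ℂ) ^ (k + 1) • lastCofaceUniv I ψ X)
    (fun X => (sum_ract_antipode_iff _).2 fun h m x =>
      congrArg ((-1 : ℂ) ^ (k + 1) * ·) (lastCoface_ract ψ hψ.1 h m x))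
    (fun X m p hp x => by
      obtain rfl : p = k := by omega
      refine (congrArg ((-1 : ℂ) ^ (p + 1) * ·) (lastCoface_chainDiff hψ hI m x)).trans ?_
      exact mul_zero _)
    (fun {X Y i j} hij hji m g g' => by
      refine (congrArg ((-1 : ℂ) ^ (k + 1) * ·) (isTraceFor hψ g hij hji m g')).trans ?_
      obtain ⟨s, hs⟩ := exists_coact_eq_sum (H := H) m
      rw [cotwist_eq_sum _ hs, cotwist_eq_sum _ hs, mul_left_comm, Finset.mul_sum]
      rfl)

end CyclicTrace

end

end HopfCyclic

namespace HopfCyclic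

noncomputable section

open Coalgebra (Repr)

/-! ### The cycle of a cyclic cochain and its character -/

section Realization

variable {H : Type v} [Ring H] [HopfAlgebra ℂ H] [BijectiveAntipode H] {D : HCat.{u} H}
  {M : Type w} [AddCommGroup M] [Module ℂ M] [Module Hᵐᵒᵖ M] [IsScalarTower ℂ Hᵐᵒᵖ M]
  [SAYDModule H M] {R : Type} [Ring R] [Algebra ℂ R] {k : ℕ}

/-- The pullback of a cochain along the projection of chains. -/
def pullback (χ : R →ₗ[ℂ] ℂ) (ψ : M ⊗[ℂ] CN D.toHSemicat k →ₗ[ℂ] ℂ) :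
    M ⊗[ℂ] CN (D.tensorAlgebra R).toHSemicat k →ₗ[ℂ] ℂ :=
  ψ ∘ₗ (loopLift (D.tensorAlgebra R).toHSemicat fun (X : D.Ob) =>
    loop D.toHSemicat k X ∘ₗ projChain D χ k X X).lTensor M

variable (χ : R →ₗ[ℂ] ℂ) (ψ : M ⊗[ℂ] CN D.toHSemicat k →ₗ[ℂ] ℂ)

theorem pullback_loop (m : M) {X : D.Ob} (x : chains (D.tensorAlgebra R).toHSemicat k X X) :
    pullback χ ψ (m ⊗ₜ loop (D.tensorAlgebra R).toHSemicat k X x) =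
      ψ (m ⊗ₜ loop D.toHSemicat k X (projChain D χ k X X x)) := by
  rw [pullback, LinearMap.comp_apply, LinearMap.lTensor_tmul, loopLift_loop]; rfl

variable {ψ}

/-- The functional `χ` is applied to each factor separately and `H` acts on the `D` part only, so
the projection commutes with the diagonal action and with rotation. No trace property of `χ` is
needed. -/
theorem pullback_mem (hψ : ψ ∈ cyclicCochains D.toHSemicat M k) :
    pullback χ ψ ∈ cyclicCochains (D.tensorAlgebra R).toHSemicat M k := by
  rw [mem_cyclicCochains_iff, mem_hopfCochains_iff]
  constructor
  · intro h m X x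
    rw [pullback_loop, ← (mem_hopfCochains_iff M ψ).1 hψ.1,
      rightAct_tmul M (Repr.arbitrary ℂ h), rightAct_tmul M (Repr.arbitrary ℂ h), map_sum, map_sum]
    exact Finset.sum_congr rfl fun i _ => by rw [pullback_loop, projChain_diagAct]
  · rw [signedCyclic, LinearMap.smul_apply]
    have hs : ∀ a : ℂ, (-1 : ℂ) ^ k * ((-1 : ℂ) ^ k * a) = a := fun a => by
      rw [← mul_assoc, ← mul_pow]; simp
    cases k with
    | zero =>
      refine cochain_ext fun m X x => ?_
      induction x using chains_zero_induction with
      | single f =>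
        rw [LinearMap.smul_apply, LinearMap.lcomp_apply, cyclicOp_loop_single, pullback_loop,
          projChain_single, smul_eq_mul]
        refine Eq.trans (congrArg _ ?_) (hs _)
        rw [← cyclicCochains_apply hψ, cyclicOp_loop_single, ← cotwist_comp _ (projHom D χ X X)
          (projHom_smul χ)]
        congr 3
        exact LinearMap.ext₂ fun m f => pullback_loop χ ψ m _
    | succ k =>
      refine cochain_ext_snoc fun m X Y x f => ?_
      rw [LinearMap.smul_apply, LinearMap.lcomp_apply, cyclicOp_loop_snoc, pullback_loop,
        projChain_snoc, smul_eq_mul]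
      refine Eq.trans (congrArg _ ?_) (hs _)
      rw [← cyclicCochains_apply hψ, cyclicOp_loop_snoc, ← cotwist_comp _ (projHom D χ Y X)
        (projHom_smul χ)]
      congr 3
      refine LinearMap.ext₂ fun m f => (pullback_loop χ ψ m _).trans ?_
      exact congrArg (fun y => ψ (m ⊗ₜ loop D.toHSemicat (k + 1) Y y)) (projChain_pre χ f x)

variable {χ}

theorem isNormalized_pullback (hχ : χ 1 = 0) : ∀ {k : ℕ} (ψ : M ⊗[ℂ] CN D.toHSemicat k →ₗ[ℂ] ℂ),
    IsNormalized (D.tensorAlgebra R).ids (pullback χ ψ)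
  | 0, _ => trivial
  | k + 1, ψ => fun m X Y f x => by
    rw [pullback_loop, pullback_loop, projChain_headComp_chainDiff hχ, projChain_pre]

variable {p : R}

/-- The cycle over `D` given by a cyclic cochain. -/
def cyclicCycle (hψ : ψ ∈ cyclicCochains D.toHSemicat M k) (hχ : χ 1 = 0) (hp : p * p = p) :
    Cycle D M (k + 1) where
  S := universalDGH (D.tensorAlgebra R).ids
  trace := cyclicTrace _ (pullback_mem χ hψ) (isNormalized_pullback hχ ψ)
  ρobj X := X
  ρ := idempotentSemifunctor D hp

/-- By `charChain_snoc` the trace has two terms. The appended `f ⊗ p` gives the last coface of `ψ`,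
because `charChain` is a section of the projection. The appended identity gives the alternating
inner faces, and the signs combine to `+1` on them. -/
theorem cyclicCycle_character (hψ : ψ ∈ cyclicCochains D.toHSemicat M k) (hχ : χ 1 = 0)
    (hp : p * p = p) (hpχ : χ p = 1) :
    (cyclicCycle hψ hχ hp).character = hochschild D.toHSemicat M k ψ := by
  refine cochain_ext_snoc fun m X Y y f => ?_
  refine (traceCochain_loop (cyclicCycle hψ hχ hp).trace (obj := fun X => X)
    (fun X => charProd (idempotentSemifunctor D hp) (k + 1) X X) m _).trans ?_
  change (-1 : ℂ) ^ (k + 1) * lastCoface (pullback χ ψ) X m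
    (charChain D hp (k + 1) X X (snoc D.toHSemicat k X Y X y f)) = _
  have h : cotwist (H := H) (headPairing (pullback χ ψ) (charChain D hp k X Y y)) m
      (tmulHom D p Y X f) = cotwist (H := H) (headPairing ψ y) m f := by
    rw [← cotwist_comp _ (tmulHom D p Y X) (fun h f => rfl)]
    congr 3
    refine LinearMap.ext₂ fun m f => (pullback_loop χ ψ m _).trans ?_
    refine congrArg (fun y => ψ (m ⊗ₜ loop D.toHSemicat k Y y)) ?_
    refine (congrArg (projChain D χ k Y Y) (charChain_headComp hp f y).symm).trans ?_
    exact projChain_charChain hχ hp hpχ _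
  rw [hochschild_apply, charChain_snoc, map_sub, lastCoface_snoc, lastCoface_snoc_id, h,
    pullback_loop, map_smul, projChain_charChain hχ hp hpχ, map_smul, TensorProduct.tmul_smul,
    map_smul, smul_eq_mul, mul_sub, ← mul_assoc, ← pow_add,
    Odd.neg_one_pow (n := k + 1 + k) ⟨k, by ring⟩]
  change _ = _ + _ * cotwist (H := H) (headPairing ψ y) m f
  ring

end Realization

/-! ### Choice of `R`, `χ` and `p`, and existence of vanishing cycles -/

section Existence

variable {H : Type v} [Ring H] [HopfAlgebra ℂ H] (D : HCat.{u} H)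

/-- Sequences of complex numbers are two-sided sequences of such sequences. -/
def seqEquiv : (ℕ → ℂ) ≃ₗ[ℂ] (ℤ → ℕ → ℂ) :=
  LinearEquiv.funCongrLeft ℂ ℂ (Denumerable.eqv (ℤ × ℕ)) ≪≫ₗ LinearEquiv.curry ℂ ℂ ℤ ℕ

/-- The degree-zero part of the universal DGH-semicategory is by definition the category it is built
from, so the swindle applies directly. -/
theorem satisfiesVanishing_universalDGH :
    (HCat.mk (universalDGH (D.tensorAlgebra (Module.End ℂ (ℕ → ℂ))).ids).degZero
      ⟨(D.tensorAlgebra (Module.End ℂ (ℕ → ℂ))).ids.id,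
        (D.tensorAlgebra (Module.End ℂ (ℕ → ℂ))).ids.id_comp,
        (D.tensorAlgebra (Module.End ℂ (ℕ → ℂ))).ids.comp_id,
        (D.tensorAlgebra (Module.End ℂ (ℕ → ℂ))).ids.smul_id⟩).SatisfiesVanishing :=
  satisfiesVanishing_end seqEquiv D

/-- The projection of a sequence on its first entry. -/
def firstProj : Module.End ℂ (ℕ → ℂ) := LinearMap.single ℂ (fun _ => ℂ) 0 ∘ₗ LinearMap.proj 0

/-- The difference of the first two diagonal entries of an endomorphism. -/
def diagDifference : Module.End ℂ (ℕ → ℂ) →ₗ[ℂ] ℂ where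
  toFun r := r (Pi.single 0 1) 0 - r (Pi.single 1 1) 1
  map_add' r s := by simp; ring
  map_smul' t r := by simp; ring

/-- The second diagonal entry is subtracted precisely for this: the functional kills the identity
and still takes the value `1` on the projection to the first entry. -/
theorem diagDifference_one : diagDifference 1 = 0 := by simp [diagDifference]

theorem firstProj_mul_self : firstProj * firstProj = firstProj := by
  refine LinearMap.ext fun x => ?_
  simp [firstProj]

theorem diagDifference_firstProj : diagDifference firstProj = 1 := by
  simp [diagDifference, firstProj]

variable {D} [BijectiveAntipode H]
  {M : Type w} [AddCommGroup M] [Module ℂ M] [Module Hᵐᵒᵖ M] [IsScalarTower ℂ Hᵐᵒᵖ M]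
  [SAYDModule H M]

theorem exists_isVanishing_of_mem_cyclicCochains {k : ℕ}
    {ψ : M ⊗[ℂ] CN D.toHSemicat k →ₗ[ℂ] ℂ} (hψ : ψ ∈ cyclicCochains D.toHSemicat M k) :
    ∃ Γ : Cycle D M (k + 1), Γ.IsVanishing ∧ hochschild D.toHSemicat M k ψ = Γ.character :=
  ⟨cyclicCycle hψ diagDifference_one firstProj_mul_self, ⟨_, satisfiesVanishing_universalDGH D⟩,
    (cyclicCycle_character hψ diagDifference_one firstProj_mul_self
      diagDifference_firstProj).symm⟩

/-- The zero trace on the same universal cycle. It serves degree `0`, where no cyclic cochain of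
lower degree is available. -/
theorem exists_isVanishing_character_eq_zero (n : ℕ) :
    ∃ Γ : Cycle D M n, Γ.IsVanishing ∧ Γ.character = 0 := by
  let T : ClosedGradedTrace (universalDGH (D.tensorAlgebra (Module.End ℂ (ℕ → ℂ))).ids) M n :=
    .ofBilinear (fun _ => 0) (fun _ _ _ _ => by simp) (fun _ _ _ _ _ => rfl)
      (fun {X Y i j} hij hji m g g' => by
        obtain ⟨s, hs⟩ := exists_coact_eq_sum (H := H) m
        rw [cotwist_eq_sum _ hs]
        simp)
  refine ⟨⟨_, T, fun X => X, idempotentSemifunctor D firstProj_mul_self⟩,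
    ⟨_, satisfiesVanishing_universalDGH D⟩, cochain_ext fun m X x => ?_⟩
  exact traceCochain_loop T (obj := fun X => X) _ m x

end Existence

end

end HopfCyclic

/-- A Hopf-cyclic `n`-cochain of a left `H`-category `D`, with coefficients in a stable
anti-Yetter-Drinfeld module `M`, is a coboundary if and only if it is the character of an
`n`-dimensional vanishing cycle over `D`. -/
theorem theorem5p9 {H : Type v} [Ring H] [HopfAlgebra ℂ H]
    [HopfCyclic.BijectiveAntipode H] (D : HopfCyclic.HCat.{u, v} H)
    (M : Type w) [AddCommGroup M] [Module ℂ M] [Module Hᵐᵒᵖ M] [IsScalarTower ℂ Hᵐᵒᵖ M]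
    [HopfCyclic.SAYDModule H M] (n : ℕ)
    (φ : HopfCyclic.hopfCochains D.toHSemicat M n) :
    φ.1 ∈ HopfCyclic.coboundaries D.toHSemicat M n ↔
      ∃ Γ : HopfCyclic.Cycle D M n, Γ.IsVanishing ∧ φ.1 = Γ.character := by
  constructor
  · intro h
    cases n with
    | zero =>
      obtain ⟨Γ, hΓ, h₀⟩ := HopfCyclic.exists_isVanishing_character_eq_zero (D := D) (M := M) 0
      exact ⟨Γ, hΓ, ((Submodule.mem_bot ℂ).1 h).trans h₀.symm⟩
    | succ k =>
      obtain ⟨ψ, hψ, h⟩ := h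
      rw [← h]
      exact HopfCyclic.exists_isVanishing_of_mem_cyclicCochains hψ
  · rintro ⟨Γ, hΓ, h⟩
    rw [h]
    exact hΓ.character_mem
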